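/- **Setting.** Let $P$ be a set of propositional letters and $I$ a set of agents with $|I|\ge 2$, whose elements are named by distinct binary words (fixed injections of $P$ and $I$ into $\{0,1\}^*$). Formulas are $\phi ::= \bot\mid p\mid\neg\phi\mid(\phi\land\phi)\mid K_i\phi\mid Kh_i\phi$ ($p\in P$, $i\in I$); they are written as words over a finite alphabet in Polish notation, using these names, and $|\phi|$ is the length of this word. Let $\mathrm{sub}^+(\phi)=\{\psi,\neg\psi\mid\psi\text{ a subformula of }\phi\}\cup\{K_i\psi,\neg K_i\psi\mid Kh_i\psi\text{ a subformula of }\phi\}$. A set of formulas is *blatantly inconsistent* if it contains $\bot$ or contains both $\phi$ and $\neg\phi$ for some formula $\phi$. **The tableau $\mathscr T_{\phi_0}$.** It is a rooted and-or tree with a label $L(n)$ (a set of formulas) on each node and a label on each edge: $\varepsilon$, an agent $i$, or an action $a_{Kh_i\psi}$. The root is labelled $\{\phi_0\}$. Blatantly inconsistent nodes and blocked nodes (defined below) are leaves. At every other node $n$ the unchecked formulas of $L(n)$ are checked one after the other, in an arbitrary given linear order (which may depend on the node). Checking $\phi\in L(n)$ means the following. To $\phi$ belongs a list of sets of formulas: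 - to $\neg\neg\psi$: $\{\psi\}$; - to $\phi_1\land\phi_2$: $\{\phi_1,\phi_2\}$; - to $\neg(\phi_1\land\phi_2)$: $\{\neg\phi_1,\neg\phi_2\},\{\neg\phi_1,\phi_2\},\{\phi_1,\neg\phi_2\}$; - to $K_i\psi$: $\{\psi\}$; - to $\neg K_i\psi$: $\{\neg\psi\},\{\psi\}$; - to $Kh_i\psi$: $\{\neg K_i\psi\},\{K_i\psi\}$; - to $\neg Kh_i\psi$: $\{\neg K_i\psi\}$; - to any other formula: the empty list. If the list is empty or one of its sets is contained in $L(n)$, then $\phi$ is just marked as checked at $n$. Otherwise $n$ is an "or" node: for each set $A$ in the list it gets a successor $n'$ with $L(n')=L(n)\cup A$ and edge label $\varepsilon$, at which $\phi$ and the formulas checked at $n$ count as checked. If all formulas of $L(n)$ get checked without creating successors, $n$ is an "and" node and gets the following successors, at which nothing is checked yet: 1. for each $\neg K_i\psi\in L(n)$, with $\Sigma$ the set consisting of $\neg\psi$ and of all formulas in $L(n)$ of the forms $K_i\chi$, $\neg K_i\chi$, $Kh_i\chi$, $\neg Kh_i\chi$: a successor with label $\Sigma$ and edge label $i$, unless some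 $n'$ with $L(n')=\Sigma$ is an $i$-ancestor of $n$, i.e. there is a path (possibly of length $0$) from $n'$ down to $n$ with all edges labelled $i$ or $\varepsilon$; 2. for all $Kh_i\psi,\neg K_i\psi\in L(n)$: a successor with label $\{K_i\psi\}$ and edge label $a_{Kh_i\psi}$; 3. for all $\neg Kh_i\chi,Kh_i\psi,\neg K_i\psi\in L(n)$: a successor with label $\{K_i\psi,\neg Kh_i\chi\}$ and edge label $a_{Kh_i\psi}$; this successor is *blocked* if some proper ancestor of it has the same label. A *complete subtree* contains the root and with each node its parent, all children of each of its "and" nodes, and at least one child of each of its "or" nodes that has children in $\mathscr T_{\phi_0}$. The tableau $\mathscr T_{\phi_0}$ is *closed* if every complete subtree has a blatantly inconsistent node. **Statement.** There is an algorithm (a multi-stack Turing machine) that uses space at most $p(|\phi_0|)$, for some polynomial $p$, and that on every input $\phi_0$ halts and decides whether $\mathscr T_{\phi_0}$ is closed, whatever orders are used in the construction of $\mathscr T_{\phi_0}$. Moreover, for every $\phi_0$ and all such orders, with $m=|\mathrm{sub}^+(\phi_0)|$, every node of $\mathscr T_{\phi_0}$ has at most $m+m^2+m^3$ children, and the height of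 $\mathscr T_{\phi_0}$ (the maximal number of edges on a path from the root) is at most $m^6$. -/

import Mathlib

namespace ELKh

universe u v

/-! ## Formulas -/

/-- Formulas over letters `P` and agents `I`:
`φ ::= ⊥ | p | ¬φ | (φ ∧ φ) | K_i φ | Kh_i φ`. -/
inductive Form (P : Type u) (I : Type v) : Type (max u v)
  | bot : Form P I
  | letter (p : P) : Form P I
  | neg (φ : Form P I) : Form P I
  | and (φ ψ : Form P I) : Form P I
  | K (i : I) (φ : Form P I) : Form P I
  | Kh (i : I) (φ : Form P I) : Form P I

section
variable {P : Type u} {I : Type v}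

namespace Form

/-- The set of subformulas of a formula (the formula itself included). -/
def sub : Form P I → Set (Form P I)
  | bot => {bot}
  | letter p => {letter p}
  | neg φ => insert (neg φ) φ.sub
  | and φ ψ => insert (and φ ψ) (φ.sub ∪ ψ.sub)
  | K i φ => insert (K i φ) φ.sub
  | Kh i φ => insert (Kh i φ) φ.sub

/-- `sub⁺(φ) = {ψ, ¬ψ | ψ a subformula of φ} ∪ {K_i ψ, ¬K_i ψ | Kh_i ψ a subformula of φ}`. -/
def subPlus (φ : Form P I) : Set (Form P I) :=
  {χ | ∃ ψ ∈ φ.sub, χ = ψ ∨ χ = neg ψ} ∪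
    {χ | ∃ i ψ, Kh i ψ ∈ φ.sub ∧ (χ = K i ψ ∨ χ = neg (K i ψ))}

/-- The alternatives that the propositional part of the construction offers when a formula is checked:
each member of the list is the set of formulas added at one of the successors.  The list is empty
for the forms of formulas that have no expansion. -/
def expansions : Form P I → List (Set (Form P I))
  | neg (neg ψ) => [{ψ}]
  | and φ ψ => [{φ, ψ}]
  | neg (and φ ψ) => [{neg φ, neg ψ}, {neg φ, ψ}, {φ, neg ψ}]
  | K _ ψ => [{ψ}]
  | neg (K _ ψ) => [{neg ψ}, {ψ}]
  | Kh i ψ => [{neg (K i ψ)}, {K i ψ}]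
  | neg (Kh i ψ) => [{neg (K i ψ)}]
  | _ => []

end Form

open Form

/-- Checking `φ` at a node with label `Γ` creates successors: there are alternatives, and none of
them is already contained in `Γ`. -/
def Active (Γ : Set (Form P I)) (φ : Form P I) : Prop :=
  φ.expansions ≠ [] ∧ ∀ A ∈ φ.expansions, ¬ A ⊆ Γ

/-- `Γ` contains `⊥`, or some formula together with its negation. -/
def BlatantlyInconsistent (Γ : Set (Form P I)) : Prop :=
  (∃ φ, φ ∈ Γ ∧ neg φ ∈ Γ) ∨ bot ∈ Γ

/-- `(Γ|K_i) ∪ (Γ|¬K_i) ∪ (Γ|Kh_i) ∪ (Γ|¬Kh_i)`. -/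
def modalPart (i : I) (Γ : Set (Form P I)) : Set (Form P I) :=
  {φ ∈ Γ | ∃ ψ, φ = K i ψ ∨ φ = neg (K i ψ) ∨ φ = Kh i ψ ∨ φ = neg (Kh i ψ)}

/-- `Σ(n, ¬K_i ψ)` for a node `n` with label `Γ`. -/
def diamondLabel (i : I) (ψ : Form P I) (Γ : Set (Form P I)) : Set (Form P I) :=
  insert (neg ψ) (modalPart i Γ)

/-! ## The tableau

A node of the tableau is named by the sequence of successor choices that leads to it from the root,
most recent choice first; the root is `[]`, the parent of `s :: n` is `n`, and the ancestors of a
node are its suffixes. -/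

/-- The name of a successor of a node. -/
inductive Succ (P : Type u) (I : Type v) : Type (max u v)
  /-- the `k`-th (from `0`) successor, with edge label `ε`, obtained by checking the formula `φ` -/
  | expand (φ : Form P I) (k : ℕ) : Succ P I
  /-- the successor created for `¬K_i ψ` -/
  | dia (i : I) (ψ : Form P I) : Succ P I
  /-- the successor created for the pair `Kh_i ψ`, `¬K_i ψ` -/
  | how (i : I) (ψ : Form P I) : Succ P I
  /-- the successor created for the triple `¬Kh_i χ`, `Kh_i ψ`, `¬K_i ψ` -/
  | negHow (i : I) (χ ψ : Form P I) : Succ P I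

/-- Nodes, as sequences of successor choices. -/
abbrev Node (P : Type u) (I : Type v) := List (Succ P I)

/-- Labels of edges: `ε`, an agent `i`, or an action `a_{Kh_i ψ}`. -/
inductive EdgeLabel (P : Type u) (I : Type v) : Type (max u v)
  | eps : EdgeLabel P I
  | agent (i : I) : EdgeLabel P I
  | action (i : I) (ψ : Form P I) : EdgeLabel P I

/-- The label of the edge from a node to its successor. -/
def Succ.edge : Succ P I → EdgeLabel P I
  | expand _ _ => .eps
  | dia i _ => .agent i
  | how i ψ => .action i ψ
  | negHow i _ ψ => .action i ψ

/-- The formula set `L(n)` labelling the node `n` of the tableau for `φ₀`. -/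
def label (φ₀ : Form P I) : Node P I → Set (Form P I)
  | [] => {φ₀}
  | .expand φ k :: n => label φ₀ n ∪ φ.expansions.getD k ∅
  | .dia i ψ :: n => diamondLabel i ψ (label φ₀ n)
  | .how i ψ :: _ => {K i ψ}
  | .negHow i χ ψ :: _ => {K i ψ, neg (Kh i χ)}

/-- The formulas that are marked as checked at a node when it is created, where `ord n` is the order
in which the formulas at `n` are checked.  When a formula `φ` of `L(n)` is expanded, all formulas of
`L(n)` up to and including `φ` are checked: an unchecked one before `φ` has just been marked as
checked without creating successors.  At nodes not created by an expansion nothing is checked. -/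
def checked (ord : Node P I → LinearOrder (Form P I)) (φ₀ : Form P I) :
    Node P I → Set (Form P I)
  | .expand φ _ :: n => checked ord φ₀ n ∪ {χ ∈ label φ₀ n | (ord n).le χ φ}
  | _ => ∅

/-- `φ` is the first unchecked formula of `L(n)` whose checking creates successors; the unchecked
formulas before it are just marked as checked. -/
def Expands (ord : Node P I → LinearOrder (Form P I)) (φ₀ : Form P I) (n : Node P I)
    (φ : Form P I) : Prop :=
  (φ ∈ label φ₀ n ∧ φ ∉ checked ord φ₀ n ∧ Active (label φ₀ n) φ) ∧
    ∀ χ ∈ label φ₀ n, χ ∉ checked ord φ₀ n → (ord n).lt χ φ → ¬ Active (label φ₀ n) χ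

/-- All formulas of `L(n)` get checked at `n` itself: those that are still unchecked when `n` is
created are marked as checked without creating successors. -/
def AllChecked (ord : Node P I → LinearOrder (Form P I)) (φ₀ : Form P I) (n : Node P I) : Prop :=
  ∀ φ ∈ label φ₀ n, φ ∉ checked ord φ₀ n → ¬ Active (label φ₀ n) φ

/-- `n'` is an `i`-ancestor of `n`: there is a path from `n'` to `n` (possibly of length `0`) all
edges of which are labelled `i` or `ε`. -/
def IsAgentAncestor (i : I) (n' n : Node P I) : Prop :=
  ∃ p : List (Succ P I), n = p ++ n' ∧ ∀ s ∈ p, s.edge = .agent i ∨ s.edge = .eps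

/-- A node created for a triple `¬Kh_i χ`, `Kh_i ψ`, `¬K_i ψ` is blocked if some proper ancestor has
the same label. No other nodes are blocked. -/
def Blocked (φ₀ : Form P I) : Node P I → Prop
  | .negHow i χ ψ :: n => ∃ n', n' <:+ n ∧ label φ₀ n' = label φ₀ (.negHow i χ ψ :: n)
  | _ => False

/-- The nodes of the tableau for `φ₀`.  Only unblocked nodes whose label is not blatantly
inconsistent get successors. -/
inductive IsNode (ord : Node P I → LinearOrder (Form P I)) (φ₀ : Form P I) : Node P I → Prop
  | root : IsNode ord φ₀ []
  | expand {n : Node P I} {φ : Form P I} {k : ℕ} (hn : IsNode ord φ₀ n)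
      (hb : ¬ Blocked φ₀ n) (hc : ¬ BlatantlyInconsistent (label φ₀ n))
      (hφ : Expands ord φ₀ n φ) (hk : k < φ.expansions.length) :
      IsNode ord φ₀ (.expand φ k :: n)
  | dia {n : Node P I} {i : I} {ψ : Form P I} (hn : IsNode ord φ₀ n)
      (hb : ¬ Blocked φ₀ n) (hc : ¬ BlatantlyInconsistent (label φ₀ n))
      (ha : AllChecked ord φ₀ n) (hψ : neg (K i ψ) ∈ label φ₀ n)
      (hi : ¬ ∃ n', IsAgentAncestor i n' n ∧ label φ₀ n' = diamondLabel i ψ (label φ₀ n)) :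
      IsNode ord φ₀ (.dia i ψ :: n)
  | how {n : Node P I} {i : I} {ψ : Form P I} (hn : IsNode ord φ₀ n)
      (hb : ¬ Blocked φ₀ n) (hc : ¬ BlatantlyInconsistent (label φ₀ n))
      (ha : AllChecked ord φ₀ n) (hψ : Kh i ψ ∈ label φ₀ n) (hψ' : neg (K i ψ) ∈ label φ₀ n) :
      IsNode ord φ₀ (.how i ψ :: n)
  | negHow {n : Node P I} {i : I} {χ ψ : Form P I} (hn : IsNode ord φ₀ n)
      (hb : ¬ Blocked φ₀ n) (hc : ¬ BlatantlyInconsistent (label φ₀ n))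
      (ha : AllChecked ord φ₀ n) (hχ : neg (Kh i χ) ∈ label φ₀ n) (hψ : Kh i ψ ∈ label φ₀ n)
      (hψ' : neg (K i ψ) ∈ label φ₀ n) :
      IsNode ord φ₀ (.negHow i χ ψ :: n)

/-- The child nodes of a node of the tableau. -/
def children (ord : Node P I → LinearOrder (Form P I)) (φ₀ : Form P I) (n : Node P I) :
    Set (Node P I) :=
  {n' | IsNode ord φ₀ n' ∧ ∃ s, n' = s :: n}

/-- A complete subtree of the tableau: it contains the root, it is closed under parents, it contains
all children of each of its "and" nodes and at least one child of each of its "or" nodes that is not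
a leaf of the tableau.  The "and" nodes are those at which all formulas get checked; a non-leaf node
at which some formula is expanded is an "or" node. -/
structure IsCompleteSubtree (ord : Node P I → LinearOrder (Form P I)) (φ₀ : Form P I)
    (S : Set (Node P I)) : Prop where
  isNode : ∀ n ∈ S, IsNode ord φ₀ n
  root_mem : [] ∈ S
  parent_mem : ∀ s n, s :: n ∈ S → n ∈ S
  and_node : ∀ n ∈ S, AllChecked ord φ₀ n → children ord φ₀ n ⊆ S
  or_node : ∀ n ∈ S, ¬ AllChecked ord φ₀ n → (children ord φ₀ n).Nonempty →
    (children ord φ₀ n ∩ S).Nonempty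

/-- The tableau for `φ₀` is closed: each of its complete subtrees has a node whose label is blatantly
inconsistent. -/
def TableauClosed (ord : Node P I → LinearOrder (Form P I)) (φ₀ : Form P I) : Prop :=
  ∀ S, IsCompleteSubtree ord φ₀ S → ∃ n ∈ S, BlatantlyInconsistent (label φ₀ n)

/-! ## Formulas as input words -/

/-- The finite alphabet in which formulas are written. -/
inductive Sym
  | bot | letter | neg | and | K | Kh | endMark
  | bit (b : Bool)

/-- A binary name, followed by an end mark. -/
def writeName (w : List Bool) : List Sym := w.map Sym.bit ++ [Sym.endMark]

/-- The word (in Polish notation) that represents a formula, where `nameP` and `nameI` are the binary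
names of the letters and of the agents. -/
def Form.encode (nameP : P ↪ List Bool) (nameI : I ↪ List Bool) : Form P I → List Sym
  | bot => [Sym.bot]
  | letter p => Sym.letter :: writeName (nameP p)
  | neg φ => Sym.neg :: φ.encode nameP nameI
  | and φ ψ => Sym.and :: (φ.encode nameP nameI ++ ψ.encode nameP nameI)
  | K i φ => Sym.K :: (writeName (nameI i) ++ φ.encode nameP nameI)
  | Kh i φ => Sym.Kh :: (writeName (nameI i) ++ φ.encode nameP nameI)

theorem writeName_append_inj (w w' : List Bool) (s t : List Sym)
    (h : writeName w ++ s = writeName w' ++ t) : w = w' ∧ s = t := by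
  induction w generalizing w' with
  | nil => cases w' <;> simp_all [writeName]
  | cons b w ih =>
    cases w' with
    | nil => simp [writeName] at h
    | cons b' w' =>
      simp only [writeName, List.map_cons, List.cons_append, List.cons.injEq, Sym.bit.injEq] at h
      have := ih w' h.2
      simp_all

theorem encode_append_inj (nameP : P ↪ List Bool) (nameI : I ↪ List Bool) (φ ψ : Form P I)
    (s t : List Sym) (h : φ.encode nameP nameI ++ s = ψ.encode nameP nameI ++ t) :
    φ = ψ ∧ s = t := by
  induction φ generalizing ψ s t with
  | bot => cases ψ <;> simp_all [Form.encode]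
  | letter p =>
    cases ψ <;> simp [Form.encode] at h ⊢
    have := writeName_append_inj _ _ _ _ h
    simpa using this
  | neg φ ih =>
    cases ψ <;> simp [Form.encode] at h ⊢
    exact ih _ _ _ h
  | and φ₁ φ₂ ih₁ ih₂ =>
    cases ψ <;> simp [Form.encode] at h ⊢
    obtain ⟨h₁, h⟩ := ih₁ _ _ _ h
    exact ⟨⟨h₁, (ih₂ _ _ _ h).1⟩, (ih₂ _ _ _ h).2⟩
  | K i φ ih =>
    cases ψ <;> simp [Form.encode] at h ⊢
    obtain ⟨h₁, h⟩ := writeName_append_inj _ _ _ _ h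
    exact ⟨⟨nameI.injective h₁, (ih _ _ _ h).1⟩, (ih _ _ _ h).2⟩
  | Kh i φ ih =>
    cases ψ <;> simp [Form.encode] at h ⊢
    obtain ⟨h₁, h⟩ := writeName_append_inj _ _ _ _ h
    exact ⟨⟨nameI.injective h₁, (ih _ _ _ h).1⟩, (ih _ _ _ h).2⟩

/-- The representation of formulas by words is unambiguous. -/
theorem encode_injective (nameP : P ↪ List Bool) (nameI : I ↪ List Bool) :
    Function.Injective (Form.encode nameP nameI) := fun φ ψ h =>
  (encode_append_inj nameP nameI φ ψ [] [] (by simpa using h)).1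

end

/-! ## Space-bounded machines

The machines are Mathlib's multi-stack Turing machines `Turing.FinTM2`, with finitely many stacks,
program labels and internal states. -/

/-- The space used by a configuration: the total number of symbols on all the stacks, input
included. -/
def space (tm : Turing.FinTM2) (c : tm.Cfg) : ℕ :=
  ∑ k ∈ @Finset.univ tm.K tm.kFin, (Turing.TM2.Cfg.stk c k).length

/-- The machine, started on the input word `w`, halts with the one-symbol output `b`. -/
def Answers {A : Type} (M : Turing.TM2ComputableAux A Bool) (w : List A) (b : Bool) : Prop :=
  Nonempty (Turing.TM2Outputs M.tm (w.map M.inputAlphabet.symm) (some [M.outputAlphabet.symm b]))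

/-- All stack alphabets of the machine are finite, and for some polynomial `p`, in every configuration
that it reaches from an input word `enc a`, it uses space at most `p(|enc a|)`. -/
def RunsInPolySpace {α : Type*} {A : Type} (M : Turing.TM2ComputableAux A Bool)
    (enc : α → List A) : Prop :=
  (∀ k, Finite (M.tm.Γ k)) ∧
    ∃ p : Polynomial ℕ, ∀ (a : α) (c : M.tm.Cfg),
      StateTransition.Reaches M.tm.step
        (Turing.initList M.tm ((enc a).map M.inputAlphabet.symm)) c →
      space M.tm c ≤ p.eval (enc a).length

end ELKh

/-! Closedness does not depend on the checking orders, the loop test or blocking. Call a label good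
if it belongs to a family of labels each of which has a saturated consistent extension from which
the modal rules lead back into the family; this is a greatest fixed point. If `{φ₀}` is good, the
nodes all of whose ancestors have good labels form a complete subtree without inconsistency.
Conversely, the labels of a consistent complete subtree form such a family: one descends through
"or" nodes to an "and" node, an `i`-successor suppressed by the loop test is represented by an
ancestor, and a blocked node by its equally labelled ancestor. This is `tableauClosed_iff`.

The height bound comes from a number below m^6, `rank`, that increases along every edge to an
unblocked node (`rank_lt`, `rank_lt_rank_cons`). Its leading digit, with m^2 values, adds the
`Kh`-depth lost at the successors for `Kh_i ψ` to the number of distinct labels of successors for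
`¬Kh_i χ`. The next, with m values, is the modal depth lost at changes of the agent since the last
action edge. Then, within the run of one agent, come the size of the modal part and the number of
diamonds already realised (m values each), and last the size of the label (m values).

The algorithm `opn` is a depth-first search that ignores loop test and blocking and is cut off at a
depth N of at least m^6, where it answers "open". It accepts good labels at every depth
(`opn_of_good`). If it accepts `[φ₀]`, choose the orders so that the tableau expands the same
formulas; its height is at most N, so the accepting choices yield a consistent complete subtree, and
`{φ₀}` is good (`good_of_opn`).

The search is run on an explicit stack with one frame per level (`dfs_iter`). Polynomial space is
handled through the class `PS` of functions on tree codes computed by structured stack programs; it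
is closed under composition, folds, and iterations of any length with small states.
`Prog.Run.outputs` and `PS.exists_machine` turn such programs into Turing machines. -/

namespace ELKh

open Turing Function

/-! ## Structured stack programs -/

section Prog

variable {K : Type} {Γ : K → Type}

/-- Structured programs that act on a family of stacks. -/
inductive Prog (Γ : K → Type) : Type
  /-- do nothing -/
  | skip : Prog Γ
  /-- push a symbol -/
  | push (k : K) (g : Γ k) : Prog Γ
  /-- pop a symbol and branch on the result -/
  | pop (k : K) (f : Option (Γ k) → Prog Γ) : Prog Γ
  /-- sequential composition -/
  | seq (p q : Prog Γ) : Prog Γ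
  /-- pop a symbol and run the corresponding program, until the stack is empty -/
  | loop (k : K) (f : Γ k → Prog Γ) : Prog Γ

namespace Prog

/-- The program labels that a program needs. -/
def Lab : Prog Γ → Type
  | skip => Unit
  | push _ _ => Unit
  | pop _ f => Option (Σ x, Lab (f x))
  | seq p q => Lab p ⊕ Lab q
  | loop _ f => Option (Σ x, Lab (f x))

/-- The label at which a program starts. -/
def entry : (p : Prog Γ) → p.Lab
  | skip => ()
  | push _ _ => ()
  | pop _ _ => none
  | seq p _ => Sum.inl (entry p)
  | loop _ _ => none

theorem finite_lab [∀ k, Finite (Γ k)] : (p : Prog Γ) → Finite p.Lab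
  | skip => inferInstanceAs (Finite Unit)
  | push _ _ => inferInstanceAs (Finite Unit)
  | pop _ f =>
    have := fun x => finite_lab (f x)
    inferInstanceAs (Finite (Option (Σ x, Lab (f x))))
  | seq p q =>
    have := finite_lab p
    have := finite_lab q
    inferInstanceAs (Finite (Lab p ⊕ Lab q))
  | loop _ f =>
    have := fun x => finite_lab (f x)
    inferInstanceAs (Finite (Option (Σ x, Lab (f x))))

section
variable [DecidableEq K]

/-- The machine code of a program, where `emb` places its labels among those of the machine and `e`
is the label at which the machine continues afterwards.  The internal state of the machine stores
what has last been popped from each stack. -/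
def code {Λ : Type} : (p : Prog Γ) → (p.Lab → Λ) → Λ → p.Lab → TM2.Stmt Γ Λ (∀ k, Option (Γ k))
  | skip, _, e, _ => .goto fun _ => e
  | push k g, _, e, _ => .push k (fun _ => g) (.goto fun _ => e)
  | pop k f, emb, _, none =>
    .pop k (fun v x => update v k x) (.goto fun v => emb (some ⟨v k, (f (v k)).entry⟩))
  | pop _ f, emb, e, some ⟨x, l⟩ => (f x).code (fun l => emb (some ⟨x, l⟩)) e l
  | seq p q, emb, _, Sum.inl l => p.code (fun l => emb (Sum.inl l)) (emb (Sum.inr q.entry)) l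
  | seq _ q, emb, e, Sum.inr l => q.code (fun l => emb (Sum.inr l)) e l
  | loop k f, emb, e, none =>
    .pop k (fun v x => update v k x)
      (.goto fun v => (v k).elim e fun x => emb (some ⟨x, (f x).entry⟩))
  | loop _ f, emb, _, some ⟨x, l⟩ =>
    (f x).code (fun l => emb (some ⟨x, l⟩)) (emb none) l

variable [Fintype K]

/-- The total number of symbols on the stacks. -/
def size (s : ∀ k, List (Γ k)) : ℕ := ∑ k, (s k).length

/-- `Run B p s s'`: the program `p`, started on `s`, ends with `s'`, and the stacks never hold more
than `B` symbols. -/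
inductive Run (B : ℕ) : Prog Γ → (∀ k, List (Γ k)) → (∀ k, List (Γ k)) → Prop
  | skip {s} (h : size s ≤ B) : Run B Prog.skip s s
  | push {s k g} (h : size s ≤ B) : Run B (Prog.push k g) s (update s k (g :: s k))
  | pop {s s' k f} (h : size s ≤ B) (hf : Run B (f (s k).head?) (update s k (s k).tail) s') :
      Run B (Prog.pop k f) s s'
  | seq {s s' s'' p q} (hp : Run B p s s') (hq : Run B q s' s'') : Run B (Prog.seq p q) s s''
  | loop_nil {s k f} (h : size s ≤ B) (hk : s k = []) : Run B (Prog.loop k f) s s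
  | loop_cons {s s' s'' k f g r} (h : size s ≤ B) (hk : s k = g :: r)
      (hf : Run B (f g) (update s k r) s') (hl : Run B (Prog.loop k f) s' s'') :
      Run B (Prog.loop k f) s s''

/-- A step of a machine from a configuration with at most `B` symbols on its stacks. -/
def BStep {Λ σ : Type} (B : ℕ) (M : Λ → TM2.Stmt Γ Λ σ) (c c' : TM2.Cfg Γ Λ σ) : Prop :=
  TM2.step M c = some c' ∧ size c.stk ≤ B

-- Each subprogram has its own block of labels and leaves it only by a jump to `e`, so runs can be
-- concatenated. The final internal state is irrelevant: a pop overwrites the entry that is read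
-- after it.
open Relation in
theorem Run.reaches {Λ : Type} {B : ℕ} (M : Λ → TM2.Stmt Γ Λ (∀ k, Option (Γ k)))
    {p : Prog Γ} {s s' : ∀ k, List (Γ k)} (h : Run B p s s') (emb : p.Lab → Λ) (e : Λ)
    (hM : ∀ l, M (emb l) = p.code emb e l) (v : ∀ k, Option (Γ k)) :
    ∃ v', ReflTransGen (BStep B M) ⟨some (emb p.entry), v, s⟩ ⟨some e, v', s'⟩ := by
  induction h generalizing e v with
  | skip h =>
    exact ⟨v, .single ⟨by simp [TM2.step, hM, code], h⟩⟩
  | push h =>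
    exact ⟨v, .single ⟨by simp [TM2.step, hM, code], h⟩⟩
  | @pop s s' k f h _ ih =>
    obtain ⟨v', h'⟩ := ih (fun l => emb (some ⟨_, l⟩)) e (fun l => hM (some ⟨_, l⟩))
      (update v k (s k).head?)
    refine ⟨v', .head ⟨?_, h⟩ h'⟩
    have : M (emb (Prog.pop k f).entry) = _ := hM _
    rw [TM2.step, this]
    simp only [entry, code, TM2.stepAux]
    rw [update_self]
  | @seq s s' s'' p q _ _ ih₁ ih₂ =>
    obtain ⟨v', h'⟩ := ih₁ (fun l => emb (Sum.inl l)) (emb (Sum.inr q.entry))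
      (fun l => hM (Sum.inl l)) v
    obtain ⟨v'', h''⟩ := ih₂ (fun l => emb (Sum.inr l)) e (fun l => hM (Sum.inr l)) v'
    exact ⟨v'', h'.trans h''⟩
  | @loop_nil s k f h hk =>
    refine ⟨update v k none, .single ⟨?_, h⟩⟩
    have : M (emb (loop k f).entry) = _ := hM _
    rw [TM2.step, this]
    simp only [entry, code, TM2.stepAux, hk, List.head?_nil, List.tail_nil, update_self]
    simp [← hk]
  | @loop_cons s s' s'' k f g r h hk _ _ ih₁ ih₂ =>
    obtain ⟨v', h'⟩ := ih₁ (fun l => emb (some ⟨_, l⟩)) (emb none) (fun l => hM (some ⟨_, l⟩))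
      (update v k (some g))
    obtain ⟨v'', h''⟩ := ih₂ emb e hM v'
    refine ⟨v'', .head ⟨?_, h⟩ (h'.trans h'')⟩
    have : M (emb (loop k f).entry) = _ := hM _
    rw [TM2.step, this]
    simp only [entry, code, TM2.stepAux, hk, List.head?_cons, List.tail_cons, update_self]
    rfl

end

end Prog

end Prog

/-! ### Structured programs as Turing machines -/

section

variable {K : Type} [DecidableEq K] [Fintype K] {Γ : K → Type}

/-- The machine that runs a structured program, with input stack `k₀` and output stack `k₁`. -/
noncomputable def Prog.toTM [∀ k, Fintype (Γ k)] (p : Prog Γ) (k₀ k₁ : K) : FinTM2 :=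
  letI : Fintype p.Lab := @Fintype.ofFinite _ p.finite_lab
  { k₀ := k₀
    k₁ := k₁
    Γ := Γ
    Λ := Option p.Lab
    main := some p.entry
    σ := ∀ k, Option (Γ k)
    initialState := fun _ => none
    m := fun l => l.elim (.load (fun _ _ => none) .halt) (p.code some none) }

/-- The stacks that are empty except for the contents `w` of the stack `k₀`. -/
def single (k₀ : K) (w : List (Γ k₀)) (k : K) : List (Γ k) :=
  if h : k = k₀ then by rw [h]; exact w else []

theorem size_single (k₀ : K) (w : List (Γ k₀)) : Prog.size (single k₀ w) = w.length := by
  rw [Prog.size, Finset.sum_eq_single k₀]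
  · simp [single]
  · intro k _ hk
    simp [single, hk]
  · simp

variable [∀ k, Fintype (Γ k)]

open Relation

theorem Prog.Run.toTM_reaches {p : Prog Γ} {k₀ k₁ : K} {B : ℕ} {w : List (Γ k₀)} {u : List (Γ k₁)}
    (h : Run B p (single k₀ w) (single k₁ u)) (hu : u.length ≤ B) :
    ReflTransGen (fun c c' => (p.toTM k₀ k₁).step c = some c' ∧ space (p.toTM k₀ k₁) c ≤ B)
      (initList (p.toTM k₀ k₁) w) (haltList (p.toTM k₀ k₁) u) := by
  obtain ⟨v, hv⟩ := h.reaches (Λ := Option p.Lab)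
    (fun l => l.elim (.load (fun _ _ => none) .halt) (p.code some none)) some none
    (fun _ => rfl) (fun _ => none)
  have h₁ : initList (p.toTM k₀ k₁) w = ⟨some (some p.entry), fun _ => none, single k₀ w⟩ := by
    rfl
  have h₂ : haltList (p.toTM k₀ k₁) u = ⟨none, fun _ => none, single k₁ u⟩ := by
    rfl
  rw [h₁, h₂]
  -- At the extra label `none` the machine clears its internal state and halts, since `haltList`
  -- demands the initial state. `Run` does not bound its final stacks; this is where `hu` is needed.
  refine ReflTransGen.tail hv ⟨rfl, ?_⟩
  exact (size_single k₁ u).le.trans hu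

theorem evalsTo_of_reaches {σ : Type*} {f : σ → Option σ} {a b : σ}
    (h : StateTransition.Reaches f a b) : Nonempty (StateTransition.EvalsTo f a (some b)) := by
  induction h with
  | refl => exact ⟨⟨0, rfl⟩⟩
  | tail _ hbc ih =>
    obtain ⟨n, hn⟩ := ih
    refine ⟨⟨n + 1, ?_⟩⟩
    rw [iterate_succ_apply', hn]
    exact hbc

/-- Steps are deterministic and the halting configuration has no successor, so every reachable
configuration lies on the bounded path obtained from `h`. -/
theorem Prog.Run.outputs {p : Prog Γ} {k₀ k₁ : K} {B : ℕ} {w : List (Γ k₀)} {u : List (Γ k₁)}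
    (h : Run B p (single k₀ w) (single k₁ u)) (hu : u.length ≤ B) :
    Nonempty (TM2Outputs (p.toTM k₀ k₁) w (some u)) ∧
      ∀ c, StateTransition.Reaches (p.toTM k₀ k₁).step (initList (p.toTM k₀ k₁) w) c →
        space (p.toTM k₀ k₁) c ≤ B := by
  have h' := h.toTM_reaches hu
  refine ⟨evalsTo_of_reaches (ReflTransGen.mono (fun _ _ h => h.1) _ _ h'), fun c hc => ?_⟩
  have hhalt : space (p.toTM k₀ k₁) (haltList (p.toTM k₀ k₁) u) ≤ B := by
    refine le_trans (le_of_eq ?_) hu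
    exact size_single k₁ u
  generalize initList (p.toTM k₀ k₁) w = a at h' hc
  induction hc using ReflTransGen.head_induction_on with
  | refl =>
    rcases ReflTransGen.cases_head h' with rfl | ⟨_, h, _⟩
    exacts [hhalt, h.2]
  | head hab _ ih =>
    rcases ReflTransGen.cases_head h' with rfl | ⟨_, h, ht⟩
    · cases hab
    · exact ih (Option.some.inj (h.1.symm.trans hab) ▸ ht)

end

end ELKh

namespace ELKh

open Function

/-! ## Binary trees on stacks -/

/-- Binary trees, the data on which the algorithms work. -/
inductive Tree : Type
  | nil
  | cons (x y : Tree)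
  deriving DecidableEq

namespace Tree

/-- The number of nodes and leaves. -/
def sz : Tree → ℕ
  | nil => 1
  | cons x y => x.sz + y.sz + 1

/-- The tree in prefix notation. -/
def ser : Tree → List Bool
  | nil => [false]
  | cons x y => true :: (x.ser ++ y.ser)

/-- The left subtree. -/
def fst : Tree → Tree
  | nil => nil
  | cons x _ => x

/-- The right subtree. -/
def snd : Tree → Tree
  | nil => nil
  | cons _ y => y

/-- Whether a tree is `nil`. -/
def isNil : Tree → Bool
  | nil => true
  | cons _ _ => false

theorem sz_pos (x : Tree) : 1 ≤ x.sz := by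
  cases x <;> simp [sz]

@[simp]
theorem length_ser (x : Tree) : x.ser.length = x.sz := by
  induction x with
  | nil => rfl
  | cons x y hx hy => simp [ser, sz, hx, hy]

theorem sz_fst_le (x : Tree) : x.fst.sz ≤ x.sz := by
  cases x <;> simp only [sz, fst, le_refl]; omega

theorem sz_snd_le (x : Tree) : x.snd.sz ≤ x.sz := by
  cases x <;> simp only [sz, snd, le_refl]; omega

end Tree

/-- The Boolean stacks of the machines: the output stack, two stacks for trees, a stack for trees in
reverse, and a stack for a counter. -/
inductive Wk : Type
  | out | main | save | rev | count
  deriving DecidableEq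

instance : Fintype Wk :=
  ⟨{.out, .main, .save, .rev, .count}, fun x => by cases x <;> simp⟩

/-- The alphabets of the stacks: the input stack `none` carries symbols, the others bits. -/
@[reducible]
def Alph : Option Wk → Type
  | none => Sym
  | some _ => Bool

noncomputable instance : Fintype Sym :=
  @Fintype.ofFinite _ <| Finite.of_surjective
    (fun x : Option (Option (Option (Option (Option (Option (Option Bool)))))) =>
      match x with
      | none => Sym.bot
      | some none => Sym.letter
      | some (some none) => Sym.neg
      | some (some (some none)) => Sym.and
      | some (some (some (some none))) => Sym.K
      | some (some (some (some (some none)))) => Sym.Kh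
      | some (some (some (some (some (some none))))) => Sym.endMark
      | some (some (some (some (some (some (some b)))))) => Sym.bit b) <| by
    rintro (_ | _ | _ | _ | _ | _ | _ | b)
    exacts [⟨none, rfl⟩, ⟨some none, rfl⟩, ⟨some (some none), rfl⟩, ⟨some (some (some none)), rfl⟩,
      ⟨some (some (some (some none))), rfl⟩, ⟨some (some (some (some (some none)))), rfl⟩,
      ⟨some (some (some (some (some (some none))))), rfl⟩,
      ⟨some (some (some (some (some (some (some b)))))), rfl⟩]

noncomputable instance : ∀ k, Fintype (Alph k)
  | none => inferInstanceAs (Fintype Sym)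
  | some _ => inferInstanceAs (Fintype Bool)

/-- The stacks with the given contents. -/
def stackOf (w : List Sym) (o a s t c : List Bool) : ∀ k, List (Alph k)
  | none => w
  | some .out => o
  | some .main => a
  | some .save => s
  | some .rev => t
  | some .count => c

section stackOf

variable {w w' : List Sym} {o a s t c l : List Bool}

@[simp]
theorem size_stackOf : Prog.size (stackOf w o a s t c) =
    w.length + o.length + a.length + s.length + t.length + c.length := by
  have : (Finset.univ : Finset Wk) = {.out, .main, .save, .rev, .count} := rfl
  simp [Prog.size, Fintype.sum_option, this, stackOf]
  ring

@[simp]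
theorem update_stackOf_inp : update (stackOf w o a s t c) none w' = stackOf w' o a s t c := by
  funext k; rcases k with _ | _ | _ | _ | _ | _ <;> simp [update, stackOf]

@[simp]
theorem update_stackOf_out : update (stackOf w o a s t c) (some .out) l = stackOf w l a s t c := by
  funext k; rcases k with _ | _ | _ | _ | _ | _ <;> simp [update, stackOf]

@[simp]
theorem update_stackOf_main : update (stackOf w o a s t c) (some .main) l = stackOf w o l s t c := by
  funext k; rcases k with _ | _ | _ | _ | _ | _ <;> simp [update, stackOf]

@[simp]
theorem update_stackOf_save : update (stackOf w o a s t c) (some .save) l = stackOf w o a l t c := by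
  funext k; rcases k with _ | _ | _ | _ | _ | _ <;> simp [update, stackOf]

@[simp]
theorem update_stackOf_rev : update (stackOf w o a s t c) (some .rev) l = stackOf w o a s l c := by
  funext k; rcases k with _ | _ | _ | _ | _ | _ <;> simp [update, stackOf]

@[simp]
theorem update_stackOf_count : update (stackOf w o a s t c) (some .count) l = stackOf w o a s t l := by
  funext k; rcases k with _ | _ | _ | _ | _ | _ <;> simp [update, stackOf]

end stackOf

namespace Prog

/-- The structured programs over the stacks used here. -/
abbrev TreeProg := Prog Alph

section

variable {B : ℕ} {w w' : List Sym} {o a s t c o' a' s' t' c' : List Bool}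

theorem run_push_main {b : Bool} (h : size (stackOf w o a s t c) ≤ B) :
    Run B (push (some .main) b) (stackOf w o a s t c) (stackOf w o (b :: a) s t c) := by
  simpa [stackOf] using Run.push (k := some .main) (g := b) h

theorem run_push_save {b : Bool} (h : size (stackOf w o a s t c) ≤ B) :
    Run B (push (some .save) b) (stackOf w o a s t c) (stackOf w o a (b :: s) t c) := by
  simpa [stackOf] using Run.push (k := some .save) (g := b) h

theorem run_push_rev {b : Bool} (h : size (stackOf w o a s t c) ≤ B) :
    Run B (push (some .rev) b) (stackOf w o a s t c) (stackOf w o a s (b :: t) c) := by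
  simpa [stackOf] using Run.push (k := some .rev) (g := b) h

theorem run_push_count {b : Bool} (h : size (stackOf w o a s t c) ≤ B) :
    Run B (push (some .count) b) (stackOf w o a s t c) (stackOf w o a s t (b :: c)) := by
  simpa [stackOf] using Run.push (k := some .count) (g := b) h

theorem run_push_out {b : Bool} (h : size (stackOf w o a s t c) ≤ B) :
    Run B (push (some .out) b) (stackOf w o a s t c) (stackOf w (b :: o) a s t c) := by
  simpa [stackOf] using Run.push (k := some .out) (g := b) h

theorem run_pop_main {f : Option Bool → TreeProg} {b : Bool} {S}
    (h : size (stackOf w o (b :: a) s t c) ≤ B)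
    (hf : Run B (f (some b)) (stackOf w o a s t c) S) :
    Run B (pop (some .main) f) (stackOf w o (b :: a) s t c) S :=
  Run.pop h (by simpa [stackOf] using hf)

theorem run_pop_save {f : Option Bool → TreeProg} {b : Bool} {S}
    (h : size (stackOf w o a (b :: s) t c) ≤ B)
    (hf : Run B (f (some b)) (stackOf w o a s t c) S) :
    Run B (pop (some .save) f) (stackOf w o a (b :: s) t c) S :=
  Run.pop h (by simpa [stackOf] using hf)

theorem run_loop_count {f : Bool → TreeProg} {b : Bool} {S S'}
    (h : size (stackOf w o a s t (b :: c)) ≤ B) (hf : Run B (f b) (stackOf w o a s t c) S)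
    (hl : Run B (loop (some .count) f) S S') :
    Run B (loop (some .count) f) (stackOf w o a s t (b :: c)) S' :=
  Run.loop_cons (g := b) (r := c) h rfl (by simpa [stackOf] using hf) hl

theorem run_loop_rev {f : Bool → TreeProg} {b : Bool} {S S'}
    (h : size (stackOf w o a s (b :: t) c) ≤ B) (hf : Run B (f b) (stackOf w o a s t c) S)
    (hl : Run B (loop (some .rev) f) S S') :
    Run B (loop (some .rev) f) (stackOf w o a s (b :: t) c) S' :=
  Run.loop_cons (g := b) (r := t) h rfl (by simpa [stackOf] using hf) hl

end

/-- Remove a tree from the stack `k`, after a counter has been pushed; if `keep` holds, push it in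
reverse on the stack `rev`. -/
def walk (k : Wk) (keep : Bool) : TreeProg :=
  loop (some .count) fun _ => pop (some k) fun x =>
    match x with
    | none => skip
    | some b =>
      seq (if keep then push (some .rev) b else skip)
        (if b then seq (push (some .count) true) (push (some .count) true) else skip)

/-- The counter holds one symbol for each tree still to be removed: a leaf uses one up, a `cons`
replaces one by two. The rest of the run is a hypothesis, so that the induction hypotheses for the
two subtrees can be chained. -/
theorem run_walk_main (keep : Bool) (x : Tree) {B : ℕ} {w : List Sym} {o a s t c : List Bool} {S}
    (hB : w.length + o.length + a.length + 2 * x.sz + s.length + t.length + c.length + 2 ≤ B)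
    (h : Run B (walk .main keep)
      (stackOf w o a s (if keep then x.ser.reverse ++ t else t) c) S) :
    Run B (walk .main keep) (stackOf w o (x.ser ++ a) s t (true :: c)) S := by
  induction x generalizing a t c with
  | nil =>
    simp only [Tree.sz] at hB
    refine run_loop_count (by simp [Tree.ser]; omega) (run_pop_main (by simp; omega) ?_) h
    refine .seq ?_ (.skip (by cases keep <;> simp [Tree.ser] <;> omega))
    cases keep
    · exact .skip (by simp; omega)
    · exact run_push_rev (by simp; omega)
  | cons x y hx hy =>
    simp only [Tree.sz] at hB
    refine run_loop_count (S := stackOf w o (x.ser ++ (y.ser ++ a)) s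
        (if keep then true :: t else t) (true :: true :: c)) (by simp [Tree.ser]; omega)
      (by
        simp only [Tree.ser, List.cons_append, List.append_assoc]
        refine run_pop_main (by simp; omega) ?_
        refine .seq (s' := stackOf w o (x.ser ++ (y.ser ++ a)) s
          (if keep then true :: t else t) c) ?_
          (.seq (run_push_count ?_) (run_push_count ?_))
        · cases keep
          · exact .skip (by simp; omega)
          · exact run_push_rev (by simp; omega)
        · cases keep <;> simp <;> omega
        · cases keep <;> simp <;> omega) ?_
    refine hx (by cases keep <;> simp <;> omega) (hy (by cases keep <;> simp <;> omega) ?_)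
    cases keep
    · simpa using h
    · simpa [Tree.ser] using h

theorem run_walk_save (x : Tree) {B : ℕ} {w : List Sym} {o a s t c : List Bool} {S}
    (hB : w.length + o.length + a.length + 2 * x.sz + s.length + t.length + c.length + 2 ≤ B)
    (h : Run B (walk .save true) (stackOf w o a s (x.ser.reverse ++ t) c) S) :
    Run B (walk .save true) (stackOf w o a (x.ser ++ s) t (true :: c)) S := by
  induction x generalizing s t c with
  | nil =>
    simp only [Tree.sz] at hB
    refine run_loop_count (by simp [Tree.ser]; omega) (run_pop_save (by simp; omega) ?_) h
    exact .seq (run_push_rev (by simp; omega)) (.skip (by simp; omega))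
  | cons x y hx hy =>
    simp only [Tree.sz] at hB
    refine run_loop_count (S := stackOf w o a (x.ser ++ (y.ser ++ s)) (true :: t)
        (true :: true :: c)) (by simp [Tree.ser]; omega)
      (by
        simp only [Tree.ser, List.cons_append, List.append_assoc]
        refine run_pop_save (by simp; omega) ?_
        exact .seq (run_push_rev (by simp; omega))
          (.seq (run_push_count (by simp; omega)) (run_push_count (by simp; omega)))) ?_
    refine hx (by simp; omega) (hy (by simp; omega) ?_)
    simpa [Tree.ser] using h

/-- Remove a tree from the stack `k`. -/
def take (k : Wk) (keep : Bool) : TreeProg := seq (push (some .count) true) (walk k keep)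

section

variable {B : ℕ} {w : List Sym} {o a s t : List Bool}

theorem run_drop (x : Tree)
    (hB : w.length + o.length + a.length + 2 * x.sz + s.length + 2 ≤ B) :
    Run B (take .main false) (stackOf w o (x.ser ++ a) s [] []) (stackOf w o a s [] []) :=
  .seq (run_push_count (by simp; omega)) <| run_walk_main false x (by simp; omega) <|
    .loop_nil (by simp; omega) rfl

theorem run_take_main (x : Tree)
    (hB : w.length + o.length + a.length + 2 * x.sz + s.length + 2 ≤ B) :
    Run B (take .main true) (stackOf w o (x.ser ++ a) s [] [])
      (stackOf w o a s x.ser.reverse []) :=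
  .seq (run_push_count (by simp; omega)) <| run_walk_main true x (by simp; omega) <| by
    rw [List.append_nil, if_pos rfl]
    exact .loop_nil (by simp; omega) rfl

theorem run_take_save (x : Tree)
    (hB : w.length + o.length + a.length + 2 * x.sz + s.length + 2 ≤ B) :
    Run B (take .save true) (stackOf w o a (x.ser ++ s) [] [])
      (stackOf w o a s x.ser.reverse []) :=
  .seq (run_push_count (by simp; omega)) <| run_walk_save x (by simp; omega) <| by
    rw [List.append_nil]
    exact .loop_nil (by simp; omega) rfl

theorem run_rev_main (hB : w.length + o.length + a.length + t.length + s.length ≤ B) :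
    Run B (loop (some .rev) fun b => push (some .main) b) (stackOf w o a s t [])
      (stackOf w o (t.reverse ++ a) s [] []) := by
  induction t generalizing a with
  | nil => exact .loop_nil (by simp at hB ⊢; omega) rfl
  | cons b t ih =>
    simp only [List.length_cons] at hB
    refine run_loop_rev (by simp; omega) (run_push_main (by simp; omega)) ?_
    simpa using ih (a := b :: a) (by simp; omega)

theorem run_rev_save (hB : w.length + o.length + a.length + t.length + s.length ≤ B) :
    Run B (loop (some .rev) fun b => push (some .save) b) (stackOf w o a s t [])
      (stackOf w o a (t.reverse ++ s) [] []) := by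
  induction t generalizing s with
  | nil => exact .loop_nil (by simp at hB ⊢; omega) rfl
  | cons b t ih =>
    simp only [List.length_cons] at hB
    refine run_loop_rev (by simp; omega) (run_push_save (by simp; omega)) ?_
    simpa using ih (s := b :: s) (by simp; omega)

theorem run_rev_both (hB : w.length + o.length + a.length + 2 * t.length + s.length ≤ B) :
    Run B (loop (some .rev) fun b => seq (push (some .main) b) (push (some .save) b))
      (stackOf w o a s t []) (stackOf w o (t.reverse ++ a) (t.reverse ++ s) [] []) := by
  induction t generalizing a s with
  | nil => exact .loop_nil (by simp at hB ⊢; omega) rfl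
  | cons b t ih =>
    simp only [List.length_cons] at hB
    refine run_loop_rev (by simp; omega)
      (.seq (run_push_main (by simp; omega)) (run_push_save (by simp; omega))) ?_
    simpa using ih (a := b :: a) (s := b :: s) (by simp; omega)

end

/-- Move a tree from the stack `main` to the stack `save`. -/
def toSave : TreeProg := seq (take .main true) (loop (some .rev) fun b => push (some .save) b)

/-- Move a tree from the stack `save` to the stack `main`. -/
def toMain : TreeProg := seq (take .save true) (loop (some .rev) fun b => push (some .main) b)

/-- Duplicate a tree on the stack `main`. -/
def dup : TreeProg :=
  seq (seq (take .main true)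
    (loop (some .rev) fun b => seq (push (some .main) b) (push (some .save) b))) toMain

section

variable {B : ℕ} {w : List Sym} {o a s : List Bool}

theorem run_toSave (x : Tree)
    (hB : w.length + o.length + a.length + 2 * x.sz + s.length + 2 ≤ B) :
    Run B toSave (stackOf w o (x.ser ++ a) s [] []) (stackOf w o a (x.ser ++ s) [] []) :=
  .seq (run_take_main x hB) <| by simpa using run_rev_save (t := x.ser.reverse) (by simp; omega)

theorem run_toMain (x : Tree)
    (hB : w.length + o.length + a.length + 2 * x.sz + s.length + 2 ≤ B) :
    Run B toMain (stackOf w o a (x.ser ++ s) [] []) (stackOf w o (x.ser ++ a) s [] []) :=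
  .seq (run_take_save x hB) <| by simpa using run_rev_main (t := x.ser.reverse) (by simp; omega)

theorem run_dup (x : Tree)
    (hB : w.length + o.length + a.length + 3 * x.sz + s.length + 2 ≤ B) :
    Run B dup (stackOf w o (x.ser ++ a) s [] []) (stackOf w o (x.ser ++ (x.ser ++ a)) s [] []) :=
  .seq (.seq (run_take_main x (by omega)) (run_rev_both (by simp; omega))) <| by
    simpa using run_toMain x (a := x.ser ++ a) (by simp; omega)

end

/-- `Comp p x y b`: the program `p` replaces the tree `x` on the stack `main` by `y`, with at most
`b` symbols on the stacks in addition to what is below. -/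
def Comp (p : TreeProg) (x y : Tree) (b : ℕ) : Prop :=
  x.sz ≤ b ∧ y.sz ≤ b ∧ ∀ (w : List Sym) (o a s : List Bool) (B : ℕ),
    w.length + o.length + a.length + s.length + b ≤ B →
      Run B p (stackOf w o (x.ser ++ a) s [] []) (stackOf w o (y.ser ++ a) s [] [])

section

variable {p q r : TreeProg} {x y z u : Tree} {b b' b'' : ℕ}

theorem Comp.mono (h : Comp p x y b) (hb : b ≤ b') : Comp p x y b' :=
  ⟨h.1.trans hb, h.2.1.trans hb, fun w o a s B hB => h.2.2 w o a s B (by omega)⟩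

theorem comp_skip (x : Tree) : Comp skip x x x.sz :=
  ⟨le_rfl, le_rfl, fun _ _ _ _ _ hB => .skip (by simp; omega)⟩

theorem Comp.seq (hp : Comp p x y b) (hq : Comp q y z b') : Comp (.seq p q) x z (b + b') :=
  ⟨hp.1.trans (by omega), hq.2.1.trans (by omega), fun w o a s B hB =>
    .seq (hp.2.2 w o a s B (by omega)) (hq.2.2 w o a s B (by omega))⟩

theorem comp_nil (x : Tree) :
    Comp (.seq (take .main false) (push (some .main) false)) x .nil (2 * x.sz + 2) :=
  ⟨by omega, by simp [Tree.sz], fun _ _ _ _ _ hB =>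
    .seq (run_drop x (by omega)) (run_push_main (by simp; omega))⟩

theorem comp_fst (x : Tree) :
    Comp (pop (some .main) fun b => if b = some true then
      .seq toSave (.seq (take .main false) toMain) else push (some .main) false) x x.fst
      (2 * x.sz + 2) := by
  refine ⟨by omega, x.sz_fst_le.trans (by omega), fun w o a s B hB => ?_⟩
  cases x with
  | nil =>
    simp only [Tree.sz] at hB
    exact run_pop_main (by simp; omega) (run_push_main (by simp; omega))
  | cons x y =>
    simp only [Tree.sz] at hB
    simp only [Tree.ser, List.cons_append, List.append_assoc, Tree.fst]
    refine run_pop_main (by simp; omega) ?_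
    exact .seq (run_toSave x (by simp; omega)) <|
      .seq (run_drop y (by simp; omega)) (run_toMain x (by omega))

theorem comp_snd (x : Tree) :
    Comp (pop (some .main) fun b => if b = some true then take .main false
      else push (some .main) false) x x.snd (2 * x.sz + 2) := by
  refine ⟨by omega, x.sz_snd_le.trans (by omega), fun w o a s B hB => ?_⟩
  cases x with
  | nil =>
    simp only [Tree.sz] at hB
    exact run_pop_main (by simp; omega) (run_push_main (by simp; omega))
  | cons x y =>
    simp only [Tree.sz] at hB
    simp only [Tree.ser, List.cons_append, List.append_assoc, Tree.snd]
    refine run_pop_main (by simp; omega) ?_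
    exact run_drop x (by simp; omega)

/-- After duplication `p` works on the upper copy, and its result waits on `save` while `q` works on
the lower one. The factor 3 pays for the duplication. -/
theorem Comp.cons (hp : Comp p x y b) (hq : Comp q x z b') :
    Comp (.seq dup (.seq p (.seq toSave (.seq q (.seq toMain (push (some .main) true))))))
      x (.cons y z) (3 * (b + b') + 3) := by
  have := hp.1
  have := hq.1
  have := hp.2.1
  have := hq.2.1
  refine ⟨by omega, by simp only [Tree.sz]; omega, fun w o a s B hB => ?_⟩
  refine .seq (run_dup x (by omega)) <| .seq (hp.2.2 w o _ s B (by simp; omega)) <|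
    .seq (run_toSave y (by simp; omega)) <| .seq (hq.2.2 w o _ _ B (by simp; omega)) <|
    .seq (run_toMain y (by simp; omega)) ?_
  simpa [Tree.ser] using run_push_main (b := true) (a := y.ser ++ (z.ser ++ a)) (by simp; omega)

/-- Run `p`, and depending on whether the result is `nil`, run `q` or `r` on the original tree. -/
def branch (p q r : TreeProg) : TreeProg :=
  .seq dup (.seq p (pop (some .main) fun b =>
    if b = some true then .seq (push (some .main) true) (.seq (take .main false) q) else r))

/-- The result `nil` is a single symbol, which the test itself removes; a result of the form `cons`
has to be restored and dropped. -/
theorem Comp.branch_nil (hp : Comp p x .nil b) (hr : Comp r x z b') :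
    Comp (branch p q r) x z (3 * (b + b') + 3) := by
  have := hp.1
  have := hp.2.1
  have := hr.1
  refine ⟨by omega, hr.2.1.trans (by omega), fun w o a s B hB => ?_⟩
  refine .seq (run_dup x (by omega)) <| .seq (hp.2.2 w o _ s B (by simp; omega)) <|
    run_pop_main (by simp; omega) ?_
  exact hr.2.2 w o _ s B (by omega)

theorem Comp.branch_cons (hp : Comp p x (.cons y u) b) (hq : Comp q x z b') :
    Comp (branch p q r) x z (3 * (b + b') + 3) := by
  have := hp.1
  have hs := hp.2.1
  have := hq.1
  simp only [Tree.sz] at hs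
  refine ⟨by omega, hq.2.1.trans (by omega), fun w o a s B hB => ?_⟩
  refine .seq (run_dup x (by omega)) <| .seq (hp.2.2 w o _ s B (by simp; omega)) ?_
  simp only [Tree.ser, List.cons_append, List.append_assoc]
  refine run_pop_main (by simp; omega) <| .seq (run_push_main (by simp; omega)) <|
    .seq (s' := stackOf w o (x.ser ++ a) s [] []) ?_ (hq.2.2 w o _ s B (by omega))
  simpa [Tree.ser] using run_drop (.cons y u) (a := x.ser ++ a) (o := o) (w := w) (s := s) (B := B)
    (by simp [Tree.sz]; omega)

/-- As long as the left subtree of the tree `x` is not `nil`, replace `x` by the result of `p`. -/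
def whileCons (p : TreeProg) : TreeProg :=
  .seq (push (some .count) true) <| loop (some .count) fun _ =>
    pop (some .main) fun b => if b = some true then
      pop (some .main) fun b' => if b' = some true then
        .seq (push (some .main) true) (.seq (push (some .main) true)
          (.seq p (push (some .count) true)))
      else .seq (push (some .main) false) (push (some .main) true)
    else push (some .main) false

/-- A symbol on the counter asks for one more test; the counter is empty while `p` runs, as `Comp`
requires. The number of rounds does not enter the bound, which is what makes an exponentially long
search affordable. -/
theorem Comp.while (x : ℕ → Tree) (n : ℕ)
    (hx : ∀ j < n, (x j).fst ≠ .nil ∧ Comp p (x j) (x (j + 1)) b)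
    (hn : (x n).fst = .nil) (hb : (x n).sz ≤ b) : Comp (whileCons p) (x 0) (x n) (b + 2) := by
  have h₀ : (x 0).sz ≤ b := by
    rcases n with _ | n
    exacts [hb, (hx 0 (by omega)).2.1]
  refine ⟨by omega, by omega, fun w o a s B hB => .seq (run_push_count (by simp; omega)) ?_⟩
  induction n generalizing x with
  | zero =>
    refine run_loop_count (S := stackOf w o ((x 0).ser ++ a) s [] []) (by simp; omega) ?_
      (.loop_nil (by simp; omega) rfl)
    rcases hx₀ : x 0 with _ | ⟨_ | ⟨u, v⟩, y⟩ <;> simp only [hx₀, Tree.sz] at h₀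
    · exact run_pop_main (by simp; omega) (run_push_main (by simp; omega))
    · simp only [Tree.ser, List.cons_append, List.nil_append]
      exact run_pop_main (by simp; omega) <| run_pop_main (by simp; omega) <|
        .seq (run_push_main (by simp; omega)) (run_push_main (by simp; omega))
    · simp [Tree.fst, hx₀] at hn
  | succ n ih =>
    obtain ⟨h₁, h₂⟩ := hx 0 (by omega)
    have h₃ : (x 1).sz ≤ b := h₂.2.1
    refine run_loop_count (S := stackOf w o ((x 1).ser ++ a) s [] [true]) (by simp; omega) ?_
      (ih (fun j => x (j + 1)) (fun j hj => hx (j + 1) (by omega)) hn hb h₃)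
    have h₄ := h₂.2.2 w o a s B (by omega)
    rcases hx₀ : x 0 with _ | ⟨_ | ⟨u, v⟩, y⟩ <;>
      simp only [hx₀, Tree.sz, Tree.fst, ne_eq, not_true_eq_false] at h₀ h₁
    simp only [hx₀, Tree.ser, List.cons_append, List.append_assoc] at h₄ ⊢
    exact run_pop_main (by simp; omega) <| run_pop_main (by simp; omega) <|
      .seq (run_push_main (by simp; omega)) <| .seq (run_push_main (by simp; omega)) <|
      .seq h₄ (run_push_count (by simp; omega))

end

end Prog

end ELKh

namespace ELKh

open Function

/-! ## Functions computable in polynomial space -/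

/-- Types whose elements are coded by trees. -/
class Enc (α : Type*) where
  /-- the code of an element -/
  enc : α → Tree
  inj : Injective enc

export Enc (enc)

section Instances

variable {α β : Type*} [Enc α] [Enc β]

instance : Enc Tree := ⟨id, injective_id⟩

instance : Enc Unit := ⟨fun _ => .nil, fun _ _ _ => rfl⟩

instance : Enc Bool :=
  ⟨fun b => if b then .cons .nil .nil else .nil, by rintro (_ | _) (_ | _) <;> simp⟩

instance : Enc (α × β) :=
  ⟨fun x => .cons (enc x.1) (enc x.2), fun x y h => by
    simp only [Tree.cons.injEq] at h
    exact Prod.ext (Enc.inj h.1) (Enc.inj h.2)⟩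

/-- The code of a list. -/
def encList : List α → Tree
  | [] => .nil
  | a :: l => .cons (enc a) (encList l)

instance : Enc (List α) :=
  ⟨encList, fun l l' h => by
    induction l generalizing l' with
    | nil => cases l' <;> simp_all [encList]
    | cons a l ih =>
      cases l' with
      | nil => simp [encList] at h
      | cons a' l' =>
        simp only [encList, Tree.cons.injEq] at h
        rw [Enc.inj h.1, ih _ h.2]⟩

/-- The code of a natural number, in unary. -/
def encNat : ℕ → Tree
  | 0 => .nil
  | n + 1 => .cons .nil (encNat n)

instance : Enc ℕ :=
  ⟨encNat, fun m n h => by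
    induction m generalizing n with
    | zero => cases n <;> simp_all [encNat]
    | succ m ih =>
      cases n with
      | zero => simp [encNat] at h
      | succ n =>
        simp only [encNat, Tree.cons.injEq, true_and] at h
        rw [ih _ h]⟩

/-- The size of the code of an element. -/
def esz (a : α) : ℕ := (enc a).sz

theorem enc_true : enc true = .cons .nil .nil := rfl
theorem enc_false : enc false = .nil := rfl
theorem enc_pair (a : α) (b : β) : enc (a, b) = .cons (enc a) (enc b) := rfl
theorem enc_nil : enc ([] : List α) = .nil := rfl
theorem enc_cons (a : α) (l : List α) : enc (a :: l) = .cons (enc a) (enc l) := rfl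
theorem enc_succ (n : ℕ) : enc (n + 1) = .cons .nil (enc n) := rfl

theorem esz_pos (a : α) : 1 ≤ esz a := Tree.sz_pos _
theorem esz_tree (x : Tree) : esz x = x.sz := rfl
theorem esz_bool_le (b : Bool) : esz b ≤ 3 := by cases b <;> decide
theorem esz_pair (a : α) (b : β) : esz (a, b) = esz a + esz b + 1 := rfl
theorem esz_nil : esz ([] : List α) = 1 := rfl
theorem esz_cons (a : α) (l : List α) : esz (a :: l) = esz a + esz l + 1 := rfl
theorem esz_nat (n : ℕ) : esz n = 2 * n + 1 := by
  induction n with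
  | zero => rfl
  | succ n ih =>
    simp only [esz, enc_succ, Tree.sz] at ih ⊢
    omega

theorem esz_append (l l' : List α) : esz (l ++ l') + 1 = esz l + esz l' := by
  induction l with
  | nil => simp [esz_nil]; omega
  | cons a l ih => simp only [List.cons_append, esz_cons]; omega

theorem esz_reverse (l : List α) : esz l.reverse = esz l := by
  induction l with
  | nil => rfl
  | cons a l ih =>
    have := esz_append l.reverse [a]
    simp only [List.reverse_cons, esz_cons, esz_nil] at this ⊢
    omega

theorem length_le_esz (l : List α) : l.length ≤ esz l := by
  induction l with
  | nil => simp
  | cons a l ih => simp only [List.length_cons, esz_cons]; omega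

theorem esz_le_of_mem {a : α} {l : List α} (h : a ∈ l) : esz a ≤ esz l := by
  induction l with
  | nil => simp at h
  | cons b l ih =>
    rw [esz_cons]
    rcases List.mem_cons.1 h with rfl | h
    · omega
    · have := ih h; omega

theorem esz_list_le {l : List α} {m M : ℕ} (hm : l.length ≤ m) (hM : ∀ a ∈ l, esz a ≤ M) :
    esz l ≤ m * (M + 1) + 1 := by
  induction l generalizing m with
  | nil => rw [esz_nil]; omega
  | cons a l ih =>
    obtain ⟨m, rfl⟩ : ∃ m', m = m' + 1 := ⟨m - 1, by simp at hm; omega⟩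
    have h₁ := ih (m := m) (by simpa using hm) fun b hb => hM b (by simp [hb])
    have h₂ := hM a (by simp)
    rw [esz_cons, add_mul]
    omega

theorem esz_prefix_le {l l' : List α} (h : l' <+: l) : esz l' ≤ esz l := by
  obtain ⟨r, rfl⟩ := h
  have := esz_append l' r
  have := esz_pos r
  omega

theorem esz_suffix_le {l l' : List α} (h : l' <:+ l) : esz l' ≤ esz l := by
  obtain ⟨r, rfl⟩ := h
  have := esz_append r l'
  have := esz_pos r
  omega

end Instances

/-- `PB s`: the numbers `s a` are polynomially bounded in the size of `a`. -/
def PB {α : Type*} [Enc α] (s : α → ℕ) : Prop := ∃ k, ∀ a, s a ≤ (esz a + 2) ^ k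

/-- `PS f`: the function `f` is computable in polynomial space. -/
def PS {α β : Type*} [Enc α] [Enc β] (f : α → β) : Prop :=
  ∃ (p : Prog.TreeProg) (k : ℕ), ∀ a, p.Comp (enc a) (enc (f a)) ((esz a + 2) ^ k)

section

variable {α β γ δ : Type*} [Enc α] [Enc β] [Enc γ] [Enc δ]

namespace PB

variable {s t : α → ℕ}

theorem mono (h : PB t) (hst : ∀ a, s a ≤ t a) : PB s :=
  h.imp fun _ hk a => (hst a).trans (hk a)

/-- The offset 2 in `PB` keeps the base at least 2, so that powers dominate constants and sums. -/
theorem const (n : ℕ) : PB fun _ : α => n :=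
  ⟨n, fun a => (Nat.lt_two_pow_self).le.trans (Nat.pow_le_pow_left (by omega) n)⟩

theorem add (hs : PB s) (ht : PB t) : PB fun a => s a + t a := by
  obtain ⟨k, hk⟩ := hs
  obtain ⟨l, hl⟩ := ht
  refine ⟨k + l + 1, fun a => ?_⟩
  have h₁ := Nat.pow_le_pow_right (show 0 < esz a + 2 by omega) (show k ≤ k + l by omega)
  have h₂ := Nat.pow_le_pow_right (show 0 < esz a + 2 by omega) (show l ≤ k + l by omega)
  have h₃ := Nat.mul_le_mul_left ((esz a + 2) ^ (k + l)) (show 2 ≤ esz a + 2 by omega)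
  have h₄ : s a ≤ _ := hk a
  have h₅ : t a ≤ _ := hl a
  show s a + t a ≤ _
  rw [pow_succ]
  omega

theorem mul (hs : PB s) (ht : PB t) : PB fun a => s a * t a := by
  obtain ⟨k, hk⟩ := hs
  obtain ⟨l, hl⟩ := ht
  exact ⟨k + l, fun a => by rw [pow_add]; exact Nat.mul_le_mul (hk a) (hl a)⟩

theorem pow (hs : PB s) (n : ℕ) : PB fun a => s a ^ n := by
  obtain ⟨k, hk⟩ := hs
  exact ⟨k * n, fun a => by rw [pow_mul]; exact Nat.pow_le_pow_left (hk a) n⟩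

theorem esz : PB (esz : α → ℕ) := ⟨1, fun a => by rw [pow_one]; omega⟩

end PB

theorem PS.pb {f : α → β} (hf : PS f) : PB fun a => esz (f a) := by
  obtain ⟨p, k, hp⟩ := hf
  exact ⟨k, fun a => (hp a).2.1⟩

namespace PS

theorem of_comp {f : α → β} {b : α → ℕ} (p : Prog.TreeProg) (hb : PB b)
    (h : ∀ a, p.Comp (enc a) (enc (f a)) (b a)) : PS f := by
  obtain ⟨k, hk⟩ := hb
  exact ⟨p, k, fun a => (h a).mono (hk a)⟩

theorem of_enc {f : α → β} {g : α → γ} (hf : PS f) (h : ∀ a, enc (g a) = enc (f a)) : PS g := by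
  obtain ⟨p, k, hp⟩ := hf
  exact ⟨p, k, fun a => by rw [h]; exact hp a⟩

theorem congr {f g : α → β} (hf : PS f) (h : ∀ a, g a = f a) : PS g :=
  hf.of_enc fun a => by rw [h]

protected theorem id : PS (id : α → α) :=
  of_comp _ PB.esz fun a => Prog.comp_skip (enc a)

theorem tree : PS (enc : α → Tree) := PS.id.of_enc fun _ => rfl

/-- `Comp` bounds the output as well as the space, so the input `g a` of `f` has polynomial size. -/
theorem comp {f : β → γ} {g : α → β} (hf : PS f) (hg : PS g) : PS fun a => f (g a) := by
  have hgb := hg.pb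
  obtain ⟨p, k, hp⟩ := hf
  obtain ⟨q, l, hq⟩ := hg
  exact of_comp _ ((PB.pow (PB.esz.add (.const 2)) l).add (PB.pow (hgb.add (.const 2)) k))
    fun a => (hq a).seq (hp (g a))

theorem pair {f : α → β} {g : α → γ} (hf : PS f) (hg : PS g) : PS fun a => (f a, g a) := by
  obtain ⟨p, k, hp⟩ := hf
  obtain ⟨q, l, hq⟩ := hg
  have h := PB.esz (α := α).add (.const 2)
  exact of_comp _ (((PB.const 3).mul ((h.pow k).add (h.pow l))).add (.const 3))
    fun a => (hp a).cons (hq a)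

theorem const (b : β) : PS fun _ : α => b := by
  suffices h : ∀ x : Tree, PS fun _ : α => x from (h (enc b)).of_enc fun _ => rfl
  intro x
  induction x with
  | nil => exact of_comp _ (((PB.const 2).mul PB.esz).add (.const 2)) fun a => Prog.comp_nil (enc a)
  | cons x y hx hy => exact (hx.pair hy).of_enc fun _ => rfl

theorem tree_fst : PS Tree.fst :=
  of_comp _ (((PB.const 2).mul PB.esz).add (.const 2)) fun a => Prog.comp_fst a

theorem tree_snd : PS Tree.snd :=
  of_comp _ (((PB.const 2).mul PB.esz).add (.const 2)) fun a => Prog.comp_snd a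

theorem fst : PS (Prod.fst : α × β → α) := (tree_fst.comp tree).of_enc fun _ => rfl

theorem snd : PS (Prod.snd : α × β → β) := (tree_snd.comp tree).of_enc fun _ => rfl

/-- Case distinction on whether a tree is `nil`. -/
theorem branch {t : α → Tree} {f r : α → γ} (ht : PS t) (hf : PS f)
    {b : β → α × Tree} {c : β → γ} (hg : PS c) (hgb : ∀ z, enc (b z) = enc z)
    (h₀ : ∀ a, t a = .nil → r a = f a) (h₁ : ∀ a, t a ≠ .nil → ∃ z, b z = (a, t a) ∧ r a = c z) :
    PS r := by
  have hp := PS.id.pair ht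
  have hpb := hp.pb
  obtain ⟨p, k, hp⟩ := hp
  obtain ⟨q, l, hq⟩ := ht
  obtain ⟨u, m, hu⟩ := hf
  obtain ⟨v, n, hv⟩ := hg
  have h := PB.esz (α := α).add (.const 2)
  refine of_comp (b := fun a => 3 * ((esz a + 2) ^ l + ((esz a + 2) ^ m +
      ((esz a + 2) ^ k + (esz (a, t a) + 2) ^ n))) + 3) (Prog.branch q (.seq p v) u)
    (((PB.const 3).mul ((h.pow l).add ((h.pow m).add ((h.pow k).add
      ((hpb.add (.const 2)).pow n))))).add (.const 3)) fun a => ?_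
  have h' := hq a
  rcases hx : t a with _ | ⟨x, y⟩
  · rw [hx] at h'
    rw [h₀ a hx]
    exact (h'.branch_nil (hu a)).mono (by omega)
  · obtain ⟨z, hz, hr⟩ := h₁ a (by simp [hx])
    rw [hx] at h'
    rw [hr]
    have h₂ := hp a
    have h₃ := hv z
    -- No conversion is needed: the program for `c` runs directly on the code of `(a, t a)`, which
    -- is also that of `z`.
    have h₄ : enc z = enc (a, t a) := by rw [← hgb, hz]
    rw [esz, h₄] at h₃
    exact (h'.branch_cons (h₂.seq h₃)).mono (by rw [← hx]; simp only [esz]; omega)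

/-- Case distinction on a list. -/
theorem listCases {l : α → List β} {f : α → γ} {g : α → β → List β → γ} (hl : PS l) (hf : PS f)
    (hg : PS fun x : α × β × List β => g x.1 x.2.1 x.2.2) :
    PS fun a => match l a with
      | [] => f a
      | b :: r => g a b r :=
  branch (t := fun a => enc (l a)) (tree.comp hl) hf
    (b := fun z : α × β × List β => (z.1, enc z.2)) hg (fun _ => rfl)
    (fun a ha => by rcases h : l a with _ | ⟨b, r⟩ <;> simp_all [enc_cons])
    (fun a ha => by
      rcases h : l a with _ | ⟨b, r⟩
      · simp [h, enc_nil] at ha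
      · exact ⟨(a, b, r), rfl, rfl⟩)

theorem ite {c : α → Prop} [DecidablePred c] {f g : α → γ} (hc : PS fun a => decide (c a))
    (hf : PS f) (hg : PS g) : PS fun a => if c a then f a else g a := by
  -- `true` and `false` have the same codes as `[()]` and `[]`.
  have h : PS fun a => if c a then [()] else [] :=
    hc.of_enc fun a => by by_cases h : c a <;> simp [h] <;> rfl
  refine (listCases h hg (g := fun a _ _ => f a) (hf.comp fst)).congr fun a => ?_
  by_cases h : c a <;> simp [h]

theorem cond {c : α → Bool} {f g : α → γ} (hc : PS c) (hf : PS f) (hg : PS g) :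
    PS fun a => if c a then f a else g a :=
  ite (by simpa using hc) hf hg

theorem not {c : α → Bool} (hc : PS c) : PS fun a => !c a :=
  (hc.cond (const false) (const true)).congr fun a => by cases c a <;> rfl

theorem and {c d : α → Bool} (hc : PS c) (hd : PS d) : PS fun a => c a && d a :=
  (hc.cond hd (const false)).congr fun a => by cases c a <;> rfl

theorem or {c d : α → Bool} (hc : PS c) (hd : PS d) : PS fun a => c a || d a :=
  (hc.cond (const true) hd).congr fun a => by cases c a <;> rfl

/-- Iteration as long as a test is satisfied. -/
theorem iterate {f : β → β} {t : β → Bool} {g r : α → β} {b : α → ℕ} (hf : PS f) (ht : PS t)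
    (hg : PS g) (hb : PB b)
    (h : ∀ a, ∃ n, (∀ j < n, t (f^[j] (g a)) = true) ∧ t (f^[n] (g a)) = false ∧
      f^[n] (g a) = r a ∧ ∀ j ≤ n, esz (f^[j] (g a)) ≤ b a) : PS r := by
  -- The value of the test is stored as the left component, where `Prog.whileCons` looks for it.
  have hbody : PS fun x : Bool × β => (t (f x.2), f x.2) :=
    (ht.comp (hf.comp snd)).pair (hf.comp snd)
  have hinit : PS fun a => (t (g a), g a) := (ht.comp hg).pair hg
  suffices hr : PS fun a => (false, r a) from snd.comp hr
  obtain ⟨p, k, hp⟩ := hbody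
  obtain ⟨q, l, hq⟩ := hinit
  refine of_comp (b := fun a => (esz a + 2) ^ l + ((b a + 4 + (b a + 4 + 2) ^ k) + 2))
    (.seq q (Prog.whileCons p))
    (((PB.esz.add (.const 2)).pow l).add (((hb.add (.const 4)).add
      (((hb.add (.const 4)).add (.const 2)).pow k)).add (.const 2))) fun a => (hq a).seq ?_
  obtain ⟨n, hn, hn', hr, hsz⟩ := h a
  have hx : ∀ j ≤ n, esz (t (f^[j] (g a)), f^[j] (g a)) ≤ b a + 4 := fun j hj => by
    have := hsz j hj
    have := esz_bool_le (t (f^[j] (g a)))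
    rw [esz_pair]
    omega
  have := Prog.Comp.while (p := p) (b := b a + 4 + (b a + 4 + 2) ^ k)
    (fun j => enc (t (f^[j] (g a)), f^[j] (g a))) n
    (fun j hj => ⟨by simp [hn j hj, enc_pair, Tree.fst, enc_true], by
      have h₁ := hp (t (f^[j] (g a)), f^[j] (g a))
      simp only [← iterate_succ_apply' f] at h₁
      refine h₁.mono (le_trans (Nat.pow_le_pow_left ?_ k) (Nat.le_add_left _ _))
      have := hx j hj.le
      omega⟩)
    (by simp [hn', enc_pair, Tree.fst, enc_false]) ((hx n le_rfl).trans (Nat.le_add_right _ _))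
  rw [hr] at hn'
  simpa only [iterate_zero, id_eq, hr, hn'] using this

theorem nil : PS fun _ : α => ([] : List β) := const []

theorem cons {f : α → β} {l : α → List β} (hf : PS f) (hl : PS l) : PS fun a => f a :: l a :=
  (hf.pair hl).of_enc fun _ => rfl

/-- The accumulator has to be bounded on all prefixes: polynomial growth in each step could
accumulate to exponential size. -/
theorem foldl {l : α → List β} {g : α → γ} {h : α → γ → β → γ} {b : α → ℕ} (hl : PS l) (hg : PS g)
    (hh : PS fun x : α × γ × β => h x.1 x.2.1 x.2.2) (hb : PB b)
    (hlb : ∀ a l', l' <+: l a → esz (l'.foldl (h a) (g a)) ≤ b a) :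
    PS fun a => (l a).foldl (h a) (g a) := by
  let f : α × List β × γ → α × List β × γ := fun x =>
    match x.2.1 with
    | [] => x
    | y :: r => (x.1, r, h x.1 x.2.2 y)
  have hf : PS f := by
    refine (listCases (l := fun x : α × List β × γ => x.2.1) (f := id)
      (g := fun x y r => (x.1, r, h x.1 x.2.2 y)) (fst.comp snd) PS.id ?_)
    exact (fst.comp fst).pair ((snd.comp snd).pair (hh.comp ((fst.comp fst).pair
      ((snd.comp (snd.comp fst)).pair (fst.comp snd)))))
  have ht : PS fun x : α × List β × γ => !x.2.1.isEmpty := by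
    refine (listCases (l := fun x : α × List β × γ => x.2.1) (fst.comp snd) (const false)
      (g := fun _ _ _ => true) (const true)).congr fun x => ?_
    rcases x.2.1 with _ | ⟨y, r⟩ <;> rfl
  suffices hr : PS fun a => (a, ([] : List β), (l a).foldl (h a) (g a)) from snd.comp (snd.comp hr)
  refine PS.iterate (b := fun a => esz a + (esz (l a) + b a + 1) + 1) hf ht
    (PS.id.pair (hl.pair hg)) ((PB.esz.add ((hl.pb.add hb).add (.const 1))).add (.const 1))
    fun a => ⟨(l a).length, ?_⟩
  have key : ∀ j ≤ (l a).length, f^[j] (a, l a, g a) =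
      (a, (l a).drop j, ((l a).take j).foldl (h a) (g a)) := by
    intro j hj
    induction j with
    | zero => simp
    | succ j ih =>
      rw [iterate_succ_apply', ih (by omega)]
      have h₁ : (l a).drop j = (l a)[j] :: (l a).drop (j + 1) := List.drop_eq_getElem_cons (by omega)
      simp only [f, h₁, List.take_succ_eq_append_getElem hj, List.foldl_append, List.foldl_cons,
        List.foldl_nil]
  refine ⟨fun j hj => ?_, ?_, ?_, fun j hj => ?_⟩
  · simp only [id_eq, key j hj.le, List.drop_eq_getElem_cons hj]
    rfl
  · simp only [id_eq, key _ le_rfl]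
    simp
  · simp only [id_eq, key _ le_rfl]
    simp
  · simp only [id_eq, key j hj, esz_pair]
    have := hlb a _ (List.take_prefix j (l a))
    have := esz_suffix_le (List.drop_suffix j (l a))
    omega

theorem reverse {l : α → List β} (hl : PS l) : PS fun a => (l a).reverse := by
  have h := foldl (g := fun _ => []) (h := fun _ acc x => x :: acc) hl nil
    ((snd.comp snd).cons (fst.comp snd)) hl.pb fun a l' hl' => by
      simpa [esz_reverse] using esz_prefix_le hl'
  exact h.congr fun a => by simp

theorem append {l l' : α → List β} (hl : PS l) (hl' : PS l') : PS fun a => l a ++ l' a := by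
  have h := foldl (g := l') (h := fun _ acc x => x :: acc) hl.reverse hl'
    ((snd.comp snd).cons (fst.comp snd)) (hl.pb.add hl'.pb) fun a m hm => by
      have h₁ := esz_prefix_le hm
      have h₂ := esz_append m.reverse (l' a)
      simp only [List.foldl_flip_cons_eq_append, List.map_id', esz_reverse] at *
      omega
  exact h.congr fun a => by simp

theorem flatMap {l : α → List β} {g : α → β → List γ} (hl : PS l)
    (hg : PS fun x : α × β => g x.1 x.2) : PS fun a => (l a).flatMap (g a) := by
  obtain ⟨k, hk⟩ := hg.pb
  have h := foldl (g := fun _ => []) (h := fun a acc x => acc ++ g a x) hl nil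
    ((fst.comp snd).append (hg.comp (fst.pair (snd.comp snd))))
    (b := fun a => esz (l a) * (esz a + esz (l a) + 1 + 2) ^ k + 1)
    ((hl.pb.mul (PB.pow (((PB.esz.add hl.pb).add (.const 1)).add (.const 2)) k)).add (.const 1))
    fun a m hm => by
      have key : ∀ m : List β, (∀ x ∈ m, x ∈ l a) → esz (m.flatMap (g a)) ≤
          m.length * (esz a + esz (l a) + 1 + 2) ^ k + 1 := by
        intro m hm
        induction m with
        | nil => simp [esz_nil]
        | cons x m ih =>
          have h₁ := ih fun y hy => hm y (by simp [hy])
          have h₂ := esz_append (g a x) (m.flatMap (g a))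
          have h₃ : esz (g a x) ≤ _ := hk (a, x)
          have h₄ := esz_le_of_mem (hm x (by simp))
          have h₅ : (esz (a, x) + 2) ^ k ≤ (esz a + esz (l a) + 1 + 2) ^ k :=
            Nat.pow_le_pow_left (by rw [esz_pair]; omega) k
          simp only [List.flatMap_cons, List.length_cons, add_mul, one_mul]
          omega
      have h₁ := key m fun x hx => hm.subset hx
      have h₂ : m.length ≤ esz (l a) := hm.length_le.trans (length_le_esz _)
      have h₃ := Nat.mul_le_mul_right ((esz a + esz (l a) + 1 + 2) ^ k) h₂
      rw [List.foldl_append_eq_append, List.nil_append, ← List.flatMap_def]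
      omega
  exact h.congr fun a => by rw [List.foldl_append_eq_append, List.nil_append, ← List.flatMap_def]

theorem map {l : α → List β} {g : α → β → γ} (hl : PS l)
    (hg : PS fun x : α × β => g x.1 x.2) : PS fun a => (l a).map (g a) :=
  (hl.flatMap (g := fun a x => [g a x]) (hg.cons nil)).congr fun a => by
    induction l a <;> simp_all

theorem filter {l : α → List β} {p : α → β → Bool} (hl : PS l)
    (hp : PS fun x : α × β => p x.1 x.2) : PS fun a => (l a).filter (p a) :=
  (hl.flatMap (g := fun a x => if p a x then [x] else []) (hp.cond (snd.cons nil) nil)).congr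
    fun a => by
      induction l a with
      | nil => rfl
      | cons x l ih => rw [List.filter_cons, List.flatMap_cons, ← ih]; split <;> rfl

theorem isEmpty {l : α → List β} (hl : PS l) : PS fun a => (l a).isEmpty :=
  (listCases hl (const true) (g := fun _ _ _ => false) (const false)).congr fun a => by
    rcases l a with _ | ⟨y, r⟩ <;> rfl

theorem any {l : α → List β} {p : α → β → Bool} (hl : PS l)
    (hp : PS fun x : α × β => p x.1 x.2) : PS fun a => (l a).any (p a) :=
  (hl.filter hp).isEmpty.not.congr fun a => by
    rw [Bool.eq_iff_iff]
    simp

theorem all {l : α → List β} {p : α → β → Bool} (hl : PS l)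
    (hp : PS fun x : α × β => p x.1 x.2) : PS fun a => (l a).all (p a) :=
  (hl.any (p := fun a x => !p a x) hp.not).not.congr fun a => by
    rw [Bool.eq_iff_iff]
    simp

end PS

end

end ELKh

namespace ELKh

open Form

section

variable {P : Type*} {I : Type*}

/-! ## Closed tableaux do not depend on the orders -/

/-- No formula of `Γ` can be expanded. -/
def Saturated (Γ : Set (Form P I)) : Prop := ∀ φ ∈ Γ, ¬ Active Γ φ

/-- All labels that the modal rules create from a node with label `Δ` belong to `X`. -/
structure ModalClosed (X : Set (Set (Form P I))) (Δ : Set (Form P I)) : Prop where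
  dia : ∀ i ψ, neg (K i ψ) ∈ Δ → diamondLabel i ψ Δ ∈ X
  how : ∀ i ψ, Kh i ψ ∈ Δ → neg (K i ψ) ∈ Δ → {K i ψ} ∈ X
  negHow : ∀ i χ ψ, neg (Kh i χ) ∈ Δ → Kh i ψ ∈ Δ → neg (K i ψ) ∈ Δ →
    {K i ψ, neg (Kh i χ)} ∈ X

/-- Every member of `X` has a saturated consistent extension from which the modal rules lead to
members of `X` again. -/
def GoodFamily (X : Set (Set (Form P I))) : Prop :=
  ∀ Γ ∈ X, ∃ Δ, Γ ⊆ Δ ∧ Saturated Δ ∧ ¬ BlatantlyInconsistent Δ ∧ ModalClosed X Δ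

/-- The labels from which the construction can go on forever without blatant inconsistency. -/
def Good (Γ : Set (Form P I)) : Prop := ∃ X, GoodFamily X ∧ Γ ∈ X

theorem ModalClosed.mono {X Y : Set (Set (Form P I))} {Δ : Set (Form P I)}
    (h : ModalClosed X Δ) (hXY : X ⊆ Y) : ModalClosed Y Δ :=
  ⟨fun i ψ h₁ => hXY (h.dia i ψ h₁), fun i ψ h₁ h₂ => hXY (h.how i ψ h₁ h₂),
    fun i χ ψ h₁ h₂ h₃ => hXY (h.negHow i χ ψ h₁ h₂ h₃)⟩

/-- The union of all good families is a good family, because `ModalClosed` is monotone in the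
family. -/
theorem Good.unfold {Γ : Set (Form P I)} (h : Good Γ) :
    ∃ Δ, Γ ⊆ Δ ∧ Saturated Δ ∧ ¬ BlatantlyInconsistent Δ ∧ ModalClosed {Γ' | Good Γ'} Δ := by
  obtain ⟨X, hX, hΓ⟩ := h
  obtain ⟨Δ, h₁, h₂, h₃, h₄⟩ := hX Γ hΓ
  exact ⟨Δ, h₁, h₂, h₃, h₄.mono fun Γ' h' => ⟨X, hX, h'⟩⟩

/-- The converse half of the fixed-point property: adjoining `Γ` to the family of all good labels
gives a good family. -/
theorem Good.of_extension {Γ Δ : Set (Form P I)} (h : Γ ⊆ Δ) (h₁ : Saturated Δ)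
    (h₂ : ¬ BlatantlyInconsistent Δ) (h₃ : ModalClosed {Γ' | Good Γ'} Δ) : Good Γ := by
  refine ⟨insert Γ {Γ' | Good Γ'}, ?_, Set.mem_insert _ _⟩
  rintro Γ' (rfl | h')
  · exact ⟨Δ, h, h₁, h₂, h₃.mono (Set.subset_insert _ _)⟩
  · obtain ⟨Δ', h₁', h₂', h₃', h₄'⟩ := Good.unfold h'
    exact ⟨Δ', h₁', h₂', h₃', h₄'.mono (Set.subset_insert _ _)⟩

theorem Good.mono {Γ Γ' : Set (Form P I)} (h : Good Γ) (h' : Γ' ⊆ Γ) : Good Γ' := by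
  obtain ⟨Δ, h₁, h₂, h₃, h₄⟩ := h.unfold
  exact .of_extension (h'.trans h₁) h₂ h₃ h₄

theorem BlatantlyInconsistent.mono {Γ Δ : Set (Form P I)} (h : BlatantlyInconsistent Γ)
    (hΓ : Γ ⊆ Δ) : BlatantlyInconsistent Δ :=
  h.imp (fun ⟨φ, h₁, h₂⟩ => ⟨φ, hΓ h₁, hΓ h₂⟩) fun h => hΓ h

theorem Good.not_inconsistent {Γ : Set (Form P I)} (h : Good Γ) : ¬ BlatantlyInconsistent Γ := by
  obtain ⟨Δ, h₁, -, h₃, -⟩ := h.unfold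
  exact fun h => h₃ (h.mono h₁)

theorem diamondLabel_mono {Γ Δ : Set (Form P I)} (h : Γ ⊆ Δ) (i : I) (ψ : Form P I) :
    diamondLabel i ψ Γ ⊆ diamondLabel i ψ Δ :=
  Set.insert_subset_insert fun _ hφ => ⟨h hφ.1, hφ.2⟩

/-- One of the alternatives for a formula in a good label is good. -/
theorem Good.expand {Γ : Set (Form P I)} (h : Good Γ) {φ : Form P I} (hφ : φ ∈ Γ)
    (hne : φ.expansions ≠ []) : ∃ A ∈ φ.expansions, Good (Γ ∪ A) := by
  obtain ⟨Δ, h₁, h₂, h₃, h₄⟩ := h.unfold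
  have h₅ := h₂ φ (h₁ hφ)
  simp only [Active, not_and, not_forall, not_not] at h₅
  obtain ⟨A, hA, hA'⟩ := h₅ hne
  exact ⟨A, hA, .of_extension (Set.union_subset h₁ hA') h₂ h₃ h₄⟩

/-- The modal rules are known to stay good from a saturated extension. Applied to `Γ` itself they
give smaller labels, and goodness passes to subsets. -/
theorem Good.modalClosed {Γ : Set (Form P I)} (h : Good Γ) : ModalClosed {Γ' | Good Γ'} Γ := by
  obtain ⟨Δ, h₁, -, -, h₄⟩ := h.unfold
  exact ⟨fun i ψ h => (h₄.dia i ψ (h₁ h)).mono (diamondLabel_mono h₁ i ψ),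
    fun i ψ h h' => h₄.how i ψ (h₁ h) (h₁ h'),
    fun i χ ψ h h' h'' => h₄.negHow i χ ψ (h₁ h) (h₁ h') (h₁ h'')⟩

/-! ## Finiteness of labels -/

theorem self_mem_sub (φ : Form P I) : φ ∈ φ.sub := by
  cases φ <;> simp [Form.sub]

theorem sub_trans {φ ψ χ : Form P I} (h : ψ ∈ φ.sub) (h' : χ ∈ ψ.sub) : χ ∈ φ.sub := by
  induction φ with
  | bot => obtain rfl : ψ = bot := h; exact h'
  | letter p => obtain rfl : ψ = letter p := h; exact h'
  | neg φ ih | K i φ ih | Kh i φ ih =>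
    rcases h with rfl | h
    exacts [h', Or.inr (ih h)]
  | and φ₁ φ₂ ih₁ ih₂ =>
    rcases h with rfl | h | h
    exacts [h', Or.inr (Or.inl (ih₁ h)), Or.inr (Or.inr (ih₂ h))]

theorem finite_sub (φ : Form P I) : φ.sub.Finite := by
  induction φ with
  | bot | letter p => exact Set.finite_singleton _
  | neg φ ih | K i φ ih | Kh i φ ih => exact ih.insert _
  | and φ₁ φ₂ ih₁ ih₂ => exact (ih₁.union ih₂).insert _

/-- The maps send formulas not of the form `Kh i ψ` to themselves, which is harmless in an
inclusion. The four images account for the factor 4 in the depth of the search. -/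
theorem subPlus_eq (φ : Form P I) : φ.subPlus ⊆ φ.sub ∪ neg '' φ.sub ∪
    ((fun χ => match χ with | Kh i ψ => K i ψ | χ => χ) '' φ.sub ∪
      (fun χ => match χ with | Kh i ψ => neg (K i ψ) | χ => χ) '' φ.sub) := by
  rintro χ (⟨ψ, h, rfl | rfl⟩ | ⟨i, ψ, h, rfl | rfl⟩)
  · exact .inl (.inl h)
  · exact .inl (.inr ⟨ψ, h, rfl⟩)
  · exact .inr (.inl ⟨_, h, rfl⟩)
  · exact .inr (.inr ⟨_, h, rfl⟩)

theorem finite_subPlus (φ : Form P I) : φ.subPlus.Finite := by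
  have h := finite_sub φ
  exact ((h.union (h.image _)).union ((h.image _).union (h.image _))).subset (subPlus_eq φ)

theorem ncard_subPlus_le (φ : Form P I) : φ.subPlus.ncard ≤ 4 * φ.sub.ncard := by
  have h := finite_sub φ
  refine (Set.ncard_le_ncard (subPlus_eq φ)
    ((h.union (h.image _)).union ((h.image _).union (h.image _)))).trans ?_
  refine (Set.ncard_union_le _ _).trans ?_
  have h₁ := Set.ncard_union_le φ.sub (neg '' φ.sub)
  have h₂ := Set.ncard_union_le
    ((fun χ : Form P I => match χ with | Kh i ψ => K i ψ | χ => χ) '' φ.sub)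
    ((fun χ => match χ with | Kh i ψ => neg (K i ψ) | χ => χ) '' φ.sub)
  have h₃ := Set.ncard_image_le (f := neg) h
  have h₄ := Set.ncard_image_le
    (f := fun χ : Form P I => match χ with | Kh i ψ => K i ψ | χ => χ) h
  have h₅ := Set.ncard_image_le
    (f := fun χ : Form P I => match χ with | Kh i ψ => neg (K i ψ) | χ => χ) h
  omega

theorem sub_subset_subPlus (φ : Form P I) : φ.sub ⊆ φ.subPlus :=
  fun _ h => .inl ⟨_, h, .inl rfl⟩

section closure

variable {φ ψ χ : Form P I} {i : I}

theorem neg_mem_subPlus (h : neg ψ ∈ φ.subPlus) :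
    ψ ∈ φ.sub ∨ ∃ i χ, ψ = K i χ ∧ Kh i χ ∈ φ.sub := by
  rcases h with ⟨χ, h, rfl | h'⟩ | ⟨i, χ, h, h' | h'⟩
  · exact .inl (sub_trans h (.inr (self_mem_sub _)))
  · cases h'; exact .inl h
  · cases h'
  · cases h'; exact .inr ⟨i, χ, rfl, h⟩

theorem sub_of_K_mem_subPlus (h : K i ψ ∈ φ.subPlus) : ψ ∈ φ.sub := by
  rcases h with ⟨χ, h, rfl | h'⟩ | ⟨i, χ, h, h' | h'⟩
  · exact sub_trans h (.inr (self_mem_sub _))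
  · cases h'
  · cases h'; exact sub_trans h (.inr (self_mem_sub _))
  · cases h'

theorem sub_of_neg_K_mem_subPlus (h : neg (K i ψ) ∈ φ.subPlus) : ψ ∈ φ.sub := by
  rcases neg_mem_subPlus h with h | ⟨j, χ, h', h⟩
  · exact sub_trans h (.inr (self_mem_sub _))
  · cases h'; exact sub_trans h (.inr (self_mem_sub _))

theorem sub_of_neg_mem_subPlus (h : neg ψ ∈ φ.subPlus) (hψ : ∀ i χ, ψ ≠ K i χ) : ψ ∈ φ.sub := by
  rcases neg_mem_subPlus h with h | ⟨j, χ, h', h⟩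
  exacts [h, absurd h' (hψ j χ)]

theorem sub_of_Kh_mem_subPlus (h : Kh i ψ ∈ φ.subPlus) : Kh i ψ ∈ φ.sub := by
  rcases h with ⟨χ, h, rfl | h'⟩ | ⟨i, χ, h, h' | h'⟩
  · exact h
  all_goals cases h'

theorem sub_of_and_mem_subPlus (h : and ψ χ ∈ φ.subPlus) : and ψ χ ∈ φ.sub := by
  rcases h with ⟨χ, h, rfl | h'⟩ | ⟨i, χ, h, h' | h'⟩
  · exact h
  all_goals cases h'

theorem mem_subPlus_of_sub (h : ψ ∈ φ.sub) : ψ ∈ φ.subPlus := sub_subset_subPlus φ h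

theorem neg_mem_subPlus_of_sub (h : ψ ∈ φ.sub) : neg ψ ∈ φ.subPlus := .inl ⟨_, h, .inr rfl⟩

theorem K_mem_subPlus (h : Kh i ψ ∈ φ.subPlus) : K i ψ ∈ φ.subPlus :=
  .inr ⟨i, ψ, sub_of_Kh_mem_subPlus h, .inl rfl⟩

theorem neg_K_mem_subPlus (h : Kh i ψ ∈ φ.sub) : neg (K i ψ) ∈ φ.subPlus :=
  .inr ⟨i, ψ, h, .inr rfl⟩

/-- The additional members `K i ψ` and `neg (K i ψ)` of `subPlus` serve the rules for `Kh i ψ` and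
its negation; all other alternatives consist of subformulas and their negations. -/
theorem expansions_subset_subPlus (h : ψ ∈ φ.subPlus) {A : Set (Form P I)}
    (hA : A ∈ ψ.expansions) : A ⊆ φ.subPlus := by
  unfold Form.expansions at hA
  split at hA <;>
    simp only [List.mem_cons, List.not_mem_nil, or_false] at hA
  · subst hA
    rintro _ rfl
    exact mem_subPlus_of_sub (sub_trans (sub_of_neg_mem_subPlus h (by simp))
      (.inr (self_mem_sub _)))
  · have h' := sub_of_and_mem_subPlus h
    subst hA
    rintro _ (rfl | rfl)
    · exact mem_subPlus_of_sub (sub_trans h' (.inr (.inl (self_mem_sub _))))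
    · exact mem_subPlus_of_sub (sub_trans h' (.inr (.inr (self_mem_sub _))))
  · have h' := sub_of_neg_mem_subPlus h (by simp)
    have h₁ := sub_trans h' (.inr (.inl (self_mem_sub _)))
    have h₂ := sub_trans h' (.inr (.inr (self_mem_sub _)))
    rcases hA with rfl | rfl | rfl <;> rintro _ (rfl | rfl) <;>
      first | exact mem_subPlus_of_sub ‹_› | exact neg_mem_subPlus_of_sub ‹_›
  · subst hA
    rintro _ rfl
    exact mem_subPlus_of_sub (sub_of_K_mem_subPlus h)
  · have h' := sub_of_neg_K_mem_subPlus h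
    rcases hA with rfl | rfl <;> rintro _ rfl
    exacts [neg_mem_subPlus_of_sub h', mem_subPlus_of_sub h']
  · have h' := sub_of_Kh_mem_subPlus h
    rcases hA with rfl | rfl <;> rintro _ rfl
    exacts [neg_K_mem_subPlus h', K_mem_subPlus h]
  · subst hA
    rintro _ rfl
    exact neg_K_mem_subPlus (sub_of_neg_mem_subPlus h (by simp))

end closure

theorem getD_expansions_mem {φ : Form P I} {k : ℕ} (hk : k < φ.expansions.length) :
    φ.expansions.getD k ∅ ∈ φ.expansions := by
  rw [List.getD_eq_getElem _ _ hk]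
  exact List.getElem_mem hk

variable {ord : Node P I → LinearOrder (Form P I)} {φ₀ : Form P I} {n : Node P I}

theorem label_subset_subPlus (h : IsNode ord φ₀ n) : label φ₀ n ⊆ φ₀.subPlus := by
  induction h with
  | root =>
    rintro _ rfl
    exact mem_subPlus_of_sub (self_mem_sub _)
  | expand hn hb hc hφ hk ih =>
    exact Set.union_subset ih (expansions_subset_subPlus (ih hφ.1.1) (getD_expansions_mem hk))
  | dia hn hb hc ha hψ hi ih =>
    refine Set.insert_subset ?_ fun χ hχ => ih hχ.1
    exact neg_mem_subPlus_of_sub (sub_of_neg_K_mem_subPlus (ih hψ))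
  | how hn hb hc ha hψ hψ' ih =>
    rintro _ rfl
    exact K_mem_subPlus (ih hψ)
  | negHow hn hb hc ha hχ hψ hψ' ih =>
    rintro _ (rfl | rfl)
    exacts [K_mem_subPlus (ih hψ), ih hχ]

theorem finite_label (h : IsNode ord φ₀ n) : (label φ₀ n).Finite :=
  (finite_subPlus φ₀).subset (label_subset_subPlus h)

theorem not_active_of_subset {Γ Δ : Set (Form P I)} (h : Γ ⊆ Δ) {φ : Form P I}
    (hφ : ¬ Active Γ φ) : ¬ Active Δ φ :=
  fun h' => hφ ⟨h'.1, fun A hA hA' => h'.2 A hA (hA'.trans h)⟩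

/-- Checked formulas need no expansion. -/
theorem not_active_of_checked (h : IsNode ord φ₀ n) {φ : Form P I}
    (hφ : φ ∈ checked ord φ₀ n) : ¬ Active (label φ₀ n) φ := by
  induction h generalizing φ with
  | @expand n χ k hn hb hc hχ hk ih =>
    have hsub : label φ₀ n ⊆ label φ₀ (.expand χ k :: n) := Set.subset_union_left
    by_cases h₁ : φ ∈ checked ord φ₀ n
    · exact not_active_of_subset hsub (ih h₁)
    obtain ⟨h₂, h₃⟩ := hφ.resolve_left h₁
    let := ord n
    rcases (show φ ≤ χ from h₃).lt_or_eq with h₄ | rfl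
    · exact not_active_of_subset hsub (hχ.2 φ h₂ h₁ h₄)
    -- The formula just expanded: the alternative taken at this successor is now part of the label.
    · exact fun h' => h'.2 _ (getD_expansions_mem hk) Set.subset_union_right
  | _ => simp [checked] at hφ

theorem saturated_of_allChecked (h : IsNode ord φ₀ n) (ha : AllChecked ord φ₀ n) :
    Saturated (label φ₀ n) := fun φ hφ => by
  by_cases hc : φ ∈ checked ord φ₀ n
  exacts [not_active_of_checked h hc, ha φ hφ hc]

theorem exists_expands (h : IsNode ord φ₀ n) (ha : ¬ AllChecked ord φ₀ n) :
    ∃ φ, Expands ord φ₀ n φ := by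
  simp only [AllChecked, not_forall, not_not] at ha
  obtain ⟨φ, h₁, h₂, h₃⟩ := ha
  let := ord n
  obtain ⟨ψ, hψ⟩ := (show {χ ∈ label φ₀ n | χ ∉ checked ord φ₀ n ∧
    Active (label φ₀ n) χ}.Finite from (finite_label h).subset fun χ hχ => hχ.1).exists_minimal
    ⟨φ, h₁, h₂, h₃⟩
  refine ⟨ψ, hψ.prop, fun χ h₄ h₅ h₆ h₇ => ?_⟩
  exact absurd (hψ.le_of_le ⟨h₄, h₅, h₇⟩ (show χ ≤ ψ from (show χ < ψ from h₆).le))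
    (not_le_of_gt (show χ < ψ from h₆))

theorem Expands.not_allChecked {φ : Form P I} (h : Expands ord φ₀ n φ) :
    ¬ AllChecked ord φ₀ n := fun ha => ha φ h.1.1 h.1.2.1 h.1.2.2

theorem IsNode.parent {s : Succ P I} (h : IsNode ord φ₀ (s :: n)) :
    IsNode ord φ₀ n ∧ ¬ Blocked φ₀ n ∧ ¬ BlatantlyInconsistent (label φ₀ n) := by
  cases h with
  | expand hn hb hc | dia hn hb hc | how hn hb hc | negHow hn hb hc => exact ⟨hn, hb, hc⟩

theorem IsNode.of_suffix {n' : Node P I} (h : IsNode ord φ₀ n) (hs : n' <:+ n) :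
    IsNode ord φ₀ n' := by
  induction n with
  | nil => rw [List.suffix_nil.1 hs]; exact h
  | cons s n ih =>
    rcases List.suffix_cons_iff.1 hs with rfl | hs
    exacts [h, ih h.parent.1 hs]

/-- A node with a proper descendant is neither blocked nor inconsistent. -/
theorem IsNode.not_blocked_of_suffix {n' : Node P I} {s : Succ P I}
    (h : IsNode ord φ₀ (s :: n)) (hs : n' <:+ n) : ¬ Blocked φ₀ n' := by
  induction n generalizing s with
  | nil => rw [List.suffix_nil.1 hs]; exact h.parent.2.1
  | cons s n ih =>
    rcases List.suffix_cons_iff.1 hs with rfl | hs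
    exacts [h.parent.2.1, ih h.parent.1 hs]

/-! ### Complete subtrees and good labels -/

theorem IsCompleteSubtree.mem_of_suffix {S : Set (Node P I)} (hS : IsCompleteSubtree ord φ₀ S)
    {n' : Node P I} (hn : n ∈ S) (h : n' <:+ n) : n' ∈ S := by
  induction n with
  | nil => rwa [List.suffix_nil.1 h]
  | cons s n ih =>
    rcases List.suffix_cons_iff.1 h with rfl | h
    exacts [hn, ih (hS.parent_mem s n hn) h]

/-- The nodes of a tableau all of whose ancestors satisfy `Q` form a complete subtree, if the
successors at "and" nodes inherit `Q` and some successor at each "or" node does. -/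
theorem isCompleteSubtree_of_forall_suffix (Q : Node P I → Prop) (h₀ : Q [])
    (hand : ∀ s n, IsNode ord φ₀ (s :: n) → AllChecked ord φ₀ n → Q n → Q (s :: n))
    (hor : ∀ n φ, IsNode ord φ₀ n → ¬ Blocked φ₀ n → ¬ BlatantlyInconsistent (label φ₀ n) →
      Expands ord φ₀ n φ → Q n → ∃ k < φ.expansions.length, Q (.expand φ k :: n)) :
    IsCompleteSubtree ord φ₀ {n | IsNode ord φ₀ n ∧ ∀ n', n' <:+ n → Q n'} where
  isNode n hn := hn.1
  root_mem := ⟨.root, fun n' h => by rwa [List.suffix_nil.1 h]⟩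
  parent_mem s n hn := ⟨hn.1.parent.1, fun n' h => hn.2 n' (h.trans (List.suffix_cons s n))⟩
  and_node n hn ha := by
    rintro _ ⟨hs, s, rfl⟩
    refine ⟨hs, fun n' h => ?_⟩
    rcases List.suffix_cons_iff.1 h with rfl | h
    exacts [hand s n hs ha (hn.2 n List.suffix_rfl), hn.2 n' h]
  or_node n hn ha hne := by
    obtain ⟨_, hs, s, rfl⟩ := hne
    obtain ⟨-, hb, hc⟩ := hs.parent
    obtain ⟨φ, hφ⟩ := exists_expands hn.1 ha
    obtain ⟨k, hk, hQ⟩ := hor n φ hn.1 hb hc hφ (hn.2 n List.suffix_rfl)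
    refine ⟨_, ⟨.expand hn.1 hb hc hφ hk, _, rfl⟩, .expand hn.1 hb hc hφ hk, fun n' h => ?_⟩
    rcases List.suffix_cons_iff.1 h with rfl | h
    exacts [hQ, hn.2 n' h]

/-- Goodness is inherited by all successors at "and" nodes and by some successor at "or" nodes. Loop
test and blocking only remove successors, so they do no harm here. -/
theorem not_tableauClosed_of_good (h : Good {φ₀}) : ¬ TableauClosed ord φ₀ := by
  intro hc
  obtain ⟨n, hn, hn'⟩ := hc _ <| isCompleteSubtree_of_forall_suffix
    (fun n => Good (label φ₀ n)) h
    (fun s n hs ha hg => by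
      have hm := hg.modalClosed
      cases hs with
      | expand _ _ _ hφ _ => exact absurd ha hφ.not_allChecked
      | dia _ _ _ _ hψ _ => exact hm.dia _ _ hψ
      | how _ _ _ _ hψ hψ' => exact hm.how _ _ hψ hψ'
      | negHow _ _ _ _ hχ hψ hψ' => exact hm.negHow _ _ _ hχ hψ hψ')
    (fun n φ _ _ _ hφ hg => by
      obtain ⟨A, hA, hgA⟩ := hg.expand hφ.1.1 hφ.1.2.2.1
      obtain ⟨k, hk, rfl⟩ := List.mem_iff_getElem.1 hA
      refine ⟨k, hk, ?_⟩
      simpa only [label, List.getD_eq_getElem _ _ hk] using hgA)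
  exact (hn.2 n List.suffix_rfl).not_inconsistent hn'

theorem good_of_not_tableauClosed (h : ¬ TableauClosed ord φ₀) : Good {φ₀} := by
  simp only [TableauClosed, not_forall, not_exists, not_and] at h
  obtain ⟨S, hS, hc⟩ := h
  refine ⟨label φ₀ '' S, ?_, [], hS.root_mem, rfl⟩
  -- The required extension is the label of an "and" node reached by expansions alone. Each
  -- expansion enlarges the label within `φ₀.subPlus`; `m` bounds the room that is left.
  have key : ∀ m n, n ∈ S → ¬ Blocked φ₀ n → φ₀.subPlus.ncard - (label φ₀ n).ncard ≤ m →
      ∃ Δ, label φ₀ n ⊆ Δ ∧ Saturated Δ ∧ ¬ BlatantlyInconsistent Δ ∧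
        ModalClosed (label φ₀ '' S) Δ := by
    intro m
    induction m with
    | zero | succ m ih =>
      intro n hn hb hm
      have hnode := hS.isNode n hn
      by_cases ha : AllChecked ord φ₀ n
      · refine ⟨label φ₀ n, subset_rfl, saturated_of_allChecked hnode ha, hc n hn, ?_, ?_, ?_⟩
        · intro i ψ hψ
          -- A successor suppressed by the loop test has its label at an ancestor, and ancestors
          -- belong to `S`.
          by_cases hi : ∃ n', IsAgentAncestor i n' n ∧ label φ₀ n' = diamondLabel i ψ (label φ₀ n)
          · obtain ⟨n', ⟨p, rfl, -⟩, h'⟩ := hi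
            exact ⟨n', hS.mem_of_suffix hn (List.suffix_append p n'), h'⟩
          · exact ⟨.dia i ψ :: n, hS.and_node n hn ha ⟨.dia hnode hb (hc n hn) ha hψ hi, _, rfl⟩,
              rfl⟩
        · intro i ψ hψ hψ'
          exact ⟨.how i ψ :: n, hS.and_node n hn ha ⟨.how hnode hb (hc n hn) ha hψ hψ', _, rfl⟩,
            rfl⟩
        · intro i χ ψ hχ hψ hψ'
          exact ⟨.negHow i χ ψ :: n,
            hS.and_node n hn ha ⟨.negHow hnode hb (hc n hn) ha hχ hψ hψ', _, rfl⟩, rfl⟩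
      · obtain ⟨φ, hφ⟩ := exists_expands hnode ha
        have hlen : 0 < φ.expansions.length := List.length_pos_iff.2 hφ.1.2.2.1
        obtain ⟨_, ⟨hs, s, rfl⟩, hsS⟩ := hS.or_node n hn ha
          ⟨.expand φ 0 :: n, .expand hnode hb (hc n hn) hφ hlen, _, rfl⟩
        cases hs with
        | @expand _ χ k _ _ _ hχ hk =>
          have hlt : (label φ₀ n).ncard < (label φ₀ (.expand χ k :: n)).ncard := by
            refine Set.ncard_lt_ncard ⟨Set.subset_union_left, fun h => ?_⟩
              (finite_label (hS.isNode _ hsS))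
            exact hχ.1.2.2.2 _ (getD_expansions_mem hk) (Set.subset_union_right.trans h)
          have hle := Set.ncard_le_ncard (label_subset_subPlus (hS.isNode _ hsS))
            (finite_subPlus φ₀)
          -- For `m = 0` there is no room for the larger label; otherwise the induction hypothesis
          -- applies.
          first
          | exact absurd hm (by omega)
          | obtain ⟨Δ, h₁, h₂⟩ := ih _ hsS id (by omega)
            exact ⟨Δ, Set.subset_union_left.trans h₁, h₂⟩
        | _ => contradiction
  rintro _ ⟨n, hn, rfl⟩
  -- A blocked node is replaced by its proper ancestor with the same label, which has a descendant
  -- and so is not blocked itself.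
  by_cases hb : Blocked φ₀ n
  · rcases n with _ | ⟨_ | _ | _ | _, n⟩ <;> try exact hb.elim
    obtain ⟨n', h', hl⟩ := hb
    rw [← hl]
    exact key _ n' (hS.mem_of_suffix hn (h'.trans (List.suffix_cons _ _)))
      ((hS.isNode _ hn).not_blocked_of_suffix h') le_rfl
  · exact key _ n hn hb le_rfl

theorem tableauClosed_iff (ord : Node P I → LinearOrder (Form P I)) (φ₀ : Form P I) :
    TableauClosed ord φ₀ ↔ ¬ Good {φ₀} :=
  ⟨fun h hg => not_tableauClosed_of_good hg h, fun h => by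
    by_contra hc
    exact h (good_of_not_tableauClosed hc)⟩

end

end ELKh

namespace ELKh

open Form

section

variable {P : Type*} {I : Type*}

/-! ## The height of the tableau -/

/-- The nesting depth of the modal operators, where `K` counts `b` and `Kh` counts `1`. -/
def Form.depth (b : ℕ) : Form P I → ℕ
  | bot => 0
  | letter _ => 0
  | neg φ => φ.depth b
  | and φ ψ => max (φ.depth b) (ψ.depth b)
  | K _ φ => φ.depth b + b
  | Kh _ φ => φ.depth b + 1

/-- Each constructor raises the maximal depth of its arguments by at most 1, so no value is skipped.
The cases `b = 0` and `b = 1` give the `Kh`-depth and the modal depth. -/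
theorem exists_sub_depth_eq {b : ℕ} (hb : b ≤ 1) (φ : Form P I) {j : ℕ} (hj : j ≤ φ.depth b) :
    ∃ χ ∈ φ.sub, χ.depth b = j := by
  induction φ with
  | bot => exact ⟨bot, rfl, (Nat.le_zero.1 hj).symm⟩
  | letter p => exact ⟨letter p, rfl, (Nat.le_zero.1 hj).symm⟩
  | neg φ ih =>
    obtain ⟨χ, h, h'⟩ := ih hj
    exact ⟨χ, .inr h, h'⟩
  | and φ ψ ih₁ ih₂ =>
    rcases le_max_iff.1 hj with hj | hj
    · obtain ⟨χ, h, h'⟩ := ih₁ hj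
      exact ⟨χ, .inr (.inl h), h'⟩
    · obtain ⟨χ, h, h'⟩ := ih₂ hj
      exact ⟨χ, .inr (.inr h), h'⟩
  | K i φ ih | Kh i φ ih =>
    by_cases h : j ≤ φ.depth b
    · obtain ⟨χ, h, h'⟩ := ih h
      exact ⟨χ, .inr h, h'⟩
    · refine ⟨_, .inl rfl, ?_⟩
      simp only [depth] at hj ⊢
      omega

theorem depth_le_of_mem_sub {b : ℕ} {φ χ : Form P I} (h : χ ∈ φ.sub) :
    χ.depth b ≤ φ.depth b := by
  induction φ with
  | bot | letter p => obtain rfl := Set.mem_singleton_iff.1 h; rfl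
  | neg φ ih | K i φ ih | Kh i φ ih =>
    rcases h with rfl | h
    · rfl
    · have := ih h
      simp only [depth]
      omega
  | and φ ψ ih₁ ih₂ =>
    rcases h with rfl | h | h
    · rfl
    · exact (ih₁ h).trans (le_max_left _ _)
    · exact (ih₂ h).trans (le_max_right _ _)

theorem depth_le_of_mem_subPlus {b : ℕ} (hb : b ≤ 1) {φ χ : Form P I} (h : χ ∈ φ.subPlus) :
    χ.depth b ≤ φ.depth b := by
  rcases h with ⟨χ, h, rfl | rfl⟩ | ⟨i, χ, h, rfl | rfl⟩
  · exact depth_le_of_mem_sub h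
  · exact (show χ.depth b ≤ _ from depth_le_of_mem_sub h)
  all_goals
    have := depth_le_of_mem_sub (b := b) h
    simp only [depth] at this ⊢
    omega

/-- All values from 0 to the depth are attained in `subPlus`, which is one value more than the
depth. -/
theorem depth_lt_ncard {b : ℕ} (hb : b ≤ 1) (φ : Form P I) : φ.depth b < φ.subPlus.ncard := by
  have h₁ : Set.Iic (φ.depth b) ⊆ depth b '' φ.subPlus := fun j hj => by
    obtain ⟨χ, h, h'⟩ := exists_sub_depth_eq hb φ hj
    exact ⟨χ, sub_subset_subPlus φ h, h'⟩
  have h₂ := Set.ncard_le_ncard h₁ ((finite_subPlus φ).image _)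
  have h₃ := Set.ncard_image_le (f := depth b) (finite_subPlus φ)
  have h₄ : (Set.Iic (φ.depth b)).ncard = φ.depth b + 1 := by
    rw [Set.ncard_eq_toFinset_card']; simp
  omega

/-- `φ` is of one of the forms `K_i ψ`, `¬K_i ψ`, `Kh_i ψ`, `¬Kh_i ψ`. -/
def IsModal (i : I) (φ : Form P I) : Prop :=
  ∃ ψ, φ = K i ψ ∨ φ = neg (K i ψ) ∨ φ = Kh i ψ ∨ φ = neg (Kh i ψ)

theorem IsModal.depth_pos {i : I} {φ : Form P I} (h : IsModal i φ) : 1 ≤ φ.depth 1 := by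
  obtain ⟨ψ, rfl | rfl | rfl | rfl⟩ := h <;> simp [depth]

/-- The agent of the current run of agent and `ε` edges that contains an agent edge. -/
def runAgent : Node P I → Option I
  | [] => none
  | .expand _ _ :: n => runAgent n
  | .dia i _ :: _ => some i
  | .how _ _ :: _ => none
  | .negHow _ _ _ :: _ => none

/-- A bound on the nesting depth of `Kh` that decreases at each successor for `Kh_i ψ`, `¬K_i ψ`. -/
def howBound (φ₀ : Form P I) : Node P I → ℕ
  | [] => φ₀.depth 0
  | .how _ _ :: n => howBound φ₀ n - 1
  | .expand _ _ :: n => howBound φ₀ n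
  | .dia _ _ :: n => howBound φ₀ n
  | .negHow _ _ _ :: n => howBound φ₀ n

open Classical in
/-- A bound on the modal depth that decreases at each change of the agent between two action
edges. -/
noncomputable def modalBound (φ₀ : Form P I) : Node P I → ℕ
  | [] => φ₀.depth 1 + 1
  | .expand _ _ :: n => modalBound φ₀ n
  | .dia i _ :: n => if runAgent n = some i then modalBound φ₀ n else modalBound φ₀ n - 1
  | .how _ _ :: _ => φ₀.depth 1 + 1
  | .negHow _ _ _ :: _ => φ₀.depth 1 + 1

/-- The labels of the ancestors of a node (itself included) that were created for triples
`¬Kh_i χ`, `Kh_i ψ`, `¬K_i ψ`. -/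
def negHowLabels (φ₀ : Form P I) (n : Node P I) : Set (Set (Form P I)) :=
  {Γ | ∃ i χ ψ n', (.negHow i χ ψ :: n') <:+ n ∧ Γ = label φ₀ (.negHow i χ ψ :: n')}

/-- The formulas `ψ` for which the successor for `¬K_i ψ` is found among the `i`-ancestors. -/
def visited (φ₀ : Form P I) (i : I) (n : Node P I) : Set (Form P I) :=
  {ψ | neg (K i ψ) ∈ modalPart i (label φ₀ n) ∧
    ∃ n', IsAgentAncestor i n' n ∧ label φ₀ n' = diamondLabel i ψ (label φ₀ n)}

/-- The rank of a node within the current run. -/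
noncomputable def runRank (φ₀ : Form P I) (n : Node P I) : ℕ :=
  (runAgent n).elim 0 fun i =>
    (modalPart i (label φ₀ n)).ncard * φ₀.subPlus.ncard + (visited φ₀ i n).ncard

/-- A number that increases along each path of the tableau. -/
noncomputable def rank (φ₀ : Form P I) (n : Node P I) : ℕ :=
  (((φ₀.depth 0 - howBound φ₀ n + (negHowLabels φ₀ n).ncard) * φ₀.subPlus.ncard +
    (φ₀.depth 1 + 1 - modalBound φ₀ n)) * (φ₀.subPlus.ncard * φ₀.subPlus.ncard) +
      runRank φ₀ n) * φ₀.subPlus.ncard + ((label φ₀ n).ncard - 1)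

variable {ord : Node P I → LinearOrder (Form P I)} {φ₀ : Form P I} {n : Node P I}

theorem expansions_depth_le {b : ℕ} (hb : b ≤ 1) {φ χ : Form P I} {A : Set (Form P I)}
    (hA : A ∈ φ.expansions) (hχ : χ ∈ A) : χ.depth b ≤ φ.depth b := by
  unfold Form.expansions at hA
  split at hA <;> simp only [List.mem_cons, List.not_mem_nil, or_false] at hA
  all_goals
    rcases hA with rfl | rfl | rfl <;>
      simp only [Set.mem_insert_iff, Set.mem_singleton_iff] at hχ <;>
      rcases hχ with rfl | rfl <;> simp only [depth] <;> omega

/-- Among modal formulas only `Kh` formulas and their negations have expansions of the same depth,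
and these are again modal for the same agent. -/
theorem expansions_modal {φ χ : Form P I} {A : Set (Form P I)} {i : I} (hφ : IsModal i φ)
    (hA : A ∈ φ.expansions) (hχ : χ ∈ A) : χ.depth 1 < φ.depth 1 ∨ IsModal i χ := by
  obtain ⟨ψ, rfl | rfl | rfl | rfl⟩ := hφ <;>
    simp only [expansions, List.mem_cons, List.not_mem_nil, or_false] at hA
  · subst hA; obtain rfl := hχ; left; simp [depth]
  · rcases hA with rfl | rfl <;> obtain rfl := hχ <;> left <;> simp [depth]
  · rcases hA with rfl | rfl <;> obtain rfl := hχ <;> right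
    exacts [⟨ψ, .inr (.inl rfl)⟩, ⟨ψ, .inl rfl⟩]
  · subst hA; obtain rfl := hχ; right; exact ⟨ψ, .inr (.inl rfl)⟩

theorem howBound_le (φ₀ : Form P I) (n : Node P I) : howBound φ₀ n ≤ φ₀.depth 0 := by
  induction n with
  | nil => exact le_rfl
  | cons s n ih => cases s <;> simp only [howBound] <;> omega

/-- At the successor for `Kh i ψ` only `K i ψ` remains, which has one `Kh` less; `K` does not count
here. The other rules do not raise the `Kh`-depth. -/
theorem depth_le_howBound (h : IsNode ord φ₀ n) {φ : Form P I} (hφ : φ ∈ label φ₀ n) :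
    φ.depth 0 ≤ howBound φ₀ n := by
  induction h generalizing φ with
  | root => obtain rfl := hφ; exact le_rfl
  | @expand n χ k hn hb hc hχ hk ih =>
    rcases hφ with hφ | hφ
    exacts [ih hφ, (expansions_depth_le (by omega) (getD_expansions_mem hk) hφ).trans (ih hχ.1.1)]
  | @dia n i ψ hn hb hc ha hψ hi ih =>
    rcases hφ with rfl | hφ
    exacts [(show _ ≤ (neg (K i ψ)).depth 0 by simp [depth]).trans (ih hψ), ih hφ.1]
  | @how n i ψ hn hb hc ha hψ hψ' ih =>
    obtain rfl := hφ
    have := ih hψ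
    simp only [depth, howBound] at this ⊢
    omega
  | @negHow n i χ ψ hn hb hc ha hχ hψ hψ' ih =>
    rcases hφ with rfl | rfl
    · exact (show (neg (K i ψ)).depth 0 ≤ _ from ih hψ')
    · exact ih hχ

theorem depth_lt_of_label (h : IsNode ord φ₀ n) {φ : Form P I} (hφ : φ ∈ label φ₀ n) :
    φ.depth 1 < φ₀.depth 1 + 1 :=
  Nat.lt_succ_of_le (depth_le_of_mem_subPlus le_rfl (label_subset_subPlus h hφ))

/-- In a run of agent `i` only modal formulas of `i` can attain the bound. When the agent changes,
none of these is kept, so the kept formulas lie strictly below the bound, which can be lowered by 1.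
An action edge resets it to one more than the depth of `φ₀`, which nothing attains. -/
theorem modalBound_spec (h : IsNode ord φ₀ n) :
    (1 ≤ modalBound φ₀ n ∧ modalBound φ₀ n ≤ φ₀.depth 1 + 1) ∧
      ∀ φ ∈ label φ₀ n, φ.depth 1 < modalBound φ₀ n ∨
        φ.depth 1 = modalBound φ₀ n ∧ ∃ i, runAgent n = some i ∧ IsModal i φ := by
  induction h with
  | root =>
    exact ⟨⟨by simp [modalBound], le_rfl⟩, fun φ hφ => .inl (depth_lt_of_label (ord := ord) .root hφ)⟩
  | @expand n χ k hn hb hc hχ hk ih =>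
    refine ⟨ih.1, ?_⟩
    rintro φ (hφ | hφ)
    · exact ih.2 φ hφ
    have h₁ := getD_expansions_mem hk
    have h₂ := expansions_depth_le le_rfl h₁ hφ
    simp only [modalBound, runAgent]
    rcases ih.2 χ hχ.1.1 with h | ⟨h, i, hi, hm⟩
    · left; omega
    · rcases expansions_modal hm h₁ hφ with h₃ | h₃
      · left; omega
      · rcases h₂.lt_or_eq with h₂ | h₂
        · left; omega
        · exact .inr ⟨by omega, i, hi, h₃⟩
  | @dia n i ψ hn hb hc ha hψ hi ih =>
    have hψm : IsModal i (neg (K i ψ)) := ⟨ψ, .inr (.inl rfl)⟩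
    have hlt : (neg ψ).depth 1 < (neg (K i ψ)).depth 1 := by simp [depth]
    have hψd := hψm.depth_pos
    by_cases hr : runAgent n = some i
    · simp only [modalBound, if_pos hr]
      refine ⟨ih.1, ?_⟩
      rintro φ (rfl | ⟨hφ, hm⟩)
      · rcases ih.2 _ hψ with h | ⟨h, -⟩ <;> left <;> omega
      · rcases ih.2 _ hφ with h | ⟨h, -⟩
        exacts [.inl h, .inr ⟨h, i, rfl, hm⟩]
    · simp only [modalBound, if_neg hr]
      have key : ∀ φ ∈ label φ₀ n, IsModal i φ → φ.depth 1 < modalBound φ₀ n := by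
        intro φ hφ hm
        rcases ih.2 φ hφ with h | ⟨-, j, hj, hm'⟩
        · exact h
        · refine absurd (hj.trans ?_) hr
          obtain ⟨χ, rfl | rfl | rfl | rfl⟩ := hm <;> obtain ⟨χ', h | h | h | h⟩ := hm' <;>
            cases h <;> rfl
      have h₁ := key _ hψ hψm
      refine ⟨⟨by omega, by omega⟩, ?_⟩
      rintro φ (rfl | ⟨hφ, hm⟩)
      · left; omega
      · have := key φ hφ hm
        rcases (show φ.depth 1 ≤ modalBound φ₀ n - 1 by omega).lt_or_eq with h | h
        exacts [.inl h, .inr ⟨h, i, rfl, hm⟩]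
  | @how n i ψ hn hb hc ha hψ hψ' ih =>
    exact ⟨⟨by simp [modalBound], le_rfl⟩,
      fun φ hφ => .inl (depth_lt_of_label (.how hn hb hc ha hψ hψ') hφ)⟩
  | @negHow n i χ ψ hn hb hc ha hχ hψ hψ' ih =>
    exact ⟨⟨by simp [modalBound], le_rfl⟩,
      fun φ hφ => .inl (depth_lt_of_label (.negHow hn hb hc ha hχ hψ hψ') hφ)⟩

theorem ncard_lt_of_ne {S T : Set (Form P I)} (h : S ⊆ φ₀.subPlus) (hT : T ⊆ S) {χ : Form P I}
    (hχ : χ ∈ φ₀.subPlus) (hχT : χ ∉ T) : T.ncard < φ₀.subPlus.ncard :=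
  Set.ncard_lt_ncard ⟨hT.trans h, fun h' => hχT (h' hχ)⟩ (finite_subPlus φ₀)

theorem ncard_modalPart_lt (i : I) {Γ : Set (Form P I)} (h : Γ ⊆ φ₀.subPlus) :
    (modalPart i Γ).ncard < φ₀.subPlus.ncard := by
  obtain ⟨χ, hχ, hχ'⟩ := exists_sub_depth_eq (b := 1) le_rfl φ₀ (Nat.zero_le _)
  refine ncard_lt_of_ne h (fun _ hφ => hφ.1) (sub_subset_subPlus φ₀ hχ) fun hm => ?_
  have := IsModal.depth_pos hm.2
  omega

theorem finite_modalPart (i : I) {Γ : Set (Form P I)} (h : Γ ⊆ φ₀.subPlus) :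
    (modalPart i Γ).Finite := (finite_subPlus φ₀).subset fun _ hφ => h hφ.1

theorem finite_visited (i : I) (h : label φ₀ n ⊆ φ₀.subPlus) : (visited φ₀ i n).Finite :=
  Set.Finite.of_finite_image (f := fun ψ => neg (K i ψ))
    ((finite_modalPart i h).subset (by rintro _ ⟨ψ, hψ, rfl⟩; exact hψ.1))
    (fun ψ _ χ _ h => by simpa using h)

theorem ncard_visited_lt (i : I) (h : label φ₀ n ⊆ φ₀.subPlus) :
    (visited φ₀ i n).ncard < φ₀.subPlus.ncard := by
  refine lt_of_le_of_lt ?_ (ncard_modalPart_lt i h)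
  rw [← Set.ncard_image_of_injective (f := fun ψ => neg (K i ψ)) _ fun ψ χ h => by simpa using h]
  exact Set.ncard_le_ncard (by rintro _ ⟨ψ, hψ, rfl⟩; exact hψ.1) (finite_modalPart i h)

theorem mul_add_lt_mul {x y e m : ℕ} (h : x < y) (he : e < m) : x * m + e < y * m :=
  calc x * m + e < x * m + m := by omega
    _ = (x + 1) * m := by ring
    _ ≤ y * m := Nat.mul_le_mul_right m h

theorem mul_add_lt_mul_add {x y e f m : ℕ} (h : x < y) (he : e < m) : x * m + e < y * m + f :=
  (mul_add_lt_mul h he).trans_le (Nat.le_add_right _ _)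

theorem runRank_lt (h : label φ₀ n ⊆ φ₀.subPlus) :
    runRank φ₀ n < φ₀.subPlus.ncard * φ₀.subPlus.ncard := by
  have h₀ : 0 < φ₀.subPlus.ncard := (Nat.zero_le _).trans_lt (depth_lt_ncard le_rfl φ₀)
  rw [runRank]
  rcases runAgent n with _ | i
  · exact Nat.mul_pos h₀ h₀
  · exact mul_add_lt_mul (ncard_modalPart_lt i h) (ncard_visited_lt i h)

theorem negHowLabels_subset (h : IsNode ord φ₀ n) : negHowLabels φ₀ n ⊆
    (fun x : Form P I × Form P I => {x.1, x.2}) ''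
      ({φ ∈ φ₀.subPlus | ∃ i ψ, φ = K i ψ} ×ˢ {φ ∈ φ₀.subPlus | ∃ i ψ, φ = neg (Kh i ψ)}) := by
  rintro _ ⟨i, χ, ψ, n', hs, rfl⟩
  have h₁ := label_subset_subPlus (h.of_suffix hs)
  exact ⟨(K i ψ, neg (Kh i χ)), ⟨⟨h₁ (.inl rfl), i, ψ, rfl⟩, h₁ (.inr rfl), i, χ, rfl⟩, rfl⟩

theorem finite_negHowLabels (h : IsNode ord φ₀ n) : (negHowLabels φ₀ n).Finite :=
  ((((finite_subPlus φ₀).subset (Set.sep_subset _ _)).prod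
    ((finite_subPlus φ₀).subset (Set.sep_subset _ _))).image _).subset (negHowLabels_subset h)

/-- Such a label is a pair of a `K` formula and a negated `Kh` formula. The formula `neg φ₀` is not
of the first form, and `φ₀` or `neg φ₀` is not of the second, so each factor is at most m - 1. This
leaves room for the `Kh`-depth below m^2 in `rank_lt`. -/
theorem ncard_negHowLabels_le (h : IsNode ord φ₀ n) :
    (negHowLabels φ₀ n).ncard ≤ (φ₀.subPlus.ncard - 1) * (φ₀.subPlus.ncard - 1) := by
  have hX : ({φ ∈ φ₀.subPlus | ∃ i ψ, φ = K i ψ} : Set (Form P I)).ncard < φ₀.subPlus.ncard :=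
    ncard_lt_of_ne subset_rfl (Set.sep_subset _ _) (neg_mem_subPlus_of_sub (self_mem_sub φ₀))
      (by simp)
  have hY : ({φ ∈ φ₀.subPlus | ∃ i ψ, φ = neg (Kh i ψ)} : Set (Form P I)).ncard <
      φ₀.subPlus.ncard := by
    by_cases hφ : ∃ i ψ, φ₀ = neg (Kh i ψ)
    · refine ncard_lt_of_ne subset_rfl (Set.sep_subset _ _)
        (neg_mem_subPlus_of_sub (self_mem_sub φ₀)) ?_
      obtain ⟨i, ψ, rfl⟩ := hφ
      simp
    · exact ncard_lt_of_ne subset_rfl (Set.sep_subset _ _)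
        (mem_subPlus_of_sub (self_mem_sub φ₀)) fun h => hφ h.2
  have hfin := ((finite_subPlus φ₀).subset
    (Set.sep_subset φ₀.subPlus fun φ => ∃ i ψ, φ = K i ψ)).prod
    ((finite_subPlus φ₀).subset (Set.sep_subset φ₀.subPlus fun φ => ∃ i ψ, φ = neg (Kh i ψ)))
  refine (Set.ncard_le_ncard (negHowLabels_subset h) (hfin.image _)).trans
    ((Set.ncard_image_le hfin).trans ?_)
  rw [Set.ncard_prod]
  exact Nat.mul_le_mul (by omega) (by omega)

theorem label_nonempty (φ₀ : Form P I) (n : Node P I) : (label φ₀ n).Nonempty := by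
  induction n with
  | nil => exact ⟨_, rfl⟩
  | cons s n ih =>
    cases s with
    | expand φ k => exact ih.mono Set.subset_union_left
    | dia i ψ => exact ⟨_, .inl rfl⟩
    | how i ψ => exact ⟨_, rfl⟩
    | negHow i χ ψ => exact ⟨_, .inl rfl⟩

theorem ncard_label_le (h : IsNode ord φ₀ n) : (label φ₀ n).ncard - 1 < φ₀.subPlus.ncard := by
  have h₁ := Set.ncard_le_ncard (label_subset_subPlus h) (finite_subPlus φ₀)
  have h₂ := (Set.ncard_pos (finite_label h)).2 (label_nonempty φ₀ n)
  omega

/-- The digits of the rank have m^2, m, m^2 and m possible values, whence the exponent 6. -/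
theorem rank_lt (h : IsNode ord φ₀ n) : rank φ₀ n < φ₀.subPlus.ncard ^ 6 := by
  have h₁ := depth_lt_ncard (b := 0) (by omega) φ₀
  have h₂ := depth_lt_ncard (b := 1) (by omega) φ₀
  have h₃ := ncard_negHowLabels_le h
  have h₄ := (modalBound_spec h).1
  have h₅ := runRank_lt (label_subset_subPlus h)
  have h₆ := ncard_label_le h
  have hA : φ₀.depth 0 - howBound φ₀ n + (negHowLabels φ₀ n).ncard <
      φ₀.subPlus.ncard * φ₀.subPlus.ncard := by
    generalize φ₀.subPlus.ncard = m at *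
    obtain ⟨m, rfl⟩ : ∃ m', m = m' + 1 := ⟨m - 1, by omega⟩
    simp only [Nat.add_sub_cancel] at h₃
    have : (m + 1) * (m + 1) = m * m + 2 * m + 1 := by ring
    omega
  refine (mul_add_lt_mul (mul_add_lt_mul (mul_add_lt_mul hA ?_) h₅) h₆).trans_eq (by ring)
  omega

theorem modalPart_mono {Γ Δ : Set (Form P I)} (h : Γ ⊆ Δ) (i : I) :
    modalPart i Γ ⊆ modalPart i Δ := fun _ hφ => ⟨h hφ.1, hφ.2⟩

theorem diamondLabel_eq {Γ Δ : Set (Form P I)} {i : I} (h : modalPart i Γ = modalPart i Δ)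
    (ψ : Form P I) : diamondLabel i ψ Γ = diamondLabel i ψ Δ := by
  rw [diamondLabel, diamondLabel, h]

theorem IsAgentAncestor.cons {i : I} {n' : Node P I} {s : Succ P I} (h : IsAgentAncestor i n' n)
    (hs : s.edge = .agent i ∨ s.edge = .eps) : IsAgentAncestor i n' (s :: n) := by
  obtain ⟨p, rfl, hp⟩ := h
  exact ⟨s :: p, rfl, by simpa using ⟨hs, hp⟩⟩

theorem visited_subset {i : I} {s : Succ P I} (hs : s.edge = .agent i ∨ s.edge = .eps)
    (h : modalPart i (label φ₀ n) = modalPart i (label φ₀ (s :: n))) :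
    visited φ₀ i n ⊆ visited φ₀ i (s :: n) := by
  rintro ψ ⟨h₁, n', h₂, h₃⟩
  exact ⟨h ▸ h₁, n', h₂.cons hs, h₃.trans (diamondLabel_eq h ψ)⟩

/-- The modal part can only grow. If it does not, the labels of the `i`-successors are unchanged,
and those found among the `i`-ancestors are still found there. -/
theorem runRank_expand (h : IsNode ord φ₀ n) {φ : Form P I} {k : ℕ}
    (h' : IsNode ord φ₀ (.expand φ k :: n)) : runRank φ₀ n ≤ runRank φ₀ (.expand φ k :: n) := by
  simp only [runRank, runAgent]
  rcases runAgent n with _ | i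
  · exact le_rfl
  have hsub : modalPart i (label φ₀ n) ⊆ modalPart i (label φ₀ (.expand φ k :: n)) :=
    modalPart_mono Set.subset_union_left i
  have hs' := label_subset_subPlus h'
  rcases (Set.ncard_le_ncard hsub (finite_modalPart i hs')).lt_or_eq with hlt | heq
  · exact (mul_add_lt_mul_add hlt (ncard_visited_lt i (label_subset_subPlus h))).le
  · have := Set.eq_of_subset_of_ncard_le hsub heq.ge (finite_modalPart i hs')
    exact Nat.add_le_add (Nat.mul_le_mul_right _ heq.le)
      (Set.ncard_le_ncard (visited_subset (.inr rfl) this) (finite_visited i hs'))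

/-- If the modal part does not grow, `ψ` becomes visited, which by `hi` it was not before. -/
theorem runRank_dia (h : IsNode ord φ₀ n) {i : I} {ψ : Form P I} (hr : runAgent n = some i)
    (hψ : neg (K i ψ) ∈ label φ₀ n)
    (hi : ¬ ∃ n', IsAgentAncestor i n' n ∧ label φ₀ n' = diamondLabel i ψ (label φ₀ n))
    (h' : IsNode ord φ₀ (.dia i ψ :: n)) : runRank φ₀ n < runRank φ₀ (.dia i ψ :: n) := by
  simp only [runRank, runAgent, hr, Option.elim]
  have hsub : modalPart i (label φ₀ n) ⊆ modalPart i (label φ₀ (.dia i ψ :: n)) :=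
    fun χ hχ => ⟨.inr hχ, hχ.2⟩
  have hs' := label_subset_subPlus h'
  rcases (Set.ncard_le_ncard hsub (finite_modalPart i hs')).lt_or_eq with hlt | heq
  · exact mul_add_lt_mul_add hlt (ncard_visited_lt i (label_subset_subPlus h))
  · have heq' := Set.eq_of_subset_of_ncard_le hsub heq.ge (finite_modalPart i hs')
    refine Nat.add_lt_add_of_le_of_lt (Nat.mul_le_mul_right _ heq.le)
      (Set.ncard_lt_ncard ⟨visited_subset (.inl rfl) heq', fun hle => ?_⟩ (finite_visited i hs'))
    -- The new node is an `i`-ancestor of itself by the empty path and carries the label for `ψ`.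
    refine hi (hle ⟨hsub ⟨hψ, ψ, .inr (.inl rfl)⟩, .dia i ψ :: n, ⟨[], rfl, by simp⟩, ?_⟩).2
    exact diamondLabel_eq heq' ψ

theorem negHowLabels_cons_of_ne {s : Succ P I} (hs : ∀ i χ ψ, s ≠ .negHow i χ ψ) :
    negHowLabels φ₀ (s :: n) = negHowLabels φ₀ n := by
  ext Γ
  constructor
  · rintro ⟨i, χ, ψ, n', h, rfl⟩
    rcases List.suffix_cons_iff.1 h with h | h
    · cases h; exact absurd rfl (hs i χ ψ)
    · exact ⟨i, χ, ψ, n', h, rfl⟩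
  · rintro ⟨i, χ, ψ, n', h, rfl⟩
    exact ⟨i, χ, ψ, n', h.trans (List.suffix_cons _ _), rfl⟩

/-- Every edge raises one digit of the rank without lowering a higher one; lower digits may drop.
Blocking matters only for the successors for `¬Kh_i χ`: an unblocked one has a label that is new on
its path. -/
theorem rank_lt_rank_cons {s : Succ P I} (h' : IsNode ord φ₀ (s :: n))
    (hb' : ¬ Blocked φ₀ (s :: n)) : rank φ₀ n < rank φ₀ (s :: n) := by
  have h := h'.parent.1
  have hm := (modalBound_spec h).1
  have h₂ := depth_lt_ncard (b := 1) (by omega) φ₀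
  have h₅ := runRank_lt (label_subset_subPlus h)
  have h₆ := ncard_label_le h
  have hm' := (modalBound_spec h').1
  have hH := howBound_le φ₀ n
  rw [rank, rank]
  cases hs : h' with
  | @expand _ φ k hn hb hc hφ hk =>
    have hlt : (label φ₀ n).ncard < (label φ₀ (.expand φ k :: n)).ncard := by
      refine Set.ncard_lt_ncard ⟨Set.subset_union_left, fun h => ?_⟩ (finite_label h')
      exact hφ.1.2.2.2 _ (getD_expansions_mem hk) (Set.subset_union_right.trans h)
    have h₇ := (Set.ncard_pos (finite_label h)).2 (label_nonempty φ₀ n)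
    have h₈ := runRank_expand h h'
    rw [negHowLabels_cons_of_ne (by simp)]
    simp only [howBound, modalBound]
    exact Nat.add_lt_add_of_le_of_lt
      (Nat.mul_le_mul_right _ (Nat.add_le_add_left h₈ _)) (by omega)
  | @dia _ i ψ hn hb hc ha hψ hi =>
    rw [negHowLabels_cons_of_ne (by simp)]
    by_cases hr : runAgent n = some i
    · simp only [howBound, modalBound, if_pos hr]
      exact mul_add_lt_mul_add (Nat.add_lt_add_left (runRank_dia h hr hψ hi h') _) h₆
    · simp only [howBound, modalBound, if_neg hr] at hm' ⊢
      exact mul_add_lt_mul_add (mul_add_lt_mul_add (Nat.add_lt_add_left (by omega) _) h₅) h₆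
  | @how _ i ψ hn hb hc ha hψ hψ' =>
    rw [negHowLabels_cons_of_ne (by simp)]
    have := depth_le_howBound h hψ
    simp only [depth] at this
    exact mul_add_lt_mul_add (mul_add_lt_mul_add (mul_add_lt_mul_add
      (by simp only [howBound]; omega) (by omega)) h₅) h₆
  | @negHow _ i χ ψ hn hb hc ha hχ hψ hψ' =>
    have hlt : (negHowLabels φ₀ n).ncard < (negHowLabels φ₀ (.negHow i χ ψ :: n)).ncard := by
      refine Set.ncard_lt_ncard ⟨?_, fun hle => ?_⟩ (finite_negHowLabels h')
      · rintro Γ ⟨j, χ', ψ', n', hs, rfl⟩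
        exact ⟨j, χ', ψ', n', hs.trans (List.suffix_cons _ _), rfl⟩
      · obtain ⟨j, χ', ψ', n', hs, he⟩ := hle ⟨i, χ, ψ, n, List.suffix_rfl, rfl⟩
        exact hb' ⟨_, hs, he.symm⟩
    exact mul_add_lt_mul_add (mul_add_lt_mul_add (mul_add_lt_mul_add
      (by simp only [howBound]; omega) (by omega)) h₅) h₆

theorem length_le_rank (h : IsNode ord φ₀ n) (hb : ¬ Blocked φ₀ n) : n.length ≤ rank φ₀ n := by
  induction n with
  | nil => simp
  | cons s n ih =>
    have h₁ := ih h.parent.1 h.parent.2.1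
    have h₂ := rank_lt_rank_cons h hb
    simp only [List.length_cons]
    omega

/-- The rank need not grow at a blocked node. It is therefore taken at the parent, which is
unblocked; the strict bound on the rank pays for the last edge. -/
theorem length_le (h : IsNode ord φ₀ n) : n.length ≤ φ₀.subPlus.ncard ^ 6 := by
  rcases n with _ | ⟨s, n⟩
  · simp
  · have h₁ := length_le_rank h.parent.1 h.parent.2.1
    have h₂ := rank_lt h.parent.1
    simp only [List.length_cons]
    omega

/-! ## The number of children -/

theorem encard_children_le (h : IsNode ord φ₀ n) : (children ord φ₀ n).encard ≤
    ((φ₀.subPlus.ncard + φ₀.subPlus.ncard ^ 2 + φ₀.subPlus.ncard ^ 3 : ℕ) : ℕ∞) := by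
  have hm : 0 < φ₀.subPlus.ncard := (Nat.zero_le _).trans_lt (depth_lt_ncard le_rfl φ₀)
  have hcl : φ₀.subPlus.encard = φ₀.subPlus.ncard := ((finite_subPlus φ₀).cast_ncard_eq).symm
  have hL : (label φ₀ n).encard ≤ φ₀.subPlus.ncard :=
    (Set.encard_le_encard (label_subset_subPlus h)).trans_eq hcl
  by_cases ha : AllChecked ord φ₀ n
  -- The first two kinds of successors are determined by one formula of the label, those for triples
  -- by two, since the agent is shared. This makes at most 2m + m^2.
  · let f₁ : Form P I → Node P I := fun φ => match φ with
      | neg (K i ψ) => .dia i ψ :: n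
      | _ => []
    let f₂ : Form P I → Node P I := fun φ => match φ with
      | Kh i ψ => .how i ψ :: n
      | _ => []
    let f₃ : Form P I × Form P I → Node P I := fun x => match x with
      | (neg (Kh i χ), Kh _ ψ) => .negHow i χ ψ :: n
      | _ => []
    have hsub : children ord φ₀ n ⊆ (f₁ '' label φ₀ n ∪ f₂ '' label φ₀ n) ∪
        f₃ '' (label φ₀ n ×ˢ label φ₀ n) := by
      rintro _ ⟨hs, s, rfl⟩
      cases hs with
      | expand hn hb hc hφ hk => exact absurd ha hφ.not_allChecked
      | dia hn hb hc ha hψ hi => exact .inl (.inl ⟨_, hψ, rfl⟩)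
      | how hn hb hc ha hψ hψ' => exact .inl (.inr ⟨_, hψ, rfl⟩)
      | negHow hn hb hc ha hχ hψ hψ' => exact .inr ⟨(_, _), ⟨hχ, hψ⟩, rfl⟩
    refine (Set.encard_le_encard hsub).trans ?_
    refine (Set.encard_union_le _ _).trans ?_
    have h₁ : (f₁ '' label φ₀ n ∪ f₂ '' label φ₀ n).encard ≤
        (φ₀.subPlus.ncard : ℕ∞) + φ₀.subPlus.ncard :=
      (Set.encard_union_le _ _).trans
        (add_le_add ((Set.encard_image_le _ _).trans hL) ((Set.encard_image_le _ _).trans hL))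
    have h₂ : (f₃ '' (label φ₀ n ×ˢ label φ₀ n)).encard ≤
        (φ₀.subPlus.ncard : ℕ∞) * φ₀.subPlus.ncard :=
      (Set.encard_image_le _ _).trans (Set.encard_prod.trans_le (mul_le_mul' hL hL))
    refine (add_le_add h₁ h₂).trans ?_
    norm_cast
    generalize φ₀.subPlus.ncard = m at *
    nlinarith [Nat.pow_le_pow_right hm (show 1 ≤ 2 by norm_num),
      Nat.pow_le_pow_right hm (show 2 ≤ 3 by norm_num), Nat.pow_le_pow_right hm (show 1 ≤ 3 by norm_num)]
  · obtain ⟨φ, hφ⟩ := exists_expands h ha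
    have hlen : φ.expansions.length ≤ 3 := by
      unfold Form.expansions
      split <;> simp
    have hsub : children ord φ₀ n ⊆ (fun k => .expand φ k :: n) '' ((Finset.range 3 : Finset ℕ) : Set ℕ) := by
      rintro _ ⟨hs, s, rfl⟩
      cases hs with
      | @expand _ χ k hn hb hc hχ hk =>
        let := ord n
        -- The order is linear, so the formula to be expanded is unique and its at most three
        -- alternatives give all the children.
        obtain rfl : χ = φ := by
          rcases lt_trichotomy χ φ with hlt | heq | hlt
          · exact absurd hχ.1.2.2 (hφ.2 χ hχ.1.1 hχ.1.2.1 hlt)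
          · exact heq
          · exact absurd hφ.1.2.2 (hχ.2 φ hφ.1.1 hφ.1.2.1 hlt)
        exact ⟨k, by simp; omega, rfl⟩
      | _ => contradiction
    refine (Set.encard_le_encard hsub).trans ((Set.encard_image_le _ _).trans ?_)
    rw [Set.encard_coe_eq_coe_finsetCard]
    norm_cast
    have h₁ := Nat.pow_pos (n := 2) hm
    have h₂ := Nat.pow_pos (n := 3) hm
    simp only [Finset.card_range]
    omega

end

end ELKh

namespace ELKh

open Function

/-! ## Equality of codes -/

section

variable {α β γ : Type*} [Enc α] [Enc β] [Enc γ]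

/-- Iterating `f` leads from `s` to `s'`; before `s'` the test `t` is satisfied, and all sizes are
at most `M`. -/
inductive Iter (f : β → β) (t : β → Bool) (M : ℕ) : β → β → Prop
  | refl {s} (h : esz s ≤ M) : Iter f t M s s
  | head {s s'} (h : esz s ≤ M) (ht : t s = true) (hs : Iter f t M (f s) s') : Iter f t M s s'

theorem Iter.trans {f : β → β} {t : β → Bool} {M : ℕ} {s s' s'' : β} (h : Iter f t M s s')
    (h' : Iter f t M s' s'') : Iter f t M s s'' := by
  induction h with
  | refl _ => exact h'
  | head h ht _ ih => exact .head h ht (ih h')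

theorem Iter.exists_iterate {f : β → β} {t : β → Bool} {M : ℕ} {s s' : β}
    (h : Iter f t M s s') : ∃ n, (∀ j < n, t (f^[j] s) = true) ∧ f^[n] s = s' ∧
      ∀ j ≤ n, esz (f^[j] s) ≤ M := by
  induction h with
  | refl h => exact ⟨0, by simp, rfl, fun j hj => by rw [Nat.le_zero.1 hj]; exact h⟩
  | head h ht _ ih =>
    obtain ⟨n, h₁, h₂, h₃⟩ := ih
    refine ⟨n + 1, fun j hj => ?_, h₂, fun j hj => ?_⟩
    · rcases j with _ | j
      exacts [ht, h₁ j (by omega)]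
    · rcases j with _ | j
      exacts [h, h₃ j (by omega)]

namespace PS

theorem iter {f : β → β} {t : β → Bool} {g r : α → β} {b : α → ℕ} (hf : PS f) (ht : PS t)
    (hg : PS g) (hb : PB b) (h : ∀ a, Iter f t (b a) (g a) (r a)) (hr : ∀ a, t (r a) = false) :
    PS r :=
  iterate hf ht hg hb fun a => by
    obtain ⟨n, h₁, h₂, h₃⟩ := (h a).exists_iterate
    exact ⟨n, h₁, h₂ ▸ hr a, h₂, h₃⟩

theorem isNil : PS Tree.isNil := by
  have h₁ : PS fun _ : Tree => true := const true
  have h₂ : PS fun _ : Tree × Tree => false := const false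
  exact branch (t := fun x => x) (b := id) PS.id h₁ h₂ (fun _ => rfl) (by rintro _ rfl; rfl)
    (fun a ha => ⟨(a, a), rfl, by cases a <;> [exact absurd rfl ha; rfl]⟩)

/-- One step of the comparison of trees: the first component is the list of the pairs that remain to
be compared. -/
def eqStep (x : List (Tree × Tree) × Bool) : List (Tree × Tree) × Bool :=
  match x.1 with
  | [] => x
  | y :: r =>
    if y.1.isNil then
      if y.2.isNil then (r, x.2) else ([], false)
    else
      if y.2.isNil then ([], false)
      else ((y.1.fst, y.2.fst) :: (y.1.snd, y.2.snd) :: r, x.2)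

theorem eqStep_ps : PS eqStep := by
  have hx : PS fun x : (List (Tree × Tree) × Bool) × (Tree × Tree) × List (Tree × Tree) => x.2.1.1 :=
    fst.comp (fst.comp snd)
  have hy : PS fun x : (List (Tree × Tree) × Bool) × (Tree × Tree) × List (Tree × Tree) => x.2.1.2 :=
    snd.comp (fst.comp snd)
  refine (listCases (l := Prod.fst) (f := id)
    (g := fun (x : List (Tree × Tree) × Bool) y r => if y.1.isNil then
      if y.2.isNil then (r, x.2) else ([], false)
    else if y.2.isNil then ([], false)
      else ((y.1.fst, y.2.fst) :: (y.1.snd, y.2.snd) :: r, x.2)) fst PS.id ?_).congr fun x => ?_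
  rotate_left
  · rcases x with ⟨_ | _, _⟩ <;> rfl
  exact (isNil.comp hx).cond
    ((isNil.comp hy).cond ((snd.comp snd).pair (snd.comp fst)) (nil.pair (const false)))
    ((isNil.comp hy).cond (nil.pair (const false))
      ((((tree_fst.comp hx).pair (tree_fst.comp hy)).cons
        (((tree_snd.comp hx).pair (tree_snd.comp hy)).cons (snd.comp snd))).pair (snd.comp fst)))

/-- Splitting a pair of `cons` trees into two pairs leaves the size of the list unchanged. The
summand 4 allows for the Boolean and the pairing. -/
theorem eqStep_iter (x y : Tree) (r : List (Tree × Tree)) (b : Bool) {M : ℕ}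
    (hM : esz ((x, y) :: r) + 4 ≤ M) :
    Iter eqStep (fun s => !s.1.isEmpty) M ((x, y) :: r, b)
      (if x = y then (r, b) else ([], false)) := by
  have hb := esz_bool_le b
  have hfail : Iter eqStep (fun s => !s.1.isEmpty) M (([], false) : List (Tree × Tree) × Bool)
      ([], false) := by
    refine .refl ?_
    simp only [esz_cons, esz_pair] at hM
    rw [esz_pair, esz_nil]
    have := esz_bool_le false
    omega
  induction x generalizing y r with
  | nil =>
    refine .head (by rw [esz_pair]; omega) rfl ?_
    cases y with
    | nil =>
      change Iter _ _ M (r, b) _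
      rw [if_pos rfl]
      refine .refl ?_
      rw [esz_cons] at hM
      rw [esz_pair]
      omega
    | cons y y' => exact hfail
  | cons x x' ih ih' =>
    refine .head (by rw [esz_pair]; omega) rfl ?_
    cases y with
    | nil => exact hfail
    | cons y y' =>
      have hsz : esz ((x, y) :: (x', y') :: r) + 4 ≤ M := by
        simp only [esz_cons, esz_pair, esz_tree, Tree.sz] at hM ⊢
        omega
      change Iter _ _ M ((x, y) :: (x', y') :: r, b) _
      have h₁ := ih y ((x', y') :: r) hsz
      by_cases h : x = y
      · have h₂ := ih' y' r (by rw [esz_cons] at hsz; omega)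
        rw [if_pos h] at h₁
        simpa [h] using h₁.trans h₂
      · rw [if_neg h] at h₁
        simpa [h] using h₁

theorem tree_eq : PS fun x : Tree × Tree =>
    (([] : List (Tree × Tree)), decide (x.1 = x.2)) := by
  refine iter (b := fun x => esz x + 6) eqStep_ps fst.isEmpty.not
    ((PS.id.cons nil).pair (const true)) (PB.esz.add (.const 6)) (fun x => ?_) fun x => rfl
  have := eqStep_iter x.1 x.2 [] true (M := esz x + 6) (by simp [esz_cons, esz_nil])
  rwa [show (if x.1 = x.2 then (([] : List (Tree × Tree)), true) else ([], false)) =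
    ([], decide (x.1 = x.2)) by by_cases h : x.1 = x.2 <;> simp only [h, if_true, if_false,
      decide_true, decide_false]] at this

theorem eq [DecidableEq β] {f g : α → β} (hf : PS f) (hg : PS g) :
    PS fun a => decide (f a = g a) :=
  (snd.comp (tree_eq.comp ((tree.comp hf).pair (tree.comp hg)))).congr fun a => by
    by_cases h : f a = g a
    · simp [h]
    · simp [h, Enc.inj.ne h]

/-! ## Arithmetic in unary -/

theorem pred : PS Nat.pred :=
  (tree_snd.comp tree).of_enc fun n => by cases n <;> rfl

theorem enc_replicate (n : ℕ) : enc (List.replicate n ()) = enc n := by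
  induction n with
  | zero => rfl
  | succ n ih => rw [List.replicate_succ, enc_cons, ih]; rfl

/-- A unary number has the code of a list of units, on which multiplication by a length is a
`flatMap`. -/
theorem length_pow {l : α → List β} (hl : PS l) (k : ℕ) : PS fun a => (l a).length ^ k := by
  suffices h : PS fun a => List.replicate ((l a).length ^ k) () from
    h.of_enc fun a => (enc_replicate _).symm
  induction k with
  | zero => exact (const [()]).congr fun a => by simp
  | succ k ih =>
    refine (hl.flatMap (g := fun a _ => List.replicate ((l a).length ^ k) ()) (ih.comp fst)).congr
      fun a => ?_
    symm
    rw [List.eq_replicate_iff]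
    simp [List.length_flatMap, pow_succ, mul_comm]

end PS

end

/-! ## Formulas as data -/

open Form

section

variable {P I : Type*} [Enc P] [Enc I]

/-- The code of a formula. -/
def encForm : Form P I → Tree
  | bot => .cons (enc 0) .nil
  | neg φ => .cons (enc 1) (encForm φ)
  | K i φ => .cons (enc 2) (.cons (enc i) (encForm φ))
  | letter p => .cons (enc 3) (enc p)
  | Form.and φ ψ => .cons (enc 4) (.cons (encForm φ) (encForm ψ))
  | Kh i φ => .cons (enc 5) (.cons (enc i) (encForm φ))

instance : Enc (Form P I) :=
  ⟨encForm, fun φ ψ h => by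
    induction φ generalizing ψ with
    | bot => cases ψ <;> simp [encForm, enc, encNat] at h ⊢
    | letter p =>
      cases ψ <;> simp only [encForm, enc, encNat, Tree.cons.injEq, reduceCtorEq,
        true_and, and_false, false_and] at h ⊢
      rw [Enc.inj h]
    | neg φ ih =>
      cases ψ <;> simp only [encForm, enc, encNat, Tree.cons.injEq, reduceCtorEq,
        true_and, and_false, false_and] at h ⊢
      rw [ih _ h]
    | and φ φ' ih ih' =>
      cases ψ <;> simp only [encForm, enc, encNat, Tree.cons.injEq, reduceCtorEq,
        true_and, and_false, false_and] at h ⊢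
      rw [ih _ h.1, ih' _ h.2]
    | K i φ ih | Kh i φ ih =>
      cases ψ <;> simp only [encForm, enc, encNat, Tree.cons.injEq, reduceCtorEq,
        true_and, and_false, false_and] at h ⊢
      rw [ih _ h.2, Enc.inj h.1]⟩

/-- The formula `ψ` if `φ` is `¬ψ`. -/
def unNeg : Form P I → List (Form P I)
  | neg φ => [φ]
  | _ => []

/-- The pair of the conjuncts if `φ` is a conjunction. -/
def unAnd : Form P I → List (Form P I × Form P I)
  | Form.and φ ψ => [(φ, ψ)]
  | _ => []

/-- The pair `(i, ψ)` if `φ` is `K_i ψ`. -/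
def unK : Form P I → List (I × Form P I)
  | K i φ => [(i, φ)]
  | _ => []

/-- The pair `(i, ψ)` if `φ` is `Kh_i ψ`. -/
def unKh : Form P I → List (I × Form P I)
  | Kh i φ => [(i, φ)]
  | _ => []

namespace PS

variable {α : Type*} [Enc α] {f g : α → Form P I} {a : α → I}

theorem neg (hf : PS f) : PS fun x => neg (f x) :=
  ((const 1).pair hf).of_enc fun _ => rfl

theorem K (ha : PS a) (hf : PS f) : PS fun x => K (a x) (f x) :=
  ((const 2).pair (ha.pair hf)).of_enc fun _ => rfl

theorem Kh (ha : PS a) (hf : PS f) : PS fun x => Kh (a x) (f x) :=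
  ((const 5).pair (ha.pair hf)).of_enc fun _ => rfl

theorem of_tag {β : Type*} [Enc β] {d : Form P I → List β} (t : ℕ)
    (h : ∀ φ, enc (d φ) = if (enc φ).fst = enc t then .cons (enc φ).snd .nil else .nil) : PS d :=
  (ite (c := fun φ : Form P I => (enc φ).fst = enc t) (eq (tree_fst.comp tree) (const (enc t)))
    (f := fun φ => [(enc φ).snd]) ((tree_snd.comp tree).cons nil) nil).of_enc fun φ => by
      rw [h]; split <;> rfl

theorem unNeg : PS (unNeg : Form P I → _) :=
  of_tag 1 fun φ => by
    cases φ <;> simp [ELKh.unNeg, enc, encForm, encNat, Tree.fst, Tree.snd, encList]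

theorem unK : PS (unK : Form P I → _) :=
  of_tag 2 fun φ => by
    cases φ <;> simp [ELKh.unK, enc, encForm, encNat, Tree.fst, Tree.snd, encList]

theorem unAnd : PS (unAnd : Form P I → _) :=
  of_tag 4 fun φ => by
    cases φ <;> simp [ELKh.unAnd, enc, encForm, encNat, Tree.fst, Tree.snd, encList]

theorem unKh : PS (unKh : Form P I → _) :=
  of_tag 5 fun φ => by
    cases φ <;> simp [ELKh.unKh, enc, encForm, encNat, Tree.fst, Tree.snd, encList]

end PS

/-! ## The tableau rules on lists -/

open Classical in
/-- Membership in a list. -/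
noncomputable def memb (φ : Form P I) (Γ : List (Form P I)) : Bool := Γ.any fun ψ => ψ = φ

open Classical in
/-- Blatant inconsistency of a list. -/
noncomputable def inconsistent (Γ : List (Form P I)) : Bool :=
  Γ.any fun φ => decide (φ = bot) || memb (neg φ) Γ

/-- The alternatives of the propositional part, as lists. -/
def exps (φ : Form P I) : List (List (Form P I)) :=
  ((unNeg φ).flatMap fun ψ => (unNeg ψ).map fun χ => [χ]) ++
  ((unAnd φ).map fun x => [x.1, x.2]) ++
  ((unNeg φ).flatMap fun ψ => (unAnd ψ).flatMap fun x =>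
    [[neg x.1, neg x.2], [neg x.1, x.2], [x.1, neg x.2]]) ++
  ((unK φ).map fun x => [x.2]) ++
  ((unNeg φ).flatMap fun ψ => (unK ψ).flatMap fun x => [[neg x.2], [x.2]]) ++
  ((unKh φ).flatMap fun x => [[neg (K x.1 x.2)], [K x.1 x.2]]) ++
  ((unNeg φ).flatMap fun ψ => (unKh ψ).map fun x => [neg (K x.1 x.2)])

/-- Whether `φ` can be expanded in `Γ`. -/
noncomputable def active (Γ : List (Form P I)) (φ : Form P I) : Bool :=
  !(exps φ).isEmpty && (exps φ).all fun A => !(A.all fun ψ => memb ψ Γ)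

open Classical in
/-- Whether `φ` has one of the forms `K_i ψ`, `¬K_i ψ`, `Kh_i ψ`, `¬Kh_i ψ`. -/
noncomputable def modal (i : I) (φ : Form P I) : Bool :=
  (unK φ ++ unKh φ ++ (unNeg φ).flatMap fun ψ => unK ψ ++ unKh ψ).any fun x => x.1 = i

open Classical in
/-- The labels of the successors at an "and" node. -/
noncomputable def succs (Γ : List (Form P I)) : List (List (Form P I)) :=
  (Γ.flatMap fun φ => (unNeg φ).flatMap unK).flatMap fun x =>
    (neg x.2 :: Γ.filter (modal x.1)) ::
      if memb (Kh x.1 x.2) Γ then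
        [K x.1 x.2] :: ((Γ.flatMap fun φ => (unNeg φ).flatMap unKh).filter fun y => y.1 = x.1).map
          fun y => [K x.1 x.2, neg (Kh x.1 y.2)]
      else []

/-- The labels of the successors, and whether it is an "and" node. -/
noncomputable def kids (Γ : List (Form P I)) : Bool × List (List (Form P I)) :=
  match Γ.filter (active Γ) with
  | [] => (true, succs Γ)
  | φ :: _ => (false, (exps φ).map (· ++ Γ))

namespace PS

variable {α : Type*} [Enc α]

theorem memb {f : α → Form P I} {l : α → List (Form P I)} (hf : PS f) (hl : PS l) :
    PS fun a => memb (f a) (l a) := by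
  classical
  exact hl.any ((snd.eq (hf.comp fst)).congr fun a => by congr)

theorem inconsistent : PS (inconsistent : List (Form P I) → Bool) := by
  classical
  exact PS.id.any (((snd.eq (const bot)).congr fun a => by congr).or
    ((snd (α := List (Form P I))).neg.memb fst))

theorem exps : PS (exps : Form P I → _) := by
  have h₁ : PS fun x : (Form P I × Form P I) × Form P I × Form P I => x.2.1 := fst.comp snd
  have h₂ : PS fun x : (Form P I × Form P I) × Form P I × Form P I => x.2.2 := snd.comp snd
  have h₃ : PS fun x : (Form P I × Form P I) × I × Form P I => x.2.1 := fst.comp snd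
  have h₄ : PS fun x : (Form P I × Form P I) × I × Form P I => x.2.2 := snd.comp snd
  have h₅ : PS fun x : Form P I × I × Form P I => x.2.1 := fst.comp snd
  have h₆ : PS fun x : Form P I × I × Form P I => x.2.2 := snd.comp snd
  refine ((((((append ?_ ?_).append ?_).append ?_).append ?_).append ?_).append ?_)
  · exact unNeg.flatMap ((unNeg.comp snd).map (snd.cons nil))
  · exact unAnd.map ((fst.comp snd).cons ((snd.comp snd).cons nil))
  · exact unNeg.flatMap ((unAnd.comp snd).flatMap ((h₁.neg.cons (h₂.neg.cons nil)).cons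
      ((h₁.neg.cons (h₂.cons nil)).cons ((h₁.cons (h₂.neg.cons nil)).cons nil))))
  · exact unK.map (h₆.cons nil)
  · exact unNeg.flatMap ((unK.comp snd).flatMap ((h₄.neg.cons nil).cons ((h₄.cons nil).cons nil)))
  · exact unKh.flatMap (((h₅.K h₆).neg.cons nil).cons (((h₅.K h₆).cons nil).cons nil))
  · exact unNeg.flatMap ((unKh.comp snd).map ((h₃.K h₄).neg.cons nil))

theorem active : PS fun x : List (Form P I) × Form P I => active x.1 x.2 := by
  refine (exps.comp snd).isEmpty.not.and ((exps.comp snd).all (not ?_))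
  exact snd.all (memb snd (fst.comp (fst.comp fst)))

theorem modal : PS fun x : I × Form P I => modal x.1 x.2 := by
  classical
  refine any ?_ (((fst.comp snd).eq (fst.comp fst)).congr fun a => by congr)
  exact ((unK.comp snd).append (unKh.comp snd)).append
    ((unNeg.comp snd).flatMap ((unK.comp snd).append (unKh.comp snd)))

theorem succs : PS (succs : List (Form P I) → _) := by
  classical
  have h₁ : PS fun x : List (Form P I) × I × Form P I => x.2.1 := fst.comp snd
  have h₂ : PS fun x : List (Form P I) × I × Form P I => x.2.2 := snd.comp snd
  have h₃ : PS fun Γ : List (Form P I) => Γ.flatMap fun φ => (ELKh.unNeg φ).flatMap ELKh.unK :=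
    PS.id.flatMap ((unNeg.comp snd).flatMap (unK.comp snd))
  have h₄ : PS fun Γ : List (Form P I) => Γ.flatMap fun φ => (ELKh.unNeg φ).flatMap ELKh.unKh :=
    PS.id.flatMap ((unNeg.comp snd).flatMap (unKh.comp snd))
  refine h₃.flatMap ((h₂.neg.cons (fst.filter (modal.comp ((h₁.comp fst).pair snd)))).cons ?_)
  refine (memb (h₁.Kh h₂) fst).cond (((h₁.K h₂).cons nil).cons ?_) nil
  refine ((h₄.comp fst).filter (((fst.comp snd).eq (h₁.comp fst)).congr fun a => by congr)).map ?_
  exact ((h₁.comp fst).K (h₂.comp fst)).cons (((h₁.comp fst).Kh (snd.comp snd)).neg.cons nil)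

theorem kids : PS (kids : List (Form P I) → _) := by
  refine (listCases (l := fun Γ : List (Form P I) => Γ.filter (ELKh.active Γ))
    (g := fun (Γ : List (Form P I)) φ _ => (false, (ELKh.exps φ).map (· ++ Γ)))
    (PS.id.filter active) ((const true).pair succs) ((const false).pair ?_)).congr fun Γ => ?_
  rotate_left
  · rw [ELKh.kids]
    rcases Γ.filter (ELKh.active Γ) with _ | ⟨φ, l⟩ <;> rfl
  exact (exps.comp (fst.comp snd)).map (snd.append (fst.comp fst))

end PS

end

end ELKh

namespace ELKh

open Function Form

section

variable {P I : Type*}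

/-! ## Correctness of the depth-bounded search -/

/-- The search for an open tableau, cut off at depth `k`. -/
noncomputable def opn : ℕ → List (Form P I) → Bool
  | 0, Γ => !inconsistent Γ
  | k + 1, Γ => !inconsistent Γ &&
      if (kids Γ).1 then (kids Γ).2.all (opn k) else (kids Γ).2.any (opn k)

/-- The set of the members of a list. -/
def toSet {α : Type*} (l : List α) : Set α := {x | x ∈ l}

@[simp]
theorem mem_toSet {α : Type*} {l : List α} {x : α} : x ∈ toSet l ↔ x ∈ l := Iff.rfl

@[simp]
theorem toSet_cons {α : Type*} {l : List α} {x : α} : toSet (x :: l) = insert x (toSet l) := by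
  ext y; simp

@[simp]
theorem toSet_nil {α : Type*} : toSet ([] : List α) = ∅ := by
  ext y; simp

@[simp]
theorem toSet_append {α : Type*} {l l' : List α} : toSet (l ++ l') = toSet l ∪ toSet l' := by
  ext y; simp

section

variable {φ ψ : Form P I} {x : I × Form P I}

@[simp]
theorem mem_unNeg : ψ ∈ unNeg φ ↔ φ = neg ψ := by
  cases φ <;> simp [unNeg, eq_comm]

@[simp]
theorem mem_unK : x ∈ unK φ ↔ φ = K x.1 x.2 := by
  cases φ <;> simp [unK, Prod.ext_iff, eq_comm]

@[simp]
theorem mem_unKh : x ∈ unKh φ ↔ φ = Kh x.1 x.2 := by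
  cases φ <;> simp [unKh, Prod.ext_iff, eq_comm]

end

theorem memb_iff {φ : Form P I} {Γ : List (Form P I)} : memb φ Γ = true ↔ φ ∈ Γ := by
  simp [memb]

theorem inconsistent_iff {Γ : List (Form P I)} :
    inconsistent Γ = true ↔ BlatantlyInconsistent (toSet Γ) := by
  simp only [inconsistent, List.any_eq_true, Bool.or_eq_true, decide_eq_true_eq, memb_iff,
    BlatantlyInconsistent, mem_toSet]
  constructor
  · rintro ⟨φ, h, rfl | h'⟩
    exacts [.inr h, .inl ⟨φ, h, h'⟩]
  · rintro (⟨φ, h, h'⟩ | h)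
    exacts [⟨φ, h, .inr h'⟩, ⟨bot, h, .inl rfl⟩]

theorem expansions_eq (φ : Form P I) : φ.expansions = (exps φ).map toSet := by
  rcases φ with _ | _ | (_ | _ | _ | _ | _ | _) | _ | _ | _ <;>
    simp [exps, unNeg, unAnd, unK, unKh, expansions]

theorem active_iff {Γ : List (Form P I)} {φ : Form P I} :
    active Γ φ = true ↔ Active (toSet Γ) φ := by
  simp only [active, Active, expansions_eq, Bool.and_eq_true, Bool.not_eq_true', List.all_eq_true,
    List.mem_map, forall_exists_index, and_imp, forall_apply_eq_imp_iff₂, ne_eq,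
    List.map_eq_nil_iff, ← Bool.not_eq_true, memb_iff]
  rw [List.isEmpty_iff]
  rfl

theorem modal_iff {i : I} {φ : Form P I} : modal i φ = true ↔ IsModal i φ := by
  simp only [modal, List.any_eq_true, List.mem_append, mem_unK, mem_unKh, List.mem_flatMap,
    mem_unNeg, decide_eq_true_eq, IsModal]
  constructor
  · rintro ⟨⟨j, ψ⟩, (h | h) | ⟨χ, rfl, h | h⟩, rfl⟩ <;> exact ⟨ψ, by simp_all⟩
  · rintro ⟨ψ, rfl | rfl | rfl | rfl⟩ <;> exact ⟨(i, ψ), by simp⟩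

theorem toSet_dia (i : I) (ψ : Form P I) (Γ : List (Form P I)) :
    toSet (neg ψ :: Γ.filter (modal i)) = diamondLabel i ψ (toSet Γ) := by
  ext φ
  simp [diamondLabel, modalPart, modal_iff, IsModal]

theorem mem_negK {Γ : List (Form P I)} {x : I × Form P I} :
    x ∈ (Γ.flatMap fun φ => (unNeg φ).flatMap unK) ↔ neg (K x.1 x.2) ∈ Γ := by
  simp

theorem mem_negKh {Γ : List (Form P I)} {x : I × Form P I} :
    x ∈ (Γ.flatMap fun φ => (unNeg φ).flatMap unKh) ↔ neg (Kh x.1 x.2) ∈ Γ := by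
  simp

theorem mem_succs {Γ Γ' : List (Form P I)} : Γ' ∈ succs Γ ↔ ∃ i ψ, neg (K i ψ) ∈ Γ ∧
    (Γ' = neg ψ :: Γ.filter (modal i) ∨ Kh i ψ ∈ Γ ∧ (Γ' = [K i ψ] ∨
      ∃ χ, neg (Kh i χ) ∈ Γ ∧ Γ' = [K i ψ, neg (Kh i χ)])) := by
  rw [succs, List.mem_flatMap, Prod.exists]
  refine exists_congr fun i => exists_congr fun ψ => ?_
  rw [mem_negK]
  refine and_congr_right fun _ => ?_
  rw [List.mem_cons]
  refine or_congr_right ?_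
  by_cases h : memb (Kh i ψ) Γ = true
  · rw [if_pos h, List.mem_cons, List.mem_map]
    simp only [memb_iff.1 h, true_and, List.mem_filter, mem_negKh, decide_eq_true_eq, Prod.exists]
    refine or_congr_right ⟨?_, ?_⟩
    · rintro ⟨j, χ, ⟨h₁, rfl⟩, rfl⟩
      exact ⟨χ, h₁, rfl⟩
    · rintro ⟨χ, h₁, rfl⟩
      exact ⟨i, χ, ⟨h₁, rfl⟩, rfl⟩
  · have h' : Kh i ψ ∉ Γ := fun h' => h (memb_iff.2 h')
    rw [if_neg h]
    simp [h']

theorem opn_consistent {k : ℕ} {Γ : List (Form P I)} (h : opn k Γ = true) :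
    ¬ BlatantlyInconsistent (toSet Γ) := by
  rw [← inconsistent_iff]
  cases k <;> simp_all [opn]

theorem kids_cases (Γ : List (Form P I)) :
    (kids Γ = (true, succs Γ) ∧ Saturated (toSet Γ)) ∨
      ∃ φ ∈ Γ, Active (toSet Γ) φ ∧ (Γ.filter (active Γ)).head? = some φ ∧
        kids Γ = (false, (exps φ).map (· ++ Γ)) := by
  rw [kids]
  rcases h : Γ.filter (active Γ) with _ | ⟨φ, l⟩
  · left
    refine ⟨rfl, fun φ hφ ha => ?_⟩
    have : φ ∈ Γ.filter (active Γ) := List.mem_filter.2 ⟨hφ, active_iff.2 ha⟩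
    simp [h] at this
  · right
    have : φ ∈ Γ.filter (active Γ) := by simp [h]
    obtain ⟨h₁, h₂⟩ := List.mem_filter.1 this
    exact ⟨φ, h₁, active_iff.1 h₂, rfl, rfl⟩

/-- The cut-off is harmless in this direction, because at depth 0 only consistency is tested. -/
theorem opn_of_good {Γ : List (Form P I)} (h : Good (toSet Γ)) (k : ℕ) : opn k Γ = true := by
  induction k generalizing Γ with
  | zero =>
    rw [opn, Bool.eq_false_iff.2 fun h' => h.not_inconsistent (inconsistent_iff.1 h'),
      Bool.not_false]
  | succ k ih =>
    have hc : inconsistent Γ = false :=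
      Bool.eq_false_iff.2 fun h' => h.not_inconsistent (inconsistent_iff.1 h')
    rw [opn, hc]
    rcases kids_cases Γ with ⟨hk, -⟩ | ⟨φ, hφ, ha, -, hk⟩
    · simp only [hk, Bool.not_false, Bool.true_and, if_true, List.all_eq_true]
      intro Γ' hΓ'
      refine ih ?_
      have hm := h.modalClosed
      obtain ⟨i, ψ, h₁, rfl | ⟨h₂, rfl | ⟨χ, h₃, rfl⟩⟩⟩ := mem_succs.1 hΓ'
      · rw [toSet_dia]
        exact hm.dia i ψ h₁
      · simpa using hm.how i ψ h₂ h₁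
      · simpa using hm.negHow i χ ψ h₃ h₂ h₁
    · simp only [hk, Bool.not_false, Bool.true_and, Bool.false_eq_true, if_false, List.any_eq_true]
      obtain ⟨A, hA, hg⟩ := h.expand hφ ha.1
      rw [expansions_eq] at hA
      obtain ⟨l, hl, rfl⟩ := List.mem_map.1 hA
      refine ⟨l ++ Γ, List.mem_map.2 ⟨l, hl, rfl⟩, ih ?_⟩
      rwa [toSet_append, Set.union_comm]

/-- The lists that the search computes for the nodes of the tableau. -/
noncomputable def listLabel (φ₀ : Form P I) : Node P I → List (Form P I)
  | [] => [φ₀]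
  | .expand φ k :: n => (exps φ).getD k [] ++ listLabel φ₀ n
  | .dia i ψ :: n => neg ψ :: (listLabel φ₀ n).filter (modal i)
  | .how i ψ :: _ => [K i ψ]
  | .negHow i χ ψ :: _ => [K i ψ, neg (Kh i χ)]

theorem toSet_listLabel (φ₀ : Form P I) (n : Node P I) :
    toSet (listLabel φ₀ n) = label φ₀ n := by
  induction n with
  | nil => simp [listLabel, label]
  | cons s n ih =>
    cases s with
    | expand φ k =>
      have : φ.expansions.getD k ∅ = toSet ((exps φ).getD k []) := by
        simp [expansions_eq, List.getD_eq_getElem?_getD]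
        cases (exps φ)[k]? <;> simp
      rw [listLabel, label, toSet_append, ih, Set.union_comm, this]
    | dia i ψ => rw [listLabel, label, toSet_dia, ih]
    | how i ψ => simp [listLabel, label]
    | negHow i χ ψ => simp [listLabel, label]

/-- Used to prescribe which formula the tableau expands. Elements are compared first by whether they
differ from the given one, then by an arbitrary linear order. -/
theorem exists_linearOrder_least {α : Type*} (p : Option α) :
    ∃ o : LinearOrder α, ∀ x ∈ p, ∀ y, y ≠ x → o.lt x y := by
  classical
  let o₁ : LinearOrder α := linearOrderOfSTO WellOrderingRel
  let f : α → Bool ×ₗ α := fun x => toLex (decide (some x ≠ p), x)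
  have hf : Injective f := fun x y h => by
    simp only [f, EmbeddingLike.apply_eq_iff_eq, Prod.mk.injEq] at h
    exact h.2
  refine ⟨LinearOrder.lift' f hf, fun x hx y hy => ?_⟩
  change f x < f y
  rw [Prod.Lex.lt_iff]
  left
  obtain rfl : p = some x := hx
  simp [f, hy]

/-- Since goodness does not mention orders, they may be chosen so that the tableau expands the
formula picked by the search. A node of length d then corresponds to a call with depth N - d. By
`length_le` the cut-off is never reached too early, and the successors in the tableau are among
those that the search examines. -/
theorem good_of_opn {φ₀ : Form P I} {N : ℕ} (hN : φ₀.subPlus.ncard ^ 6 ≤ N)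
    (h : opn N [φ₀] = true) : Good {φ₀} := by
  choose ord hord using fun n : Node P I => exists_linearOrder_least
    ((listLabel φ₀ n).filter (active (listLabel φ₀ n))).head?
  refine good_of_not_tableauClosed (ord := ord) fun hc => ?_
  obtain ⟨n, hn, hn'⟩ := hc _ <| isCompleteSubtree_of_forall_suffix
    (fun n => opn (N - n.length) (listLabel φ₀ n) = true) h
    (fun s n hs ha hq => by
      have hlen := (length_le hs).trans hN
      rw [List.length_cons] at hlen
      have hsat := saturated_of_allChecked hs.parent.1 ha
      rw [show N - n.length = N - (s :: n).length + 1 by simp; omega, opn, Bool.and_eq_true] at hq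
      rw [← toSet_listLabel] at hsat
      rcases kids_cases (listLabel φ₀ n) with ⟨hk, -⟩ | ⟨φ, hφ, hφa, -⟩
      · simp only [hk, if_true, List.all_eq_true] at hq
        refine hq.2 _ (mem_succs.2 ?_)
        cases hs with
        | expand _ _ _ hφ _ => exact absurd ha hφ.not_allChecked
        | dia _ _ _ _ hψ _ =>
          rw [← toSet_listLabel] at hψ
          exact ⟨_, _, hψ, .inl rfl⟩
        | how _ _ _ _ hψ hψ' =>
          rw [← toSet_listLabel] at hψ hψ'
          exact ⟨_, _, hψ', .inr ⟨hψ, .inl rfl⟩⟩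
        | negHow _ _ _ _ hχ hψ hψ' =>
          rw [← toSet_listLabel] at hχ hψ hψ'
          exact ⟨_, _, hψ', .inr ⟨hψ, .inr ⟨_, hχ, rfl⟩⟩⟩
      · exact absurd hφa (hsat φ hφ))
    (fun n φ hn hb hc hφ hq => by
      have hlen := (length_le (.expand hn hb hc hφ (List.length_pos_iff.2 hφ.1.2.2.1))).trans hN
      rw [List.length_cons] at hlen
      rw [show N - n.length = N - (n.length + 1) + 1 by omega, opn, Bool.and_eq_true] at hq
      rcases kids_cases (listLabel φ₀ n) with ⟨-, hs⟩ | ⟨χ, hχ, hχa, hhead, hk⟩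
      · rw [toSet_listLabel] at hs
        exact absurd hφ.1.2.2 (hs φ hφ.1.1)
      · rw [← mem_toSet, toSet_listLabel] at hχ
        rw [toSet_listLabel] at hχa
        -- As an active formula, `χ` is unchecked, and it is least in `ord n`, so no other formula
        -- can be the one expanded.
        obtain rfl : φ = χ := by
          by_contra hne
          exact hφ.2 χ hχ (fun h => not_active_of_checked hn h hχa) (hord n χ hhead φ hne) hχa
        simp only [hk, Bool.false_eq_true, if_false, List.any_eq_true, List.mem_map] at hq
        obtain ⟨-, _, ⟨l, hl, rfl⟩, hq⟩ := hq
        obtain ⟨k, hk, rfl⟩ := List.mem_iff_getElem.1 hl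
        refine ⟨k, by simpa [expansions_eq] using hk, ?_⟩
        simpa only [listLabel, List.getD_eq_getElem _ _ hk, List.length_cons] using hq)
  rw [← toSet_listLabel] at hn'
  exact opn_consistent (hn.2 n List.suffix_rfl) hn'

theorem opn_iff_good {φ₀ : Form P I} {N : ℕ} (hN : φ₀.subPlus.ncard ^ 6 ≤ N) :
    opn N [φ₀] = true ↔ Good {φ₀} :=
  ⟨good_of_opn hN, fun h => opn_of_good (by simpa using h) N⟩

/-! ## The search with an explicit stack -/

/-- A node of the search tree under evaluation: whether it is an "and" node, the depth that remains
for its successors, and the labels of the successors that remain. -/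
abbrev Frame (P I : Type*) := Bool × ℕ × List (List (Form P I))

/-- The evaluation of a label starts with this frame. -/
noncomputable def frame (Γ : List (Form P I)) (k : ℕ) : Frame P I :=
  if inconsistent Γ then (false, 0, [])
  else if k = 0 then (true, 0, [])
  else ((kids Γ).1, k.pred, (kids Γ).2)

/-- One step of the search. -/
noncomputable def dfsStep (s : List (Frame P I)) : List (Frame P I) :=
  match s with
  | [] => []
  | f :: r =>
    match f.2.2 with
    | [] =>
      match r with
      | [] => [f]
      | g :: r' => if f.1 = g.1 then g :: r' else (f.1, g.2.1, []) :: r'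
    | Γ :: l => frame Γ f.2.1 :: (f.1, f.2.1, l) :: r

/-- The search is not finished. -/
def dfsRunning (s : List (Frame P I)) : Bool :=
  match s with
  | [] => false
  | f :: r => !(f.2.2.isEmpty && r.isEmpty)

/-- The value of a frame. -/
noncomputable def value (t : Bool) (k : ℕ) (l : List (List (Form P I))) : Bool :=
  if t then l.all (opn k) else l.any (opn k)

theorem length_exps_le (φ : Form P I) : (exps φ).length ≤ 3 := by
  rcases φ with _ | _ | (_ | _ | _ | _ | _ | _) | _ | _ | _ <;>
    simp [exps, unNeg, unAnd, unK, unKh]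

theorem length_flatMap_le {α β : Type*} {l : List α} {g : α → List β} {m : ℕ}
    (h : ∀ x ∈ l, (g x).length ≤ m) : (l.flatMap g).length ≤ l.length * m := by
  induction l with
  | nil => simp
  | cons x l ih =>
    have h₁ := ih fun y hy => h y (by simp [hy])
    have h₂ := h x (by simp)
    simp only [List.flatMap_cons, List.length_append, List.length_cons, add_mul]
    omega

theorem length_succs_le (Γ : List (Form P I)) :
    (succs Γ).length ≤ Γ.length * (Γ.length + 2) := by
  have h₁ : ∀ φ : Form P I, ((unNeg φ).flatMap unK).length ≤ 1 := fun φ => by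
    rcases φ with _ | _ | (_ | _ | _ | _ | _ | _) | _ | _ | _ <;> simp [unNeg, unK]
  have h₂ : ∀ φ : Form P I, ((unNeg φ).flatMap unKh).length ≤ 1 := fun φ => by
    rcases φ with _ | _ | (_ | _ | _ | _ | _ | _) | _ | _ | _ <;> simp [unNeg, unKh]
  have h₃ := length_flatMap_le (l := Γ) fun φ _ => h₁ φ
  have h₄ := length_flatMap_le (l := Γ) fun φ _ => h₂ φ
  rw [mul_one] at h₃ h₄
  refine (length_flatMap_le (m := Γ.length + 2) fun x _ => ?_).trans (Nat.mul_le_mul_right _ h₃)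
  split
  · simp only [List.length_cons, List.length_map]
    classical
    have := (List.length_filter_le (fun y : I × Form P I => decide (y.1 = x.1))
      (Γ.flatMap fun φ => (unNeg φ).flatMap unKh)).trans h₄
    omega
  · simp

section sizes

variable [Enc P] [Enc I]

theorem esz_neg (φ : Form P I) : esz (neg φ) = esz φ + 4 := by
  change 3 + esz φ + 1 = _
  omega

theorem esz_and (φ ψ : Form P I) : esz (Form.and φ ψ) = esz φ + esz ψ + 11 := by
  change 9 + (esz φ + esz ψ + 1) + 1 = _
  omega

theorem esz_K (i : I) (φ : Form P I) : esz (K i φ) = esz i + esz φ + 7 := by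
  change 5 + (esz i + esz φ + 1) + 1 = _
  omega

theorem esz_Kh (i : I) (φ : Form P I) : esz (Kh i φ) = esz i + esz φ + 13 := by
  change 11 + (esz i + esz φ + 1) + 1 = _
  omega

/-- The list has at most `n` members, of sizes at most `W`. -/
def Small (n W : ℕ) (Γ : List (Form P I)) : Prop := Γ.length ≤ n ∧ ∀ φ ∈ Γ, esz φ ≤ W

theorem Small.esz_le {n W : ℕ} {Γ : List (Form P I)} (h : Small n W Γ) :
    esz Γ ≤ n * (W + 1) + 1 := esz_list_le h.1 h.2

theorem small_exps {φ : Form P I} {l : List (Form P I)} (h : l ∈ exps φ) : Small 2 (esz φ) l := by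
  rcases φ with _ | _ | (_ | _ | _ | _ | _ | _) | _ | _ | _ <;>
    simp [exps, unNeg, unAnd, unK, unKh] at h
  all_goals
    first
    | subst h
      simp only [Small, List.length_cons, List.length_nil, List.mem_cons, List.not_mem_nil,
        or_false, forall_eq_or_imp, forall_eq, esz_neg, esz_and, esz_K, esz_Kh]
      omega
    | rcases h with rfl | rfl | rfl <;>
      simp only [Small, List.length_cons, List.length_nil, List.mem_cons, List.not_mem_nil,
        or_false, forall_eq_or_imp, forall_eq, esz_neg, esz_and, esz_K, esz_Kh] <;>
      omega

/-- No successor contains a formula larger than those present, and at most two are added. As the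
lists may repeat formulas, their lengths are controlled by the depth of the search and not by
`subPlus`. -/
theorem small_kids {n W : ℕ} {Γ : List (Form P I)} (h : Small n W Γ) :
    (kids Γ).2.length ≤ n * (n + 2) + 3 ∧ ∀ Γ' ∈ (kids Γ).2, Small (n + 2) W Γ' := by
  have hn := h.1
  rcases kids_cases Γ with ⟨hk, -⟩ | ⟨φ, hφ, -, -, hk⟩
  · rw [hk]
    refine ⟨(length_succs_le Γ).trans ((Nat.mul_le_mul hn
      (Nat.add_le_add_right hn 2)).trans (Nat.le_add_right _ 3)), ?_⟩
    intro Γ' hΓ'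
    obtain ⟨i, ψ, h₁, rfl | ⟨h₂, rfl | ⟨χ, h₃, rfl⟩⟩⟩ := mem_succs.1 hΓ'
    · have h₁' := h.2 _ h₁
      rw [esz_neg, esz_K] at h₁'
      refine ⟨?_, ?_⟩
      · have := List.length_filter_le (modal i) Γ
        simp only [List.length_cons]
        omega
      · intro φ hφ
        rcases List.mem_cons.1 hφ with rfl | hφ
        · rw [esz_neg]; omega
        · exact h.2 φ (List.mem_filter.1 hφ).1
    · have h₁' := h.2 _ h₁
      rw [esz_neg] at h₁'
      refine ⟨by simp, fun φ hφ => ?_⟩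
      rw [List.mem_singleton.1 hφ]
      omega
    · have h₁' := h.2 _ h₁
      have h₃' := h.2 _ h₃
      rw [esz_neg] at h₁'
      refine ⟨by simp, fun φ hφ => ?_⟩
      simp only [List.mem_cons, List.not_mem_nil, or_false] at hφ
      rcases hφ with rfl | rfl
      · omega
      · exact h₃'
  · rw [hk]
    refine ⟨by simpa using (length_exps_le φ).trans (by omega), ?_⟩
    intro Γ' hΓ'
    obtain ⟨l, hl, rfl⟩ := List.mem_map.1 hΓ'
    have hs := small_exps hl
    refine ⟨?_, fun χ hχ => ?_⟩
    · have := hs.1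
      simp only [List.length_append]
      omega
    · rcases List.mem_append.1 hχ with hχ | hχ
      exacts [(hs.2 χ hχ).trans (h.2 φ hφ), h.2 χ hχ]

/-- A bound on the sizes of frames. -/
def frameBound (n N W : ℕ) : ℕ :=
  (n * (n + 2) + 3) * (n * (W + 1) + 2) + 2 * N + 8

theorem esz_frame_le {n N W k : ℕ} {t : Bool} {l : List (List (Form P I))} (hk : k ≤ N)
    (hl : l.length ≤ n * (n + 2) + 3) (h : ∀ Γ ∈ l, Small n W Γ) :
    esz (t, k, l) + 1 ≤ frameBound n N W := by
  have h₁ := esz_list_le hl fun Γ hΓ => (h Γ hΓ).esz_le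
  have h₂ := esz_bool_le t
  rw [esz_pair, esz_pair, esz_nat, frameBound]
  rw [add_assoc (n * (W + 1)), one_add_one_eq_two] at h₁
  omega

/-- The Boolean of a frame serves as its kind and as its value: an exhausted "and" frame is true, an
exhausted "or" frame false. A finished child with the Boolean of its parent leaves the parent
undecided; any other value decides it, and the remaining labels are dropped. One level down, `k`
decreases by 1 while `d` grows by 2, so `d + 2 * k ≤ n` keeps all labels within `n` formulas. -/
theorem dfs_iter {n N W M : ℕ} (k : ℕ) (t : Bool) (l : List (List (Form P I)))
    (st : List (Frame P I)) (hk : k ≤ N) (hl : l.length ≤ n * (n + 2) + 3) {d : ℕ}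
    (hd : d + 2 * k ≤ n) (h : ∀ Γ ∈ l, Small d W Γ)
    (hM : esz st + (k + 2) * frameBound n N W ≤ M) :
    Iter dfsStep dfsRunning M ((t, k, l) :: st) ((value t k l, k, []) :: st) := by
  induction k using Nat.strong_induction_on generalizing t l st d with
  | _ k ihk =>
  induction l generalizing t with
  | nil =>
    have hv : value t k ([] : List (List (Form P I))) = t := by cases t <;> rfl
    have := esz_frame_le (t := t) (W := W) (n := n) hk hl
      (fun Γ (hΓ : Γ ∈ ([] : List (List (Form P I)))) => by simp at hΓ)
    rw [hv]
    refine .refl ?_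
    rw [esz_cons]
    rw [add_mul] at hM
    omega
  | cons Γ l ihl =>
    have hmono : ∀ {m' : ℕ} {Γ' : List (Form P I)}, m' ≤ n → Small m' W Γ' → Small n W Γ' :=
      fun h h' => ⟨h'.1.trans h, h'.2⟩
    have hsz := esz_frame_le (t := t) (N := N) hk hl
      (fun Γ' hΓ' => hmono (m' := d) (by omega) (h Γ' hΓ'))
    have hl' : l.length ≤ n * (n + 2) + 3 := by simp at hl; omega
    have hsz' : ∀ t, esz ((t, k, l) : Frame P I) + 1 ≤ frameBound n N W := fun t =>
      esz_frame_le (t := t) (N := N) hk hl'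
        (fun Γ' hΓ' => hmono (m' := d) (by omega) (h Γ' (by simp [hΓ'])))
    have hnil : ∀ t k', k' ≤ N → esz ((t, k', []) : Frame P I) + 1 ≤ frameBound n N W :=
      fun t k' hk' => esz_frame_le hk' (by simp) (by simp)
    have hM' : esz st + 2 * frameBound n N W ≤ M :=
      le_trans (Nat.add_le_add_left (Nat.mul_le_mul_right _ (by omega)) _) hM
    -- The evaluation of one label ends in an exhausted frame with its value; the depth `k'` left in
    -- that frame plays no further role.
    have key : ∃ k' ≤ N, Iter dfsStep dfsRunning M (frame Γ k :: (t, k, l) :: st)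
        ((opn k Γ, k', []) :: (t, k, l) :: st) := by
      by_cases hc : inconsistent Γ = true
      · have : opn k Γ = false := by cases k <;> simp [opn, hc]
        refine ⟨0, by omega, ?_⟩
        rw [frame, if_pos hc, this]
        refine .refl ?_
        have := hnil false 0 (by omega)
        have := hsz' t
        simp only [esz_cons]
        omega
      rcases k with _ | k
      · refine ⟨0, by omega, ?_⟩
        rw [frame, if_neg hc, if_pos rfl, opn]
        simp only [hc, Bool.not_false]
        refine .refl ?_
        have := hnil true 0 (by omega)
        have := hsz' t
        simp only [esz_cons]
        omega
      · have hv : opn (k + 1) Γ = value (kids Γ).1 k (kids Γ).2 := by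
          rw [opn, value]
          simp only [hc, Bool.not_false, Bool.true_and]
        refine ⟨k, by omega, ?_⟩
        rw [frame, if_neg hc, if_neg (by omega), hv]
        have hsk := small_kids (h Γ (by simp))
        refine ihk k (by omega) _ _ _ (by omega) (hsk.1.trans ?_) (d := d + 2) (by omega) hsk.2 ?_
        · exact Nat.add_le_add_right (Nat.mul_le_mul (by omega) (by omega)) _
        · have := hsz' t
          rw [esz_cons]
          rw [show k + 1 + 2 = (k + 2) + 1 by omega, add_mul (k + 2) 1] at hM
          omega
    obtain ⟨k', hk', hkey⟩ := key
    refine .head ?_ rfl (Iter.trans (s' := (opn k Γ, k', []) :: (t, k, l) :: st) hkey ?_)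
    · rw [esz_cons]; omega
    refine .head ?_ rfl ?_
    · have := hnil (opn k Γ) k' hk'
      have := hsz' t
      simp only [esz_cons]
      omega
    change Iter _ _ M (if opn k Γ = t then (t, k, l) :: st else (opn k Γ, k, []) :: st) _
    by_cases ht : opn k Γ = t
    · have hv : value t k (Γ :: l) = value t k l := by
        cases t <;> simp [value, ht]
      rw [if_pos ht, hv]
      exact ihl t hl' fun Γ' hΓ' => h Γ' (by simp [hΓ'])
    · have hv : value t k (Γ :: l) = opn k Γ := by
        cases t <;> simp_all [value]
      rw [if_neg ht, hv]
      refine .refl ?_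
      have := hnil (opn k Γ) k hk
      rw [esz_cons]
      omega

end sizes

/-! ## The search takes polynomial space -/

namespace PS

variable [Enc P] [Enc I]

theorem frame : PS fun x : List (Form P I) × ℕ => frame x.1 x.2 := by
  refine (inconsistent.comp fst).cond (const _) (ite (eq snd (const 0)) (const _) ?_)
  exact (fst.comp (kids.comp fst)).pair ((pred.comp snd).pair (snd.comp (kids.comp fst)))

theorem dfsStep : PS (dfsStep : List (Frame P I) → _) := by
  have hinner : PS fun x : List (Frame P I) × Frame P I × List (Frame P I) =>
      match x.2.2 with
      | [] => [x.2.1]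
      | g :: r' => if x.2.1.1 = g.1 then g :: r' else (x.2.1.1, g.2.1, []) :: r' := by
    have hf : PS fun x : (List (Frame P I) × Frame P I × List (Frame P I)) × Frame P I ×
        List (Frame P I) => x.1.2.1.1 := fst.comp (fst.comp (snd.comp fst))
    refine (listCases (l := fun x : List (Frame P I) × Frame P I × List (Frame P I) => x.2.2)
      (f := fun x => [x.2.1]) (g := fun x g r' => if x.2.1.1 = g.1 then g :: r' else
        (x.2.1.1, g.2.1, []) :: r') (snd.comp snd) ((fst.comp snd).cons nil) ?_).congr
      fun ⟨_, _, r⟩ => by cases r <;> rfl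
    refine ite (eq hf (fst.comp (fst.comp snd))) ((fst.comp snd).cons (snd.comp snd)) ?_
    exact (hf.pair ((fst.comp (snd.comp (fst.comp snd))).pair nil)).cons (snd.comp snd)
  have hmid : PS fun x : List (Frame P I) × Frame P I × List (Frame P I) =>
      match x.2.1.2.2 with
      | [] =>
        match x.2.2 with
        | [] => [x.2.1]
        | g :: r' => if x.2.1.1 = g.1 then g :: r' else (x.2.1.1, g.2.1, []) :: r'
      | Γ :: l => ELKh.frame Γ x.2.1.2.1 :: (x.2.1.1, x.2.1.2.1, l) :: x.2.2 := by
    refine (listCases (l := fun x : List (Frame P I) × Frame P I × List (Frame P I) => x.2.1.2.2)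
      (g := fun x Γ l => ELKh.frame Γ x.2.1.2.1 :: (x.2.1.1, x.2.1.2.1, l) :: x.2.2)
      (snd.comp (snd.comp (fst.comp snd))) hinner ?_).congr fun ⟨_, ⟨_, _, l⟩, _⟩ => by
        cases l <;> rfl
    have hf : PS fun x : (List (Frame P I) × Frame P I × List (Frame P I)) × List (Form P I) ×
        List (List (Form P I)) => x.1.2.1 := fst.comp (snd.comp fst)
    exact (frame.comp ((fst.comp snd).pair (fst.comp (snd.comp hf)))).cons
      (((fst.comp hf).pair ((fst.comp (snd.comp hf)).pair (snd.comp snd))).cons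
        (snd.comp (snd.comp fst)))
  refine (listCases (l := fun s : List (Frame P I) => s) (f := fun _ => []) (g := fun _ f r =>
      match f.2.2 with
      | [] =>
        match r with
        | [] => [f]
        | g :: r' => if f.1 = g.1 then g :: r' else (f.1, g.2.1, []) :: r'
      | Γ :: l => ELKh.frame Γ f.2.1 :: (f.1, f.2.1, l) :: r) PS.id nil hmid).congr fun s => ?_
  rcases s with _ | ⟨f, r⟩ <;> rfl

theorem dfsRunning : PS (dfsRunning : List (Frame P I) → _) := by
  refine (listCases (l := fun s : List (Frame P I) => s) (f := fun _ => false)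
    (g := fun _ f r => !(f.2.2.isEmpty && r.isEmpty)) PS.id (const false) ?_).congr fun s => ?_
  · exact ((snd.comp (snd.comp (fst.comp snd))).isEmpty.and (snd.comp snd).isEmpty).not
  · rcases s with _ | ⟨f, r⟩ <;> rfl

/-- One initial formula and at most two more at each of `x.2` levels give the length `1 + 2 * x.2`.
Depths are in unary, so the resulting bound is polynomial in the input. -/
theorem opn : PS fun x : Form P I × ℕ => opn x.2 [x.1] := by
  have h : PS fun x : Form P I × ℕ => ([(ELKh.opn x.2 [x.1], x.2, [])] : List (Frame P I)) := by
    refine iter (g := fun x => [(true, x.2, [[x.1]])])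
      (b := fun x => 1 + (x.2 + 2) * frameBound (1 + 2 * x.2) x.2 (esz x.1)) dfsStep dfsRunning
      (((const true).pair (snd.pair ((fst.cons nil).cons nil))).cons nil) ?_ (fun x => ?_)
      fun x => rfl
    · have h₁ : PB fun x : Form P I × ℕ => x.2 := snd.pb.mono fun x => by
        simp only [esz_nat]; omega
      have h₂ : PB fun x : Form P I × ℕ => esz x.1 := fst.pb
      have h₃ := (PB.const 1).add ((PB.const 2).mul h₁)
      exact (PB.const 1).add ((h₁.add (.const 2)).mul ((((h₃.mul (h₃.add (.const 2))).add
        (.const 3)).mul ((h₃.mul (h₂.add (.const 1))).add (.const 2))).add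
        ((PB.const 2).mul h₁) |>.add (.const 8)))
    · have := dfs_iter (n := 1 + 2 * x.2) (N := x.2) (W := esz x.1)
        (M := 1 + (x.2 + 2) * frameBound (1 + 2 * x.2) x.2 (esz x.1)) x.2 true [[x.1]] [] le_rfl
        (by simp) (d := 1) (by omega)
        (by simp [Small]) (by rw [esz_nil])
      simpa [value] using this
  have hc : PS fun s : List (Frame P I) => s.any fun f => f.1 :=
    PS.id.any (fst.comp snd)
  exact (hc.comp h).congr fun x => by simp

end PS

end

end ELKh

namespace ELKh

open Function Form

/-! ## Reading formulas -/

/-- The second argument is compared with the finitely many possible values one after the other. -/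
theorem PS.finite_cases {α β σ : Type*} [Enc α] [Enc β] [Enc σ] [Finite σ] [Nonempty σ]
    {h : α → σ → β} (hh : ∀ s, PS fun a => h a s) : PS fun x : α × σ => h x.1 x.2 := by
  classical
  have := Fintype.ofFinite σ
  have key : ∀ L : List σ, ∃ g : α × σ → β, PS g ∧ ∀ x, x.2 ∈ L → g x = h x.1 x.2 := by
    intro L
    induction L with
    | nil => exact ⟨_, (hh (Classical.arbitrary σ)).comp fst, by simp⟩
    | cons s L ih =>
      obtain ⟨g, hg, hL⟩ := ih
      refine ⟨_, ite (c := fun x : α × σ => x.2 = s) (eq snd (const s)) ((hh s).comp fst) hg,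
        fun x hx => ?_⟩
      by_cases hs : x.2 = s
      · rw [if_pos hs, hs]
      · rw [if_neg hs]
        exact hL x ((List.mem_cons.1 hx).resolve_left hs)
  obtain ⟨g, hg, h'⟩ := key Finset.univ.toList
  exact hg.congr fun x => (h' x (by simp)).symm

noncomputable instance : Enc Sym :=
  ⟨fun s => enc (Fintype.equivFin Sym s : ℕ), fun _ _ h =>
    (Fintype.equivFin Sym).injective (Fin.val_injective (Enc.inj h))⟩

instance : Nonempty Sym := ⟨.bot⟩

/-- A bound on the sizes of the codes of symbols. -/
noncomputable def symBound : ℕ := 2 * Fintype.card Sym + 1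

theorem esz_sym_le (s : Sym) : esz s ≤ symBound := by
  have h : esz s = 2 * (Fintype.equivFin Sym s : ℕ) + 1 := esz_nat _
  have := (Fintype.equivFin Sym s).isLt
  rw [h, symBound]
  omega

/-- One step of the reading of a word from its end. The state consists of the name under construction
and of the list of the codes of the formulas read so far. -/
def parseStep (x : List Bool × Tree) : Sym → List Bool × Tree
  | .bot => ([], .cons (.cons (enc 0) .nil) x.2)
  | .neg => ([], .cons (.cons (enc 1) x.2.fst) x.2.snd)
  | .K => ([], .cons (.cons (enc 2) (.cons (enc x.1) x.2.fst)) x.2.snd)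
  | .letter => ([], .cons (.cons (enc 3) (enc x.1)) x.2)
  | .and => ([], .cons (.cons (enc 4) (.cons x.2.fst x.2.snd.fst)) x.2.snd.snd)
  | .Kh => ([], .cons (.cons (enc 5) (.cons (enc x.1) x.2.fst)) x.2.snd)
  | .endMark => ([], x.2)
  | .bit b => (b :: x.1, x.2)

/-- The code of the formula that is written in reverse as `l`. -/
def parse (l : List Sym) : Tree := (l.foldl parseStep ([], .nil)).2.fst

namespace PS

theorem tree_cons {α : Type*} [Enc α] {f g : α → Tree} (hf : PS f) (hg : PS g) :
    PS fun a => Tree.cons (f a) (g a) :=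
  (hf.pair hg).of_enc fun _ => rfl

theorem parseStep : PS fun x : (List Bool × Tree) × Sym => parseStep x.1 x.2 := by
  refine finite_cases (h := ELKh.parseStep) fun s => ?_
  have hn : PS fun x : List Bool × Tree => enc x.1 := tree.comp fst
  have h₁ : PS fun x : List Bool × Tree => x.2.fst := tree_fst.comp snd
  have h₂ : PS fun x : List Bool × Tree => x.2.snd := tree_snd.comp snd
  cases s with
  | bot => exact nil.pair ((const _).tree_cons snd)
  | neg => exact nil.pair (((const _).tree_cons h₁).tree_cons h₂)
  | K => exact nil.pair (((const _).tree_cons (hn.tree_cons h₁)).tree_cons h₂)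
  | letter => exact nil.pair (((const _).tree_cons hn).tree_cons snd)
  | and =>
    exact nil.pair (((const _).tree_cons (h₁.tree_cons (tree_fst.comp h₂))).tree_cons
      (tree_snd.comp h₂))
  | Kh => exact nil.pair (((const _).tree_cons (hn.tree_cons h₁)).tree_cons h₂)
  | endMark => exact nil.pair snd
  | bit b => exact ((const b).cons fst).pair snd

end PS

theorem Tree.sz_fst_add_sz_snd_le (x : Tree) : x.fst.sz + x.snd.sz ≤ x.sz + 1 := by
  cases x <;> simp only [sz, fst, snd] <;> omega

/-- Codes already built are moved and never copied, so each symbol adds only a constant. -/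
theorem esz_parseStep_le (x : List Bool × Tree) (s : Sym) :
    esz (parseStep x s) ≤ esz x + 20 := by
  obtain ⟨n, t⟩ := x
  have h₀ : (enc n).sz = esz n := rfl
  have h₁ := esz_pos n
  have h₂ := t.sz_fst_add_sz_snd_le
  have h₃ := t.snd.sz_fst_add_sz_snd_le
  have hc (k : ℕ) : (enc k).sz = 2 * k + 1 := esz_nat k
  cases s with
  | bit b =>
    have := esz_bool_le b
    simp only [parseStep, esz_pair, esz_cons]
    omega
  | _ =>
    simp only [parseStep, esz_pair, esz_nil, esz_tree, Tree.sz, hc, h₀]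
    omega

theorem PS.parse : PS parse := by
  have h : PS fun l : List Sym => l.foldl ELKh.parseStep ([], .nil) := by
    refine foldl (l := fun l : List Sym => l) (g := fun _ => ([], Tree.nil))
      (h := fun _ => ELKh.parseStep) (b := fun l => 20 * esz l + 3) PS.id (const _)
      (parseStep.comp snd) (((PB.const 20).mul PB.esz).add (.const 3)) fun l l' hl => ?_
    have key : ∀ (l : List Sym) (x : List Bool × Tree),
        esz (l.foldl ELKh.parseStep x) ≤ esz x + 20 * l.length := by
      intro l
      induction l with
      | nil => simp
      | cons s l ih =>
        intro x
        have h₁ := ih (ELKh.parseStep x s)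
        have h₂ := esz_parseStep_le x s
        simp only [List.foldl_cons, List.length_cons]
        omega
    have h₁ := key l' ([], .nil)
    have h₂ := hl.length_le.trans (length_le_esz l)
    have h₃ : esz (([], .nil) : List Bool × Tree) = 3 := rfl
    omega
  exact tree_fst.comp (snd.comp h)

section

variable {P I : Type*} (nameP : P ↪ List Bool) (nameI : I ↪ List Bool)

/-- Things are coded by their names. -/
abbrev encName (nameP : P ↪ List Bool) : Enc P :=
  ⟨fun p => enc (nameP p), fun _ _ h => nameP.injective (Enc.inj h)⟩

/-- A formula, to be coded by the reverse of the word that represents it. -/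
structure Written (nameP : P ↪ List Bool) (nameI : I ↪ List Bool) where
  /-- the formula -/
  form : Form P I

noncomputable instance : Enc (Written nameP nameI) :=
  ⟨fun x => enc (x.form.encode nameP nameI).reverse, fun ⟨_⟩ ⟨_⟩ h =>
    congrArg _ (encode_injective nameP nameI (List.reverse_injective (Enc.inj h)))⟩

theorem foldr_writeName (w n : List Bool) (t : Tree) :
    (writeName w).foldr (fun s x => parseStep x s) (n, t) = (w, t) := by
  induction w with
  | nil => rfl
  | cons b w ih =>
    change parseStep ((writeName w).foldr _ _) (.bit b) = _
    rw [ih]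
    rfl

/-- In Polish notation read from the end, the operands are on top of the stack when the operator
arrives. The buffer `n` is arbitrary, since the end mark of a name is read before its bits and
clears it. -/
theorem foldr_encode (φ : Form P I) (n : List Bool) (t : Tree) :
    letI := encName nameP
    letI := encName nameI
    (φ.encode nameP nameI).foldr (fun s x => parseStep x s) (n, t) = ([], .cons (enc φ) t) := by
  let _ := encName nameP
  let _ := encName nameI
  induction φ generalizing n t with
  | bot => rfl
  | letter p =>
    rw [Form.encode, List.foldr_cons, foldr_writeName]
    rfl
  | neg φ ih =>
    rw [Form.encode, List.foldr_cons, ih]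
    rfl
  | and φ ψ ih ih' =>
    rw [Form.encode, List.foldr_cons, List.foldr_append, ih', ih]
    rfl
  | K i φ ih | Kh i φ ih =>
    rw [Form.encode, List.foldr_cons, List.foldr_append, ih, foldr_writeName]
    rfl

theorem parse_encode (φ : Form P I) :
    letI := encName nameP
    letI := encName nameI
    parse (φ.encode nameP nameI).reverse = enc φ := by
  rw [parse, List.foldl_reverse, foldr_encode]
  rfl

theorem ncard_sub_le (φ : Form P I) : φ.sub.ncard ≤ (φ.encode nameP nameI).length := by
  induction φ with
  | bot => simp [sub, Form.encode]
  | letter p => simp [sub, Form.encode]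
  | neg φ ih =>
    refine (Set.ncard_insert_le _ _).trans ?_
    simp only [Form.encode, List.length_cons]
    omega
  | and φ ψ ih ih' =>
    refine (Set.ncard_insert_le _ _).trans ?_
    have := Set.ncard_union_le φ.sub ψ.sub
    simp only [Form.encode, List.length_cons, List.length_append]
    omega
  | K i φ ih | Kh i φ ih =>
    refine (Set.ncard_insert_le _ _).trans ?_
    simp only [Form.encode, List.length_cons, List.length_append]
    omega

/-- Whether the tableau is closed, as computed by the depth-bounded search. -/
noncomputable def closed (φ : Form P I) : Bool :=
  !opn ((4 * (φ.encode nameP nameI).length) ^ 6) [φ]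

/-- By `ncard_subPlus_le` and `ncard_sub_le`, m is at most four times the length of the word, so the
search is deep enough. -/
theorem closed_iff (ord : Node P I → LinearOrder (Form P I)) (φ : Form P I) :
    closed nameP nameI φ = true ↔ TableauClosed ord φ := by
  have h := (ncard_subPlus_le φ).trans (Nat.mul_le_mul_left 4 (ncard_sub_le nameP nameI φ))
  rw [tableauClosed_iff, ← opn_iff_good (Nat.pow_le_pow_left h 6), closed, Bool.not_eq_true',
    Bool.not_eq_true]

theorem PS.closed : PS fun x : Written nameP nameI => closed nameP nameI x.form := by
  let _ := encName nameP
  let _ := encName nameI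
  -- The code of a `Written` formula already is the code of its reversed word, which is what reading
  -- the input leaves on the stack.
  have hw : PS fun x : Written nameP nameI => (x.form.encode nameP nameI).reverse :=
    PS.id.of_enc fun _ => rfl
  have hf : PS (Written.form : Written nameP nameI → Form P I) :=
    (parse.comp hw).of_enc fun x => (parse_encode nameP nameI x.form).symm
  have hn : PS fun x : Written nameP nameI => (4 * (x.form.encode nameP nameI).length) ^ 6 :=
    (((hw.append hw).append (hw.append hw)).length_pow 6).congr fun x => by
      simp only [List.length_append, List.length_reverse]
      congr 1
      omega
  exact (opn.comp (hf.pair hn)).not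

end

/-! ## The machine -/

namespace Prog

/-- Push a word on the stack `main`. -/
def pushAll : List Bool → TreeProg
  | [] => skip
  | b :: l => seq (pushAll l) (push (some .main) b)

theorem run_pushAll (l : List Bool) {B : ℕ} {w : List Sym} {o a s : List Bool}
    (hB : w.length + o.length + l.length + a.length + s.length ≤ B) :
    Run B (pushAll l) (stackOf w o a s [] []) (stackOf w o (l ++ a) s [] []) := by
  induction l with
  | nil => exact .skip (by simp at hB ⊢; omega)
  | cons b l ih =>
    simp only [List.length_cons] at hB
    exact .seq (ih (by omega)) (run_push_main (by simp; omega))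

/-- Read the input. -/
noncomputable def readInput : TreeProg :=
  loop none fun s => pushAll (true :: (enc s).ser)

/-- Pushing the code of a symbol and then `true` on the code of a list gives the code of the
extended list, so the word ends up reversed. -/
theorem run_readInput (w l : List Sym) {B : ℕ}
    (hB : w.length * (symBound + 2) + esz l ≤ B) :
    Run B readInput (stackOf w [] (enc l).ser [] [] [])
      (stackOf [] [] (enc (w.reverse ++ l)).ser [] [] []) := by
  induction w generalizing l with
  | nil => exact .loop_nil (by simpa [esz] using hB) rfl
  | cons s w ih =>
    have hs := esz_sym_le s
    have he : (enc s).sz = esz s := rfl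
    have hl : (enc l).sz = esz l := rfl
    have hw := Nat.mul_le_mul_left w.length (show 1 ≤ symBound + 2 by omega)
    rw [List.length_cons, add_mul] at hB
    refine .loop_cons (g := s) (r := w) (s' := stackOf w [] (enc (s :: l)).ser [] [] [])
      (by simp; omega) rfl ?_ ?_
    · have := run_pushAll (true :: (enc s).ser) (B := B) (w := w) (o := []) (a := (enc l).ser)
        (s := []) (by simp; omega)
      simpa [enc_cons, Tree.ser] using this
    · have := ih (s :: l) (by rw [esz_cons]; omega)
      simpa [readInput] using this

/-- Move the code of a truth value to the output. -/
def writeOutput : TreeProg :=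
  pop (some .main) fun x =>
    if x = some true then
      seq (pop (some .main) fun _ => skip)
        (seq (pop (some .main) fun _ => skip) (push (some .out) true))
    else push (some .out) false

theorem run_writeOutput (b : Bool) {B : ℕ} (hB : 3 ≤ B) :
    Run B writeOutput (stackOf [] [] (enc b).ser [] [] []) (stackOf [] [b] [] [] [] []) := by
  cases b with
  | false => exact run_pop_main (by simp; omega) (run_push_out (by simp))
  | true =>
    refine run_pop_main (a := [false, false]) (by simpa using hB) ?_
    rw [if_pos rfl]
    exact .seq (run_pop_main (by simp; omega) (.skip (by simp; omega)))
      (.seq (run_pop_main (by simp; omega) (.skip (by simp))) (run_push_out (by simp)))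

theorem single_none (w : List Sym) : single (Γ := Alph) none w = stackOf w [] [] [] [] [] := by
  funext k; rcases k with _ | _ | _ | _ | _ | _ <;> rfl

theorem single_out (u : List Bool) :
    single (Γ := Alph) (some .out) u = stackOf [] u [] [] [] [] := by
  funext k; rcases k with _ | _ | _ | _ | _ | _ <;> rfl

end Prog

theorem PS.exists_machine {α : Type*} [Enc α] {word : α → List Sym}
    (hword : ∀ a, enc a = enc (word a).reverse) {f : α → Bool} (hf : PS f) :
    ∃ M : Turing.TM2ComputableAux Sym Bool,
      RunsInPolySpace M word ∧ ∀ a, Answers M (word a) (f a) := by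
  obtain ⟨p, k, hp⟩ := hf
  let q : Prog.TreeProg :=
    .seq (.push (some .main) false) (.seq Prog.readInput (.seq p Prog.writeOutput))
  let B : ℕ → ℕ := fun n => (symBound + 2) * n + 3 + ((symBound + 1) * n + 3) ^ k
  have hq (a : α) : Prog.Run (B (word a).length) q (single none (word a))
      (single (some .out) [f a]) := by
    have hE : esz a ≤ (symBound + 1) * (word a).length + 1 := by
      rw [esz, hword, mul_comm]
      exact esz_list_le (by simp) fun s _ => esz_sym_le s
    have hpow := Nat.pow_le_pow_left (Nat.add_le_add_right hE 2) k
    have hn := Nat.mul_le_mul_right (word a).length (show 1 ≤ symBound + 2 by omega)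
    rw [Prog.single_none, Prog.single_out]
    refine .seq (Prog.run_push_main (by simp [B]; omega)) (.seq (Prog.run_readInput (word a) []
      ?_) (.seq (s' := stackOf [] [] (enc (f a)).ser [] [] []) ?_ (Prog.run_writeOutput _ ?_)))
    · simp only [B, esz_nil, mul_comm (word a).length]
      omega
    · have := (hp a).2.2 [] [] [] [] (B (word a).length) (by
        simp only [B, List.length_nil]
        change (esz a + 2) ^ k ≤ ((symBound + 1) * (word a).length + 3) ^ k at hpow
        omega)
      simpa [hword] using this
    · simp only [B]
      omega
  have hu (n : ℕ) : 1 ≤ B n := by simp only [B]; omega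
  -- The input of the machine is `word a` mapped by the identity, which is equal to `word a` only by
  -- `List.map_id`; hence the variable `u`.
  have hout (a : α) : ∀ u, u = word a →
      Nonempty (Turing.TM2Outputs (q.toTM none (some .out)) u (some [f a])) ∧
      ∀ c, StateTransition.Reaches (q.toTM none (some .out)).step
        (Turing.initList (q.toTM none (some .out)) u) c →
          space (q.toTM none (some .out)) c ≤ B (word a).length := by
    rintro _ rfl
    exact (hq a).outputs (hu _)
  have hfin (k : Option Wk) : Finite (Alph k) := inferInstance
  refine ⟨⟨q.toTM none (some .out), Equiv.refl _, Equiv.refl _⟩,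
    ⟨hfin, ?_⟩,
    fun a => (hout a _ (List.map_id _)).1⟩
  refine ⟨.C (symBound + 2) * .X + .C 3 + (.C (symBound + 1) * .X + .C 3) ^ k, fun a c hc => ?_⟩
  simp only [Polynomial.eval_add, Polynomial.eval_mul, Polynomial.eval_C, Polynomial.eval_X,
    Polynomial.eval_pow]
  exact (hout a _ (List.map_id _)).2 c hc

end ELKh

theorem mainTheorem2 {P : Type*} {I : Type*} [Nontrivial I]
    (nameP : P ↪ List Bool) (nameI : I ↪ List Bool) :
    (∃ M : Turing.TM2ComputableAux ELKh.Sym Bool,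
      ELKh.RunsInPolySpace M (ELKh.Form.encode nameP nameI) ∧
      ∀ (φ₀ : ELKh.Form P I) (ord : ELKh.Node P I → LinearOrder (ELKh.Form P I)),
        (ELKh.TableauClosed ord φ₀ → ELKh.Answers M (φ₀.encode nameP nameI) true) ∧
        (¬ ELKh.TableauClosed ord φ₀ → ELKh.Answers M (φ₀.encode nameP nameI) false)) ∧
    (∀ (φ₀ : ELKh.Form P I) (ord : ELKh.Node P I → LinearOrder (ELKh.Form P I))
        (n : ELKh.Node P I), ELKh.IsNode ord φ₀ n →
      (ELKh.children ord φ₀ n).encard ≤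
        ((φ₀.subPlus.ncard + φ₀.subPlus.ncard ^ 2 + φ₀.subPlus.ncard ^ 3 : ℕ) : ℕ∞) ∧
      n.length ≤ φ₀.subPlus.ncard ^ 6) := by
  refine ⟨?_, fun φ₀ ord n hn => ⟨ELKh.encard_children_le hn, ELKh.length_le hn⟩⟩
  obtain ⟨M, ⟨hfin, p, hp⟩, hM⟩ := (ELKh.PS.closed nameP nameI).exists_machine
    (word := fun x => x.form.encode nameP nameI) fun _ => rfl
  refine ⟨M, ⟨hfin, p, fun φ => hp ⟨φ⟩⟩, fun φ ord => ?_⟩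
  have h : ELKh.Answers M _ (ELKh.closed nameP nameI φ) := hM ⟨φ⟩
  have h' := ELKh.closed_iff nameP nameI ord φ
  constructor <;> intro hc
  · rwa [h'.2 hc] at h
  · rwa [Bool.eq_false_iff.2 fun h₀ => hc (h'.1 h₀)] at h
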